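/- Let $m\in\mathbb C$, let $\delta\ge 1+2\max(-\operatorname{Re} m,0)$, and let $Q\in L^1_{\mathrm{loc}}]0,\infty[$ be complex-valued with $$\int_1^\infty x^{\delta}|Q(x)|\,dx<\infty\ \text{ if } m\neq0,\qquad \int_1^\infty x^{\delta}(1+\ln x)|Q(x)|\,dx<\infty\ \text{ if } m=0 .$$ Write $L_{m^2}=-\partial_x^2+(m^2-\tfrac14)x^{-2}+Q(x)$, acting on $AC^1]0,\infty[$ (the functions with locally absolutely continuous derivative on $]0,\infty[$). Let $G^0_\leftarrow$ be the zero-energy backward Green's operator of $-\partial_x^2+(m^2-\frac14)x^{-2}$, $$(G^0_\leftarrow f)(x)=-\int_x^\infty G^0_\leftrightarrow(x,y)f(y)\,dy,\qquad G^0_\leftrightarrow(x,y)=\begin{cases}\frac1{2m}\big(x^{\frac12-m}y^{\frac12+m}-x^{\frac12+m}y^{\frac12-m}\big),&m\ne0,\\ x^{\frac12}y^{\frac12}(\ln y-\ln x),&m=0.\end{cases}$$ Then for every $a>0$ the operator $1+G^0_\leftarrow Q$ is bounded and invertible on the space of measurable $f$ on $]a,\infty[$ with $\operatorname{ess\,sup}_{x>a}|f(x)|x^{-\frac12+\operatorname{Re}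 m}<\infty$, and the function $$q_{-m}:=(1+G^0_\leftarrow Q)^{-1}\,x^{\frac12-m}$$ on $]0,\infty[$ (so that $(1+G^0_\leftarrow Q)^{-1}u^0_{-m}(\cdot,0)=q_{-m}/\Gamma(1-m)$ for $u^0_{-m}(x,0)=x^{\frac12-m}/\Gamma(1-m)$, with $1/\Gamma:=0$ at the poles of $\Gamma$) is the unique solution in $AC^1]0,\infty[$ of $L_{m^2}q=0$ such that, as $x\to\infty$, $$q_{-m}(x)-x^{\frac12-m}=o\big(x^{\frac32-\operatorname{Re} m-\delta}\big),\qquad \partial_xq_{-m}(x)-\partial_xx^{\frac12-m}=o\big(x^{\frac12-\operatorname{Re} m-\delta}\big).$$ Moreover, let $\operatorname{Re} m>0$. For $\operatorname{Re}k\ge0$, $k\ne0$, let $w_m^0(x,k)=\sqrt{2kx/\pi}\,K_m(kx)$, with $K_m$ the Macdonald function. Then there is a unique Jost solution $w_m(\cdot,k)\in AC^1]0,\infty[$ of $L_{m^2}w=-k^2w$ with $w_m-w_m^0=o(e^{-x\operatorname{Re}k})$ and $\partial_xw_m-\partial_xw_m^0=o(e^{-x\operatorname{Re}k})$ as $x\to\infty$;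 and, with $v_m(x,k)=\sqrt{\frac{\pi}{2k}}\big(\frac k2\big)^m w_m(x,k)$ (principal branches), for every $x>0$ $$\lim_{k\to0,\ \operatorname{Re}k\ge0,\ k\neq0}v_m(x,k)=\tfrac12\Gamma(m)\,q_{-m}(x).$$ -/

import Mathlib

open Filter Topology MeasureTheory Set Asymptotics
open scoped ENNReal NNReal

namespace PerturbedBessel

noncomputable section

/-- The class `𝓛^{(∞)}_δ`: `Q ∈ L¹_loc ]0,∞[` with `∫₁^∞ x^δ |Q(x)| dx < ∞`. -/
def potInfty (δ : ℝ) : Set (ℝ → ℂ) :=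
  {Q | LocallyIntegrableOn Q (Ioi 0) ∧
    IntegrableOn (fun x : ℝ => x ^ δ * ‖Q x‖) (Ioi 1)}

/-- The class `𝓛^{(∞)}_{δ,ln}`: `Q ∈ L¹_loc ]0,∞[` with
`∫₁^∞ x^δ (1 + ln x) |Q(x)| dx < ∞`. -/
def potInftyLog (δ : ℝ) : Set (ℝ → ℂ) :=
  {Q | LocallyIntegrableOn Q (Ioi 0) ∧
    IntegrableOn (fun x : ℝ => x ^ δ * (1 + Real.log x) * ‖Q x‖) (Ioi 1)}

/-- `g ∈ AC¹]0,∞[`: `g` is differentiable on `]0,∞[` and `g'` is absolutely continuous on every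
compact subinterval of `]0,∞[`. Values of `g` outside `]0,∞[` are irrelevant. -/
def IsAC1 (g : ℝ → ℂ) : Prop :=
  (∀ x : ℝ, 0 < x → DifferentiableAt ℝ g x) ∧
    ∀ a b : ℝ, 0 < a → a ≤ b → AbsolutelyContinuousOnInterval (deriv g) a b

/-- `g ∈ AC¹]0,∞[` solves `(-∂ₓ² + (m² - 1/4) x⁻² + Q(x)) g = -k² g`
(an identity in `L¹_loc ]0,∞[`, that is, almost everywhere). -/
def IsEigensolution (m k : ℂ) (Q g : ℝ → ℂ) : Prop :=
  IsAC1 g ∧ ∀ᵐ x ∂(volume.restrict (Ioi (0 : ℝ))),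
    -deriv (deriv g) x + ((m ^ 2 - 1 / 4) / (x : ℂ) ^ 2 + Q x) * g x = -k ^ 2 * g x

/-- The canonical bisolution `G⁰_↔(x,y)` of `-∂ₓ² + (m² - 1/4) x⁻²` (energy zero). -/
def bisolution (m : ℂ) (x y : ℝ) : ℂ :=
  if m = 0 then
    (x : ℂ) ^ (1 / 2 : ℂ) * (y : ℂ) ^ (1 / 2 : ℂ) * ((Real.log y : ℂ) - (Real.log x : ℂ))
  else
    1 / (2 * m) * ((x : ℂ) ^ (1 / 2 - m) * (y : ℂ) ^ (1 / 2 + m)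
      - (x : ℂ) ^ (1 / 2 + m) * (y : ℂ) ^ (1 / 2 - m))

/-- The zero-energy backward Green's operator composed with multiplication by `Q`,
`(G⁰_← Q f)(x) = - ∫_x^∞ G⁰_↔(x,y) Q(y) f(y) dy`. -/
def backwardGreen (m : ℂ) (Q f : ℝ → ℂ) (x : ℝ) : ℂ :=
  -∫ y in Ioi x, bisolution m x y * Q y * f y

/-- The norm of `L^∞(]a,∞[, φ)`: the essential supremum of `|f / φ|` over `]a,∞[`. -/
def wnorm (a : ℝ) (φ : ℝ → ℝ) (f : ℝ → ℂ) : ℝ≥0∞ :=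
  eLpNorm (fun x => f x / (φ x : ℂ)) ⊤ (volume.restrict (Ioi a))

/-- `f ∈ L^∞(]a,∞[, φ)`. -/
def MemWeighted (a : ℝ) (φ : ℝ → ℝ) (f : ℝ → ℂ) : Prop :=
  AEStronglyMeasurable f (volume.restrict (Ioi a)) ∧ wnorm a φ f < ⊤

/-- `G⁰_← Q` is given by absolutely convergent integrals on `L^∞(]a,∞[, φ)` and is a bounded
operator there. -/
def BackwardGreenBounded (m : ℂ) (Q : ℝ → ℂ) (a : ℝ) (φ : ℝ → ℝ) : Prop :=
  ∃ C : ℝ≥0, ∀ f : ℝ → ℂ, MemWeighted a φ f →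
    (∀ x ∈ Ioi a, IntegrableOn (fun y => bisolution m x y * Q y * f y) (Ioi x)) ∧
    MemWeighted a φ (backwardGreen m Q f) ∧
    wnorm a φ (backwardGreen m Q f) ≤ C * wnorm a φ f

/-- `1 + G⁰_← Q` is a bijection of `L^∞(]a,∞[, φ)` (functions modulo equality almost
everywhere). -/
def OneAddBackwardGreenBijective (m : ℂ) (Q : ℝ → ℂ) (a : ℝ) (φ : ℝ → ℝ) : Prop :=
  ∀ h : ℝ → ℂ, MemWeighted a φ h →
    ∃ f : ℝ → ℂ, MemWeighted a φ f ∧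
      (∀ᵐ x ∂(volume.restrict (Ioi a)), f x + backwardGreen m Q f x = h x) ∧
      ∀ f' : ℝ → ℂ, MemWeighted a φ f' →
        (∀ᵐ x ∂(volume.restrict (Ioi a)), f' x + backwardGreen m Q f' x = h x) →
        ∀ᵐ x ∂(volume.restrict (Ioi a)), f' x = f x

/-- `q = (1 + G⁰_← Q)⁻¹ u` on `]0,∞[`: for every `a > 0` the operator `1 + G⁰_← Q` is bounded and
invertible on `L^∞(]a,∞[, φ)`, the functions `u` and `q` belong to this space, and
`(1 + G⁰_← Q) q = u`. -/
def IsBackwardInverse (m : ℂ) (Q : ℝ → ℂ) (φ : ℝ → ℝ) (u q : ℝ → ℂ) : Prop :=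
  ∀ a : ℝ, 0 < a →
    BackwardGreenBounded m Q a φ ∧ OneAddBackwardGreenBijective m Q a φ ∧
    MemWeighted a φ u ∧ MemWeighted a φ q ∧
    ∀ x ∈ Ioi a, q x + backwardGreen m Q q x = u x

/-- The zero-energy unperturbed solution `u⁰_m(x,0) = x^{1/2+m} / Γ(1+m)`
(it is `0` if `m` is a negative integer). -/
def uZero (m : ℂ) (x : ℝ) : ℂ :=
  (x : ℂ) ^ (1 / 2 + m) / Complex.Gamma (1 + m)

/-- The 1d Macdonald function `𝒦_m(z) = √(2z/π) K_m(z)` for `Re z ≥ 0`, `z ≠ 0`, where `K_m` is the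
usual Macdonald function, through the classical integral
`K_μ(z) = √(π/(2z)) e^{-z} / Γ(μ+1/2) ∫₀^∞ e^{-s} s^{μ-1/2} (1 + s/(2z))^{μ-1/2} ds`,
valid for `|arg z| < π`, `Re μ > -1/2` (including the imaginary axis in `z`), and `K_m = K_{-m}`. -/
def macdonald1d (m z : ℂ) : ℂ :=
  let μ : ℂ := if 0 ≤ m.re then m else -m
  Complex.exp (-z) / Complex.Gamma (μ + 1 / 2) *
    ∫ s in Ioi (0 : ℝ), Complex.exp (-(s : ℂ)) * (s : ℂ) ^ (μ - 1 / 2) *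
      (1 + (s : ℂ) / (2 * z)) ^ (μ - 1 / 2)

/-- The unperturbed Jost solution `w⁰_m(x,k) = 𝒦_m(kx)`. -/
def wZero (m k : ℂ) (x : ℝ) : ℂ := macdonald1d m (k * x)

/-- `w` is a Jost solution: an eigensolution in `AC¹]0,∞[` with `w - w⁰_m = o(e^{-x Re k})` and
`w' - (w⁰_m)' = o(e^{-x Re k})` as `x → ∞`. -/
def IsJostSolution (m k : ℂ) (Q w : ℝ → ℂ) : Prop :=
  IsEigensolution m k Q w ∧
    (fun x : ℝ => w x - wZero m k x) =o[atTop] (fun x : ℝ => Real.exp (-x * k.re)) ∧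
    (fun x : ℝ => deriv w x - deriv (wZero m k) x) =o[atTop]
      (fun x : ℝ => Real.exp (-x * k.re))

open Classical in
/-- The Jost solution `w_m(·,k)` (the zero function should there be none). -/
def jostW (m k : ℂ) (Q : ℝ → ℂ) : ℝ → ℂ :=
  if h : ∃ w, IsJostSolution m k Q w then h.choose else 0

/-- The renormalized Jost solution `v_m(x,k) = √(π/(2k)) (k/2)^m w_m(x,k)` (principal branches). -/
def jostV (m k : ℂ) (Q : ℝ → ℂ) (x : ℝ) : ℂ :=
  ((Real.pi : ℂ) / (2 * k)) ^ (1 / 2 : ℂ) * (k / 2) ^ m * jostW m k Q x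

/-- The power `x^{1/2-m}`. -/
def powSol (m : ℂ) (x : ℝ) : ℂ := (x : ℂ) ^ (1 / 2 - m)

/-- `q` is a zero-energy eigensolution with `q - x^{1/2-m} = o(x^{3/2 - Re m - δ})` and
`q' - (x^{1/2-m})' = o(x^{1/2 - Re m - δ})` as `x → ∞`. -/
def IsZeroEnergySolution (m : ℂ) (δ : ℝ) (Q q : ℝ → ℂ) : Prop :=
  IsEigensolution m 0 Q q ∧
    (fun x : ℝ => q x - powSol m x) =o[atTop] (fun x : ℝ => x ^ (3 / 2 - m.re - δ)) ∧
    (fun x : ℝ => deriv q x - deriv (powSol m) x) =o[atTop]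
      (fun x : ℝ => x ^ (1 / 2 - m.re - δ))

end

end PerturbedBessel

namespace PerturbedBessel

noncomputable section

/-! ### Absolutely continuous functions with complex values -/

/-! At zero energy, the equation together with the behaviour at infinity is the Volterra equation
q(x) = x^{1/2-m} + ∫_x^∞ G(x,y) Q(y) q(y) dy, with G the canonical bisolution. Put φ(x) = x^{1/2-Re
m}. For x ≤ y one has |G(x,y)| φ(y) ≤ C φ(x) x^{1-δ} y^δ up to logarithms; of the two products in G,
one needs δ ≥ 1 and the other δ ≥ 1 - 2 Re m (`exists_bisolution_bound`). Hence on ]a,∞[ the kernel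
is dominated, relative to φ, by an integrable density ρ. In the norm weighted further by
exp(2∫_x^∞ρ) the operator has norm at most 1/2 (`integral_mul_exp_tail_le`), so the Neumann series
converges and inverts 1 + G⁰_← Q. Differentiating the integral equation
(`FundPair.secondPrimitive_green`) gives the differential equation, and the factor x^{1-δ} times the
tail of the weighted potential gives the asymptotics. Uniqueness is a Wronskian argument: the
Wronskian of q with the difference d of two candidates is constant and tends to 0, so d/q is
constant near infinity and tends to 0 (`SecondPrimitive.eq_zero_of_wronskian`).

For k ≠ 0 the whole potential (m²-1/4)x^{-2} + Q is integrable at infinity, so the same Volterra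
scheme around e^{-kx} yields a unique solution asymptotic to e^{-kx}. The Macdonald function is such
a solution for Q = 0, as is seen from its integral representation by differentiation under the
integral sign and an exact derivative in the integration variable (`macI_ode`). With the
normalization of v_m all powers of k cancel, and v_m^0 converges to Γ(m) x^{1/2-m}/2 by the
duplication formula (`macConst_mul`).

The limit k → 0 is obtained by matching at X = 1/|k|. Beyond X/2 the centrifugal term has mass of
order |k|, comparable with the energy scale, while Q contributes only |k| ∫_{X/2}^∞ y|Q|; so v_m and
v_m^0 have Cauchy data at X that differ by o(1) relative to X^{1/2-Re m} (`norm_jostSol_sub_le`). On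
]a,X] the difference d = v_m - v_m^0 solves d'' = V d + k² d + Q (d + v_m^0), where V is the
centrifugal term. The energy multiplies d alone, so it has bounded mass |k|²X² = 1 in Grönwall's
inequality. This shows that d is bounded relative to φ, and small beyond |k|^{-1/2}
(`InnerProblem.norm_le_of_data`). The equation for d + v_m^0 - Γ(m) q/2 then has an inhomogeneity
that tends to 0 (`InnerProblem.relSize_error_le`), and a last Grönwall inequality with dominated
convergence concludes. -/

/-- The comparison reduces vector-valued primitives to primitives of the norm, and also covers
functions that differ from a primitive by a constant or a sign. -/
theorem ac_of_dist_le {X Y : Type*} [PseudoMetricSpace X] [PseudoMetricSpace Y] {F : ℝ → X}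
    {G : ℝ → Y} {a b K : ℝ} (hG : AbsolutelyContinuousOnInterval G a b)
    (h : ∀ x ∈ uIcc a b, ∀ y ∈ uIcc a b, dist (F x) (F y) ≤ K * dist (G x) (G y)) :
    AbsolutelyContinuousOnInterval F a b := by
  have hmem : ∀ᶠ E in AbsolutelyContinuousOnInterval.totalLengthFilter ⊓
      𝓟 (AbsolutelyContinuousOnInterval.disjWithin a b),
      E ∈ AbsolutelyContinuousOnInterval.disjWithin a b :=
    eventually_inf_principal.mpr (by simp)
  have hK : Tendsto (fun E : ℕ × (ℕ → ℝ × ℝ) ↦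
      K * ∑ i ∈ Finset.range E.1, dist (G (E.2 i).1) (G (E.2 i).2))
      (AbsolutelyContinuousOnInterval.totalLengthFilter ⊓
        𝓟 (AbsolutelyContinuousOnInterval.disjWithin a b)) (𝓝 0) := by
    simpa using Tendsto.const_mul K hG
  refine squeeze_zero' (Eventually.of_forall fun E => Finset.sum_nonneg fun _ _ => dist_nonneg)
    ?_ hK
  filter_upwards [hmem] with E hE
  rw [Finset.mul_sum]
  exact Finset.sum_le_sum fun i hi => h _ (hE.1 i hi).1 _ (hE.1 i hi).2

theorem ac_congr {X : Type*} [PseudoMetricSpace X] {F G : ℝ → X} {a b : ℝ}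
    (hG : AbsolutelyContinuousOnInterval G a b) (h : EqOn F G (uIcc a b)) :
    AbsolutelyContinuousOnInterval F a b :=
  ac_of_dist_le (K := 1) hG fun x hx y hy => by rw [h hx, h hy, one_mul]

theorem ac_intervalIntegral {E : Type*} [NormedAddCommGroup E] [NormedSpace ℝ E]
    {f : ℝ → E} {a b c : ℝ} (h : IntervalIntegrable f volume a b)
    (hc : c ∈ uIcc a b) : AbsolutelyContinuousOnInterval (fun x ↦ ∫ t in c..x, f t) a b := by
  refine ac_of_dist_le (K := 1)
    (h.norm.absolutelyContinuousOnInterval_intervalIntegral hc) fun x hx y hy => ?_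
  have hi : ∀ {z w : ℝ}, z ∈ uIcc a b → w ∈ uIcc a b → IntervalIntegrable f volume z w :=
    fun hz hw => h.mono_set (uIcc_subset_uIcc hz hw)
  rw [one_mul, dist_comm, dist_comm (∫ t in c..x, ‖f t‖), dist_eq_norm, dist_eq_norm,
    intervalIntegral.integral_interval_sub_left (hi hc hy) (hi hc hx),
    intervalIntegral.integral_interval_sub_left (hi hc hy).norm (hi hc hx).norm]
  exact intervalIntegral.norm_integral_le_abs_integral_norm

/-- The fundamental theorem of calculus for an absolutely continuous function whose derivative
is known almost everywhere. -/
theorem ac_sub_eq_integral {E : Type*} [NormedAddCommGroup E] [NormedSpace ℝ E]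
    [CompleteSpace E] {f f' : ℝ → E} {a b : ℝ} (hf : AbsolutelyContinuousOnInterval f a b)
    (hd : ∀ᵐ x, x ∈ uIcc a b → HasDerivAt f (f' x) x) (hi : IntervalIntegrable f' volume a b) :
    f b - f a = ∫ t in a..b, f' t := by
  -- Subtracting the primitive of `f'` leaves an absolutely continuous function with derivative zero
  -- almost everywhere, which is constant.
  have hF := hf.sub (ac_intervalIntegral hi (left_mem_uIcc))
  obtain ⟨C, hC⟩ := hF.const_of_ae_hasDerivAt_zero (by
    filter_upwards [hd, hi.ae_hasDerivAt_integral] with x h1 h2 hx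
    simpa using! (h1 hx).sub (h2 hx a left_mem_uIcc))
  have ha := hC a left_mem_uIcc
  have hb := hC b right_mem_uIcc
  simp only [Pi.sub_apply, intervalIntegral.integral_same, sub_zero] at ha hb
  rw [ha, ← hb]; abel

theorem ac_mul {f g : ℝ → ℂ} {a b : ℝ} (hf : AbsolutelyContinuousOnInterval f a b)
    (hg : AbsolutelyContinuousOnInterval g a b) :
    AbsolutelyContinuousOnInterval (fun x => f x * g x) a b :=
  hf.smul hg

theorem ac_of_hasDerivAt {f f' : ℝ → ℂ} {a b : ℝ}
    (hf : ∀ x ∈ uIcc a b, HasDerivAt f (f' x) x) (hc : ContinuousOn f' (uIcc a b)) :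
    AbsolutelyContinuousOnInterval f a b := by
  obtain ⟨K, hK⟩ := isCompact_uIcc.exists_bound_of_continuousOn hc
  refine LipschitzOnWith.absolutelyContinuousOnInterval (K := K.toNNReal)
    ((convex_uIcc a b).lipschitzOnWith_of_nnnorm_hasDerivWithin_le
      (fun x hx => (hf x hx).hasDerivWithinAt) fun x hx => ?_)
  rw [← NNReal.coe_le_coe, coe_nnnorm]
  exact (hK x hx).trans (Real.le_coe_toNNReal K)

/-! ### Twice differentiable functions in the sense of Carathéodory -/

/-- `g` has derivative `g'` on `]0,∞[` and `g'` is a primitive of the locally integrable `h`. -/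
structure SecondPrimitive (g g' h : ℝ → ℂ) : Prop where
  hasDerivAt : ∀ x, 0 < x → HasDerivAt g (g' x) x
  intervalIntegrable : ∀ x y, 0 < x → 0 < y → IntervalIntegrable h volume x y
  sub_eq : ∀ x y, 0 < x → 0 < y → g' y - g' x = ∫ t in x..y, h t

theorem pos_of_mem_uIcc {x y t : ℝ} (hx : 0 < x) (hy : 0 < y) (ht : t ∈ uIcc x y) : 0 < t :=
  lt_of_lt_of_le (lt_min hx hy) ht.1

namespace SecondPrimitive

variable {g g' h f f' k : ℝ → ℂ}

theorem ac (H : SecondPrimitive g g' h) {x y : ℝ} (hx : 0 < x) (hy : 0 < y) :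
    AbsolutelyContinuousOnInterval g' x y := by
  refine ac_of_dist_le (K := 1) (ac_intervalIntegral (H.intervalIntegrable x y hx hy)
    left_mem_uIcc) fun s hs t ht => ?_
  have hs0 := pos_of_mem_uIcc hx hy hs
  have ht0 := pos_of_mem_uIcc hx hy ht
  rw [← H.sub_eq x s hx hs0, ← H.sub_eq x t hx ht0, one_mul, dist_sub_right]

theorem continuousOn_deriv (H : SecondPrimitive g g' h) : ContinuousOn g' (Ioi 0) := by
  intro x hx
  have hx : 0 < x := hx
  have := (H.ac (x := x / 2) (y := 2 * x) (by linarith) (by linarith)).continuousOn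
  refine (this.continuousAt ?_).continuousWithinAt
  rw [uIcc_of_le (by linarith)]
  exact Icc_mem_nhds (by linarith) (by linarith)

theorem continuousOn (H : SecondPrimitive g g' h) : ContinuousOn g (Ioi 0) :=
  fun x hx => (H.hasDerivAt x hx).continuousAt.continuousWithinAt

theorem ac_self (H : SecondPrimitive g g' h) {x y : ℝ} (hx : 0 < x) (hy : 0 < y) :
    AbsolutelyContinuousOnInterval g x y :=
  ac_of_hasDerivAt (fun t ht => H.hasDerivAt t (pos_of_mem_uIcc hx hy ht))
    (H.continuousOn_deriv.mono fun _ ht => pos_of_mem_uIcc hx hy ht)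

theorem ae_hasDerivAt_deriv (H : SecondPrimitive g g' h) {x y : ℝ} (hx : 0 < x) (hy : 0 < y) :
    ∀ᵐ t, t ∈ uIcc x y → HasDerivAt g' (h t) t := by
  filter_upwards [(H.intervalIntegrable x y hx hy).ae_hasDerivAt_integral] with t ht hm
  have ht0 := pos_of_mem_uIcc hx hy hm
  have h1 := (ht hm x left_mem_uIcc).const_add (g' x)
  refine h1.congr_of_eventuallyEq ?_
  filter_upwards [Ioi_mem_nhds ht0] with s hs
  rw [← H.sub_eq x s hx hs]; ring

theorem congr (H : SecondPrimitive g g' h) {g₁ h₁ : ℝ → ℂ} (hg : EqOn g₁ g (Ioi 0))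
    (hh : ∀ᵐ x ∂(volume.restrict (Ioi (0 : ℝ))), h x = h₁ x) : SecondPrimitive g₁ g' h₁ := by
  have hh' : ∀ x y : ℝ, 0 < x → 0 < y → h =ᵐ[volume.restrict (uIoc x y)] h₁ := fun x y hx hy =>
    ae_restrict_of_ae_restrict_of_subset
      (fun t ht => pos_of_mem_uIcc hx hy (uIoc_subset_uIcc ht)) hh
  refine ⟨fun x hx => (H.hasDerivAt x hx).congr_of_eventuallyEq ?_, fun x y hx hy => ?_,
    fun x y hx hy => ?_⟩
  · filter_upwards [Ioi_mem_nhds hx] with s hs using hg hs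
  · exact (H.intervalIntegrable x y hx hy).congr_ae (hh' x y hx hy)
  · rw [H.sub_eq x y hx hy]
    exact intervalIntegral.integral_congr_ae_restrict (hh' x y hx hy)

theorem add (H : SecondPrimitive g g' h) (F : SecondPrimitive f f' k) :
    SecondPrimitive (fun x => g x + f x) (fun x => g' x + f' x) (fun x => h x + k x) := by
  refine ⟨fun x hx => (H.hasDerivAt x hx).add (F.hasDerivAt x hx), fun x y hx hy =>
    (H.intervalIntegrable x y hx hy).add (F.intervalIntegrable x y hx hy), fun x y hx hy => ?_⟩
  rw [intervalIntegral.integral_add (H.intervalIntegrable x y hx hy)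
    (F.intervalIntegrable x y hx hy), ← H.sub_eq x y hx hy, ← F.sub_eq x y hx hy]
  ring

theorem const_mul (H : SecondPrimitive g g' h) (c : ℂ) :
    SecondPrimitive (fun x => c * g x) (fun x => c * g' x) (fun x => c * h x) := by
  refine ⟨fun x hx => (H.hasDerivAt x hx).const_mul c, fun x y hx hy =>
    (H.intervalIntegrable x y hx hy).const_mul c, fun x y hx hy => ?_⟩
  rw [intervalIntegral.integral_const_mul, ← H.sub_eq x y hx hy]
  ring

theorem sub (H : SecondPrimitive g g' h) (F : SecondPrimitive f f' k) :
    SecondPrimitive (fun x => g x - f x) (fun x => g' x - f' x) (fun x => h x - k x) := by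
  simpa [sub_eq_add_neg] using H.add (F.const_mul (-1))

/-- The Lagrange identity. -/
theorem wronskian_sub (H : SecondPrimitive g g' h) (F : SecondPrimitive f f' k) {x y : ℝ}
    (hx : 0 < x) (hy : 0 < y) :
    (g y * f' y - g' y * f y) - (g x * f' x - g' x * f x)
      = ∫ t in x..y, (g t * k t - h t * f t) := by
  have hsub : uIcc x y ⊆ Ioi 0 := fun _ ht => pos_of_mem_uIcc hx hy ht
  refine ac_sub_eq_integral (f := fun t => g t * f' t - g' t * f t)
    ((ac_mul (H.ac_self hx hy) (F.ac hx hy)).sub (ac_mul (H.ac hx hy) (F.ac_self hx hy))) ?_ ?_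
  · filter_upwards [H.ae_hasDerivAt_deriv hx hy, F.ae_hasDerivAt_deriv hx hy] with t h1 h2 ht
    have e1 := H.hasDerivAt t (hsub ht)
    have e2 := F.hasDerivAt t (hsub ht)
    convert! (e1.mul (h2 ht)).sub ((h1 ht).mul e2) using 1
    ring
  · exact ((F.intervalIntegrable x y hx hy).continuousOn_mul (H.continuousOn.mono hsub)).sub
      ((H.intervalIntegrable x y hx hy).mul_continuousOn (F.continuousOn.mono hsub))

theorem deriv_eq (H : SecondPrimitive g g' h) {x : ℝ} (hx : 0 < x) : deriv g x = g' x :=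
  (H.hasDerivAt x hx).deriv

theorem isAC1 (H : SecondPrimitive g g' h) : IsAC1 g := by
  refine ⟨fun x hx => (H.hasDerivAt x hx).differentiableAt, fun a b ha hab => ?_⟩
  have hb := ha.trans_le hab
  exact ac_congr (H.ac ha hb) fun t ht => H.deriv_eq (pos_of_mem_uIcc ha hb ht)

theorem ae_deriv_deriv (H : SecondPrimitive g g' h) :
    ∀ᵐ x ∂(volume.restrict (Ioi (0 : ℝ))), deriv (deriv g) x = h x := by
  rw [ae_restrict_iff' measurableSet_Ioi]
  -- The half-line is exhausted by the countably many compact intervals [1/(n+1), n+1], so the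
  -- exceptional sets have a null union.
  have hn : ∀ n : ℕ, ∀ᵐ t, t ∈ uIcc (1 / (n + 1) : ℝ) (n + 1) → HasDerivAt g' (h t) t :=
    fun n => H.ae_hasDerivAt_deriv (by positivity) (by positivity)
  filter_upwards [ae_all_iff.2 hn] with t ht ht0
  have ht0 : 0 < t := ht0
  obtain ⟨n, hn1⟩ := exists_nat_ge (max t (1 / t))
  have h1 : t ≤ n + 1 := by linarith [le_max_left t (1 / t)]
  have h2 : 1 / t ≤ n + 1 := by linarith [le_max_right t (1 / t)]
  have h3 : (1 / (n + 1) : ℝ) ≤ t := by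
    rw [div_le_iff₀ (by positivity)]
    rw [div_le_iff₀ ht0] at h2
    linarith
  have := (ht n (by rw [uIcc_of_le (h3.trans h1)]; exact ⟨h3, h1⟩)).deriv
  rw [← this]
  refine EventuallyEq.deriv_eq ?_
  filter_upwards [Ioi_mem_nhds ht0] with s hs using H.deriv_eq hs

end SecondPrimitive

theorem intervalIntegrable_of_locallyIntegrableOn {Q : ℝ → ℂ}
    (hQ : LocallyIntegrableOn Q (Ioi 0)) {x y : ℝ} (hx : 0 < x) (hy : 0 < y) :
    IntervalIntegrable Q volume x y := by
  rw [intervalIntegrable_iff']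
  exact hQ.integrableOn_compact_subset (fun _ ht => pos_of_mem_uIcc hx hy ht) isCompact_uIcc

theorem intervalIntegrable_potential_mul {m k : ℂ} {Q g : ℝ → ℂ}
    (hQ : LocallyIntegrableOn Q (Ioi 0)) (hg : ContinuousOn g (Ioi 0)) {x y : ℝ} (hx : 0 < x)
    (hy : 0 < y) :
    IntervalIntegrable (fun t : ℝ => ((m ^ 2 - 1 / 4) / (t : ℂ) ^ 2 + k ^ 2 + Q t) * g t)
      volume x y := by
  have hsub : uIcc x y ⊆ Ioi 0 := fun _ ht => pos_of_mem_uIcc hx hy ht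
  refine IntervalIntegrable.mul_continuousOn (IntervalIntegrable.add ?_
    (intervalIntegrable_of_locallyIntegrableOn hQ hx hy)) (hg.mono hsub)
  refine ContinuousOn.intervalIntegrable fun t ht => ContinuousAt.continuousWithinAt ?_
  have : (t : ℂ) ^ 2 ≠ 0 := pow_ne_zero _ (by exact_mod_cast (hsub ht).ne')
  fun_prop (disch := exact this)

/-- Absolute continuity of g' turns the almost-everywhere equation into an integrated one, with no
singular part. The arguments on solutions work with this integrated form. -/
theorem IsEigensolution.secondPrimitive {m k : ℂ} {Q g : ℝ → ℂ}
    (hQ : LocallyIntegrableOn Q (Ioi 0)) (H : IsEigensolution m k Q g) :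
    SecondPrimitive g (deriv g)
      (fun t : ℝ => ((m ^ 2 - 1 / 4) / (t : ℂ) ^ 2 + k ^ 2 + Q t) * g t) := by
  have hc : ContinuousOn g (Ioi 0) := fun x hx => (H.1.1 x hx).continuousAt.continuousWithinAt
  refine ⟨fun x hx => (H.1.1 x hx).hasDerivAt, fun x y hx hy =>
    intervalIntegrable_potential_mul hQ hc hx hy, ?_⟩
  suffices key : ∀ x y, 0 < x → x ≤ y → deriv g y - deriv g x =
      ∫ t in x..y, ((m ^ 2 - 1 / 4) / (t : ℂ) ^ 2 + k ^ 2 + Q t) * g t by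
    intro x y hx hy
    rcases le_total x y with h | h
    · exact key x y hx h
    · rw [intervalIntegral.integral_symm, ← key y x hy h]; ring
  intro x y hx hxy
  have hy := hx.trans_le hxy
  have hac := H.1.2 x y hx hxy
  refine ac_sub_eq_integral hac ?_ (intervalIntegrable_potential_mul hQ hc hx hy)
  -- Almost-everywhere differentiability of g' is obtained from its real and imaginary parts
  -- separately.
  have hre : AbsolutelyContinuousOnInterval (fun t => (deriv g t).re) x y :=
    ac_of_dist_le (K := 1) hac fun s _ t _ => by
      rw [one_mul, dist_eq_norm, dist_eq_norm, ← Complex.sub_re]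
      exact Complex.abs_re_le_norm _
  have him : AbsolutelyContinuousOnInterval (fun t => (deriv g t).im) x y :=
    ac_of_dist_le (K := 1) hac fun s _ t _ => by
      rw [one_mul, dist_eq_norm, dist_eq_norm, ← Complex.sub_im]
      exact Complex.abs_im_le_norm _
  have hode := (ae_restrict_iff' measurableSet_Ioi).1 H.2
  filter_upwards [hre.ae_differentiableAt, him.ae_differentiableAt, hode] with t h1 h2 h3 ht
  have hd : DifferentiableAt ℝ (deriv g) t := by
    have h1' := (h1 ht).hasDerivAt.ofReal_comp
    have h2' := (h2 ht).hasDerivAt.ofReal_comp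
    have := h1'.add (h2'.mul_const Complex.I)
    refine (this.congr_of_eventuallyEq (Eventually.of_forall fun s => ?_)).differentiableAt
    simp [Complex.re_add_im]
  have h4 := h3 (pos_of_mem_uIcc hx hy ht)
  have h5 : deriv (deriv g) t = ((m ^ 2 - 1 / 4) / (t : ℂ) ^ 2 + k ^ 2 + Q t) * g t := by
    linear_combination -h4
  rw [← h5]
  exact hd.hasDerivAt

theorem SecondPrimitive.isEigensolution {m k : ℂ} {Q g g' : ℝ → ℂ}
    (H : SecondPrimitive g g'
      (fun t : ℝ => ((m ^ 2 - 1 / 4) / (t : ℂ) ^ 2 + k ^ 2 + Q t) * g t)) :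
    IsEigensolution m k Q g := by
  refine ⟨H.isAC1, ?_⟩
  filter_upwards [H.ae_deriv_deriv] with x hx
  rw [hx]; ring

/-! ### Tails of integrable functions -/

/-- The tail `x ↦ ∫_x^∞ ρ`. -/
def tail (ρ : ℝ → ℝ) (x : ℝ) : ℝ := ∫ y in Ioi x, ρ y

section Tail

variable {ρ : ℝ → ℝ} {a : ℝ}

theorem tail_sub_tail (hρ : IntegrableOn ρ (Ioi a)) {x y : ℝ} (hx : a ≤ x) (hxy : x ≤ y) :
    tail ρ x - tail ρ y = ∫ t in x..y, ρ t :=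
  intervalIntegral.integral_Ioi_sub_Ioi (hρ.mono_set (Ioi_subset_Ioi hx)) hxy

theorem tail_nonneg (h0 : ∀ x, a < x → 0 ≤ ρ x) {x : ℝ} (hx : a ≤ x) : 0 ≤ tail ρ x :=
  setIntegral_nonneg measurableSet_Ioi fun y hy => h0 y (hx.trans_lt hy)

theorem tail_anti (hρ : IntegrableOn ρ (Ioi a)) (h0 : ∀ x, a < x → 0 ≤ ρ x) {x y : ℝ}
    (hx : a ≤ x) (hxy : x ≤ y) : tail ρ y ≤ tail ρ x := by
  rw [← sub_nonneg, tail_sub_tail hρ hx hxy]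
  exact intervalIntegral.integral_nonneg_of_ae_restrict hxy (by
    rw [← restrict_Ioc_eq_restrict_Icc]
    exact (ae_restrict_iff' measurableSet_Ioc).2
      (ae_of_all _ fun t ht => h0 t (hx.trans_lt ht.1)))

theorem tendsto_tail (hρ : IntegrableOn ρ (Ioi a)) : Tendsto (tail ρ) atTop (𝓝 0) := by
  have h := intervalIntegral_tendsto_integral_Ioi a hρ tendsto_id
  have h2 : Tendsto (fun y => tail ρ a - ∫ t in a..y, ρ t) atTop (𝓝 0) := by
    simpa [tail] using h.const_sub (tail ρ a)
  refine h2.congr' ?_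
  filter_upwards [eventually_ge_atTop a] with y hy
  rw [← tail_sub_tail hρ le_rfl hy]; ring

theorem exp_sub_exp_le {p q M : ℝ} (hq : q ≤ M) :
    Real.exp q - Real.exp p ≤ Real.exp M * |q - p| := by
  have h1 := Real.add_one_le_exp (p - q)
  have h2 : Real.exp p = Real.exp q * Real.exp (p - q) := by rw [← Real.exp_add]; ring_nf
  have h3 : Real.exp q ≤ Real.exp M := Real.exp_le_exp.2 hq
  have h4 := le_abs_self (q - p)
  calc Real.exp q - Real.exp p = Real.exp q * (1 - Real.exp (p - q)) := by rw [h2]; ring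
    _ ≤ Real.exp q * |q - p| := by gcongr; linarith
    _ ≤ Real.exp M * |q - p| := by gcongr

theorem integrableOn_mul_exp_tail (hρ : IntegrableOn ρ (Ioi a)) (h0 : ∀ x, a < x → 0 ≤ ρ x)
    {x : ℝ} (hx : a ≤ x) : IntegrableOn (fun y => ρ y * Real.exp (2 * tail ρ y)) (Ioi x) := by
  have hanti : AntitoneOn (tail ρ) (Ioi x) := fun s hs t _ hst =>
    tail_anti hρ h0 (hx.trans (le_of_lt hs)) hst
  have hm : AEStronglyMeasurable (fun y => Real.exp (2 * tail ρ y)) (volume.restrict (Ioi x)) := by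
    have := (aemeasurable_restrict_of_antitoneOn measurableSet_Ioi hanti (μ := volume))
    exact ((this.const_mul 2).exp).aestronglyMeasurable
  refine Integrable.mul_bdd (c := Real.exp (2 * tail ρ x)) (hρ.mono_set (Ioi_subset_Ioi hx)) hm ?_
  refine (ae_restrict_iff' measurableSet_Ioi).2 (ae_of_all _ fun y hy => ?_)
  rw [Real.norm_of_nonneg (Real.exp_pos _).le]
  exact Real.exp_le_exp.2 (by have := tail_anti hρ h0 hx (le_of_lt hy); linarith)

/-- Since the tail has derivative -ρ, the integrand is the derivative of -exp(2 tail)/2; on ]x,T]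
the boundary term at T has a favourable sign and is dropped. The factor 1/2 gained here makes every
Volterra operator below a contraction, and replaces factorial estimates of iterated kernels. -/
theorem integral_mul_exp_tail_le (hρ : IntegrableOn ρ (Ioi a)) (h0 : ∀ x, a < x → 0 ≤ ρ x)
    {x : ℝ} (hx : a ≤ x) :
    ∫ y in Ioi x, ρ y * Real.exp (2 * tail ρ y) ≤ Real.exp (2 * tail ρ x) / 2 := by
  have hint := integrableOn_mul_exp_tail hρ h0 hx
  refine le_of_tendsto (intervalIntegral_tendsto_integral_Ioi x hint tendsto_id) ?_
  filter_upwards [eventually_ge_atTop x] with T hT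
  simp only [id]
  have hi : IntervalIntegrable ρ volume x T :=
    (intervalIntegrable_iff_integrableOn_Ioc_of_le hT).2
      (hρ.mono_set fun t ht => hx.trans_lt ht.1)
  have htail : ∀ t, x ≤ t → tail ρ t = tail ρ x - ∫ s in x..t, ρ s := fun t ht => by
    rw [← tail_sub_tail hρ hx ht]; ring
  have hac : AbsolutelyContinuousOnInterval
      (fun t => Real.exp (2 * (tail ρ x - ∫ s in x..t, ρ s))) x T := by
    refine ac_of_dist_le (K := Real.exp (2 * tail ρ x) * 2)
      (ac_intervalIntegral hi left_mem_uIcc) fun s hs t ht => ?_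
    rw [uIcc_of_le hT] at hs ht
    have hb : ∀ u ∈ Icc x T, 2 * (tail ρ x - ∫ s in x..u, ρ s) ≤ 2 * tail ρ x := fun u hu => by
      rw [← htail u hu.1]; linarith [tail_anti hρ h0 hx hu.1]
    have e1 := exp_sub_exp_le (p := 2 * (tail ρ x - ∫ r in x..t, ρ r)) (hb s hs)
    have e2 := exp_sub_exp_le (p := 2 * (tail ρ x - ∫ r in x..s, ρ r)) (hb t ht)
    rw [Real.dist_eq, Real.dist_eq, mul_assoc]
    have e3 : ∀ p q : ℝ, |2 * (tail ρ x - p) - 2 * (tail ρ x - q)| = 2 * |q - p| := fun p q => by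
      rw [← abs_of_pos (show (0 : ℝ) < 2 by norm_num), ← abs_mul,
        abs_of_pos (show (0 : ℝ) < 2 by norm_num)]; congr 1; ring
    rw [e3] at e1 e2
    rw [abs_sub_comm] at e1
    exact abs_sub_le_iff.2 ⟨e1, e2⟩
  have hcont : ContinuousOn (fun t => Real.exp (2 * (tail ρ x - ∫ s in x..t, ρ s)))
      (uIcc x T) := hac.continuousOn
  have hftc := ac_sub_eq_integral
    (f' := fun t => -(2 * (ρ t * Real.exp (2 * (tail ρ x - ∫ s in x..t, ρ s))))) hac (by
      filter_upwards [hi.ae_hasDerivAt_integral] with t ht hm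
      have := ((((ht hm x left_mem_uIcc).const_sub (tail ρ x)).const_mul 2)).exp
      convert! this using 1
      ring) (((hi.mul_continuousOn hcont).const_mul 2).neg)
  rw [intervalIntegral.integral_neg, intervalIntegral.integral_const_mul] at hftc
  have hcongr : ∫ t in x..T, ρ t * Real.exp (2 * tail ρ t) =
      ∫ t in x..T, ρ t * Real.exp (2 * (tail ρ x - ∫ s in x..t, ρ s)) := by
    refine intervalIntegral.integral_congr fun t ht => ?_
    rw [uIcc_of_le hT] at ht
    simp only [htail t ht.1]
  rw [hcongr]
  have hp := Real.exp_pos (2 * (tail ρ x - ∫ s in x..T, ρ s))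
  simp only [intervalIntegral.integral_same, sub_zero] at hftc
  linarith

/-- A backward Grönwall inequality with an integrable coefficient. -/
theorem backward_gronwall (hρ : IntegrableOn ρ (Ioi a)) (h0 : ∀ x, a < x → 0 ≤ ρ x)
    {g : ℝ → ℝ} {A M : ℝ} (hA : 0 ≤ A) (hg0 : ∀ x, a < x → 0 ≤ g x)
    (hgM : ∀ x, a < x → g x ≤ M)
    (hg : ∀ x, a < x → g x ≤ A + ∫ y in Ioi x, ρ y * g y) {x : ℝ} (hx : a < x) :
    g x ≤ 2 * A * Real.exp (2 * tail ρ x) := by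
  have hM : 0 ≤ M := (hg0 x hx).trans (hgM x hx)
  have hexp : ∀ y, a < y → 1 ≤ Real.exp (2 * tail ρ y) := fun y hy =>
    Real.one_le_exp (mul_nonneg zero_le_two (tail_nonneg h0 hy.le))
  -- Inserting a bound with coefficient c into the inequality returns the coefficient A + c/2, whose
  -- fixed point is 2A. The start at n = 0 is the a priori bound M.
  have key : ∀ n : ℕ, ∀ y, a < y → g y ≤ (2 * A + M / 2 ^ n) * Real.exp (2 * tail ρ y) := by
    intro n
    induction n with
    | zero =>
      intro y hy
      have := hexp y hy
      have h2 := hgM y hy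
      simp only [pow_zero, div_one]
      nlinarith
    | succ n ih =>
      intro y hy
      have hle : ∫ t in Ioi y, ρ t * g t ≤
          ∫ t in Ioi y, (2 * A + M / 2 ^ n) * (ρ t * Real.exp (2 * tail ρ t)) := by
        -- No measurability of `g` is required: if `ρ g` is not integrable its integral is 0 by
        -- convention, and the comparison still holds.
        refine integral_mono_of_nonneg ?_
          ((integrableOn_mul_exp_tail hρ h0 hy.le).const_mul _) ?_
        · exact (ae_restrict_iff' measurableSet_Ioi).2 (ae_of_all _ fun t ht =>
            mul_nonneg (h0 t (hy.trans ht)) (hg0 t (hy.trans ht)))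
        · refine (ae_restrict_iff' measurableSet_Ioi).2 (ae_of_all _ fun t ht => ?_)
          have := mul_le_mul_of_nonneg_left (ih t (hy.trans ht)) (h0 t (hy.trans ht))
          simp only
          linarith
      rw [integral_const_mul] at hle
      have h1 := integral_mul_exp_tail_le hρ h0 hy.le
      have hc : 0 ≤ 2 * A + M / 2 ^ n := by positivity
      have h2 := mul_le_mul_of_nonneg_left h1 hc
      have h3 := hg y hy
      have h4 := mul_le_mul_of_nonneg_left (hexp y hy) hA
      rw [pow_succ, ← div_div]
      nlinarith
  have hlim : Tendsto (fun n : ℕ => (2 * A + M / 2 ^ n) * Real.exp (2 * tail ρ x)) atTop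
      (𝓝 ((2 * A + 0) * Real.exp (2 * tail ρ x))) := by
    refine (Tendsto.add tendsto_const_nhds ?_).mul_const _
    have := (tendsto_pow_atTop_nhds_zero_of_lt_one (r := (1 / 2 : ℝ)) (by norm_num)
      (by norm_num)).const_mul M
    simpa [div_eq_mul_inv] using this
  rw [add_zero] at hlim
  exact ge_of_tendsto' hlim fun n => key n x hx

end Tail

/-! ### Backward Volterra operators on weighted spaces -/

/-- The backward Volterra operator with kernel `K`. -/
def volt (K : ℝ → ℝ → ℂ) (f : ℝ → ℂ) (x : ℝ) : ℂ := ∫ y in Ioi x, K x y * f y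

/-- The Neumann series of the Volterra equation `f = h + volt K f`. -/
def voltSol (K : ℝ → ℝ → ℂ) (h : ℝ → ℂ) (x : ℝ) : ℂ := ∑' n : ℕ, ((volt K)^[n] h) x

/-- `K` is a Volterra kernel on `]a,∞[` dominated by `ρ ∈ L¹` relative to the weight `φ`. -/
structure VolterraKernel (K : ℝ → ℝ → ℂ) (φ ρ : ℝ → ℝ) (a : ℝ) : Prop where
  pos : ∀ x, a < x → 0 < φ x
  continuousOn_weight : ContinuousOn φ (Ioi a)
  nonneg : ∀ x, a < x → 0 ≤ ρ x
  integrable : IntegrableOn ρ (Ioi a)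
  bound : ∀ x y, a < x → x < y → ‖K x y‖ * φ y ≤ φ x * ρ y
  measurable : ∀ x, a < x → AEStronglyMeasurable (K x) (volume.restrict (Ioi a))
  continuousOn : ∀ y, ContinuousOn (fun x => K x y) (Ioo a y)

namespace VolterraKernel

variable {K : ℝ → ℝ → ℂ} {φ ρ : ℝ → ℝ} {a M : ℝ} {f h : ℝ → ℂ}

theorem norm_mul_le (H : VolterraKernel K φ ρ a) {x y c : ℝ} {z : ℂ} (hx : a < x) (hxy : x < y)
    (hz : ‖z‖ ≤ c * φ y) (hc : 0 ≤ c) : ‖K x y * z‖ ≤ φ x * (c * ρ y) := by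
  rw [norm_mul]
  calc ‖K x y‖ * ‖z‖ ≤ ‖K x y‖ * (c * φ y) := by gcongr
    _ = c * (‖K x y‖ * φ y) := by ring
    _ ≤ c * (φ x * ρ y) := mul_le_mul_of_nonneg_left (H.bound x y hx hxy) hc
    _ = φ x * (c * ρ y) := by ring

theorem integrableOn (H : VolterraKernel K φ ρ a)
    (hf : AEStronglyMeasurable f (volume.restrict (Ioi a))) (hM : 0 ≤ M)
    (hfM : ∀ᵐ y ∂(volume.restrict (Ioi a)), ‖f y‖ ≤ M * φ y) {x : ℝ} (hx : a < x) :
    IntegrableOn (fun y => K x y * f y) (Ioi x) := by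
  have hsub : Ioi x ⊆ Ioi a := Ioi_subset_Ioi hx.le
  refine Integrable.mono' (((H.integrable.mono_set hsub).const_mul M).const_mul (φ x))
    (((H.measurable x hx).mul hf).mono_measure (Measure.restrict_mono_set _ hsub)) ?_
  filter_upwards [ae_restrict_of_ae_restrict_of_subset hsub hfM,
    ae_restrict_mem measurableSet_Ioi] with y h1 h2
  exact H.norm_mul_le hx h2 h1 hM

theorem norm_volt_le (H : VolterraKernel K φ ρ a) {C : ℝ → ℝ}
    (hC0 : ∀ y, a < y → 0 ≤ C y)
    (hfM : ∀ᵐ y ∂(volume.restrict (Ioi a)), ‖f y‖ ≤ C y * φ y) {x : ℝ} (hx : a < x)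
    (hC : IntegrableOn (fun y => C y * ρ y) (Ioi x)) :
    ‖volt K f x‖ ≤ φ x * ∫ y in Ioi x, C y * ρ y := by
  have hsub : Ioi x ⊆ Ioi a := Ioi_subset_Ioi hx.le
  rw [volt, ← integral_const_mul]
  refine norm_integral_le_of_norm_le (hC.const_mul _) ?_
  filter_upwards [ae_restrict_of_ae_restrict_of_subset hsub hfM,
    ae_restrict_mem measurableSet_Ioi] with y h1 h2
  exact H.norm_mul_le hx h2 h1 (hC0 y (hx.trans h2))

theorem norm_volt_le_tail (H : VolterraKernel K φ ρ a) (hM : 0 ≤ M)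
    (hfM : ∀ᵐ y ∂(volume.restrict (Ioi a)), ‖f y‖ ≤ M * φ y) {x : ℝ} (hx : a < x) :
    ‖volt K f x‖ ≤ M * tail ρ x * φ x := by
  refine (H.norm_volt_le (C := fun _ => M) (fun _ _ => hM) hfM hx
    ((H.integrable.mono_set (Ioi_subset_Ioi hx.le)).const_mul M)).trans_eq ?_
  rw [integral_const_mul, tail]; ring

/-- This is the contraction estimate: in the weight φ exp(2 tail ρ) the operator has norm at most
1/2, whatever the total mass of ρ. -/
theorem norm_volt_le_exp (H : VolterraKernel K φ ρ a) (hM : 0 ≤ M)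
    (hfM : ∀ y, a < y → ‖f y‖ ≤ M * Real.exp (2 * tail ρ y) * φ y) {x : ℝ} (hx : a < x) :
    ‖volt K f x‖ ≤ M / 2 * Real.exp (2 * tail ρ x) * φ x := by
  have hi : IntegrableOn (fun y => M * Real.exp (2 * tail ρ y) * ρ y) (Ioi x) := by
    refine ((integrableOn_mul_exp_tail H.integrable H.nonneg hx.le).const_mul M).congr
      (ae_of_all _ fun y => ?_)
    simp only; ring
  refine (H.norm_volt_le (C := fun y => M * Real.exp (2 * tail ρ y))
    (fun _ _ => mul_nonneg hM (Real.exp_pos _).le)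
    ((ae_restrict_iff' measurableSet_Ioi).2 (ae_of_all _ hfM)) hx hi).trans ?_
  have h1 := integral_mul_exp_tail_le H.integrable H.nonneg hx.le
  have h2 : ∫ y in Ioi x, M * Real.exp (2 * tail ρ y) * ρ y =
      M * ∫ y in Ioi x, ρ y * Real.exp (2 * tail ρ y) := by
    rw [← integral_const_mul]; congr 1; ext y; ring
  rw [h2]
  have h3 := mul_le_mul_of_nonneg_left (mul_le_mul_of_nonneg_left h1 hM) (H.pos x hx).le
  linarith

/-- Dominated convergence, after writing the moving domain as an indicator on a fixed half-line. The
continuity is what makes the iterates of the operator measurable. -/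
theorem continuousOn_volt (H : VolterraKernel K φ ρ a)
    (hf : AEStronglyMeasurable f (volume.restrict (Ioi a))) (hM : 0 ≤ M)
    (hfM : ∀ᵐ y ∂(volume.restrict (Ioi a)), ‖f y‖ ≤ M * φ y) :
    ContinuousOn (volt K f) (Ioi a) := by
  intro x hx
  have hx : a < x := hx
  refine ContinuousAt.continuousWithinAt ?_
  have heq : ∀ t, a < t → volt K f t =
      ∫ y in Ioi a, (Ioi t).indicator (fun y => K t y * f y) y := fun t ht => by
    rw [volt, setIntegral_indicator measurableSet_Ioi, Ioi_inter_Ioi, max_eq_right ht.le]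
  obtain ⟨ε, hε, hball⟩ := Metric.continuousAt_iff.1
    ((H.continuousOn_weight.continuousAt (Ioi_mem_nhds hx))) 1 one_pos
  have hev : ∀ᶠ t in 𝓝 x, a < t ∧ φ t ≤ φ x + 1 := by
    filter_upwards [Ioi_mem_nhds hx, Metric.ball_mem_nhds x hε] with t ht1 ht2
    refine ⟨ht1, ?_⟩
    have := hball ht2
    rw [Real.dist_eq] at this
    linarith [(abs_lt.1 this).2]
  have hmain : ContinuousAt
      (fun t => ∫ y in Ioi a, (Ioi t).indicator (fun y => K t y * f y) y) x := by
    refine continuousAt_of_dominated (bound := fun y => (φ x + 1) * (M * ρ y)) ?_ ?_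
      ((H.integrable.const_mul M).const_mul _) ?_
    · filter_upwards [hev] with t ht
      exact ((H.measurable t ht.1).mul hf).indicator measurableSet_Ioi
    · filter_upwards [hev] with t ht
      filter_upwards [hfM, ae_restrict_mem measurableSet_Ioi] with y h1 h2
      have h0 : 0 ≤ M * ρ y := mul_nonneg hM (H.nonneg y h2)
      by_cases hy : t < y
      · rw [indicator_of_mem (show y ∈ Ioi t from hy)]
        exact (H.norm_mul_le ht.1 hy h1 hM).trans (by gcongr; exact ht.2)
      · rw [indicator_of_notMem (show y ∉ Ioi t from hy), norm_zero]
        have := (H.pos x hx).le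
        positivity
    -- At y = x the indicator jumps, but a single point is null; on either side of it the integrand
    -- is continuous at x, being locally zero or free of the cutoff.
    · have hne : ∀ᵐ y ∂(volume.restrict (Ioi a)), y ≠ x :=
        ae_restrict_of_ae (by simp [ae_iff, measure_singleton])
      filter_upwards [hne] with y hy
      rcases lt_or_gt_of_ne hy with h | h
      · refine (continuousAt_const (y := (0 : ℂ))).congr ?_
        filter_upwards [Ioi_mem_nhds h] with t ht
        rw [indicator_of_notMem]
        exact fun hc => lt_asymm (mem_Ioi.1 hc) (mem_Ioi.1 ht)
      · have hc : ContinuousAt (fun t => K t y * f y) x :=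
          ((H.continuousOn y).continuousAt (Ioo_mem_nhds hx h)).mul continuousAt_const
        refine hc.congr ?_
        filter_upwards [Iio_mem_nhds h] with t ht
        rw [indicator_of_mem (show y ∈ Ioi t from ht)]
  refine hmain.congr ?_
  filter_upwards [Ioi_mem_nhds hx] with t ht
  rw [heq t ht]

theorem volt_sub (H : VolterraKernel K φ ρ a) {g : ℝ → ℂ} {N : ℝ}
    (hf : AEStronglyMeasurable f (volume.restrict (Ioi a))) (hM : 0 ≤ M)
    (hfM : ∀ᵐ y ∂(volume.restrict (Ioi a)), ‖f y‖ ≤ M * φ y)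
    (hg : AEStronglyMeasurable g (volume.restrict (Ioi a))) (hN : 0 ≤ N)
    (hgN : ∀ᵐ y ∂(volume.restrict (Ioi a)), ‖g y‖ ≤ N * φ y) {x : ℝ} (hx : a < x) :
    volt K (fun y => f y - g y) x = volt K f x - volt K g x := by
  simp only [volt, mul_sub]
  exact integral_sub (H.integrableOn hf hM hfM hx) (H.integrableOn hg hN hgN hx)

theorem norm_iterate_le (H : VolterraKernel K φ ρ a) (hM : 0 ≤ M)
    (hh : ∀ y, a < y → ‖h y‖ ≤ M * φ y) (n : ℕ) {y : ℝ} (hy : a < y) :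
    ‖((volt K)^[n] h) y‖ ≤ M * (1 / 2) ^ n * Real.exp (2 * tail ρ y) * φ y := by
  induction n generalizing y with
  | zero =>
    have h1 : 1 ≤ Real.exp (2 * tail ρ y) :=
      Real.one_le_exp (mul_nonneg zero_le_two (tail_nonneg H.nonneg hy.le))
    have h2 : 0 ≤ M * φ y := mul_nonneg hM (H.pos y hy).le
    have h3 := hh y hy
    simp only [Function.iterate_zero, id, pow_zero]
    nlinarith
  | succ n ih =>
    rw [Function.iterate_succ_apply']
    refine (H.norm_volt_le_exp (M := M * (1 / 2) ^ n) (by positivity) (fun y hy => ih hy)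
      hy).trans_eq ?_
    rw [pow_succ]; ring

theorem exp_tail_le (H : VolterraKernel K φ ρ a) {y : ℝ} (hy : a < y) :
    Real.exp (2 * tail ρ y) ≤ Real.exp (2 * tail ρ a) :=
  Real.exp_le_exp.2 (by linarith [tail_anti H.integrable H.nonneg le_rfl hy.le])

theorem norm_iterate_le_const (H : VolterraKernel K φ ρ a) (hM : 0 ≤ M)
    (hh : ∀ y, a < y → ‖h y‖ ≤ M * φ y) (n : ℕ) {y : ℝ} (hy : a < y) :
    ‖((volt K)^[n] h) y‖ ≤ M * (1 / 2) ^ n * Real.exp (2 * tail ρ a) * φ y := by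
  refine (H.norm_iterate_le hM hh n hy).trans ?_
  have := H.exp_tail_le hy
  have := (H.pos y hy).le
  gcongr

theorem aestronglyMeasurable_iterate (H : VolterraKernel K φ ρ a)
    (hm : AEStronglyMeasurable h (volume.restrict (Ioi a))) (hM : 0 ≤ M)
    (hh : ∀ y, a < y → ‖h y‖ ≤ M * φ y) (n : ℕ) :
    AEStronglyMeasurable ((volt K)^[n] h) (volume.restrict (Ioi a)) := by
  induction n with
  | zero => simpa using hm
  | succ n ih =>
    rw [Function.iterate_succ']
    refine ContinuousOn.aestronglyMeasurable (H.continuousOn_volt ih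
      (M := M * (1 / 2) ^ n * Real.exp (2 * tail ρ a)) (by positivity) ?_) measurableSet_Ioi
    exact (ae_restrict_iff' measurableSet_Ioi).2
      (ae_of_all _ fun y hy => H.norm_iterate_le_const hM hh n hy)

theorem hasSum_iterate (H : VolterraKernel K φ ρ a) (hM : 0 ≤ M)
    (hh : ∀ y, a < y → ‖h y‖ ≤ M * φ y) {y : ℝ} (hy : a < y) :
    HasSum (fun n => ((volt K)^[n] h) y) (voltSol K h y) := by
  refine (Summable.of_norm_bounded (g := fun n : ℕ =>
    M * (1 / 2) ^ n * Real.exp (2 * tail ρ y) * φ y) ?_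
    fun n => H.norm_iterate_le hM hh n hy).hasSum
  exact ((summable_geometric_two.mul_left M).mul_right _).mul_right _

theorem norm_voltSol_le (H : VolterraKernel K φ ρ a) (hM : 0 ≤ M)
    (hh : ∀ y, a < y → ‖h y‖ ≤ M * φ y) {y : ℝ} (hy : a < y) :
    ‖voltSol K h y‖ ≤ 2 * M * Real.exp (2 * tail ρ y) * φ y := by
  have hs : HasSum (fun n : ℕ => M * (1 / 2) ^ n * Real.exp (2 * tail ρ y) * φ y)
      (M * 2 * Real.exp (2 * tail ρ y) * φ y) :=
    ((hasSum_geometric_two.mul_left M).mul_right _).mul_right _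
  have := (H.hasSum_iterate hM hh hy).norm_le_of_bounded hs fun n => H.norm_iterate_le hM hh n hy
  linarith

theorem norm_voltSol_le_const (H : VolterraKernel K φ ρ a) (hM : 0 ≤ M)
    (hh : ∀ y, a < y → ‖h y‖ ≤ M * φ y) {y : ℝ} (hy : a < y) :
    ‖voltSol K h y‖ ≤ 2 * M * Real.exp (2 * tail ρ a) * φ y := by
  refine (H.norm_voltSol_le hM hh hy).trans ?_
  have := H.exp_tail_le hy
  have := (H.pos y hy).le
  gcongr

theorem aestronglyMeasurable_voltSol (H : VolterraKernel K φ ρ a)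
    (hm : AEStronglyMeasurable h (volume.restrict (Ioi a))) (hM : 0 ≤ M)
    (hh : ∀ y, a < y → ‖h y‖ ≤ M * φ y) :
    AEStronglyMeasurable (voltSol K h) (volume.restrict (Ioi a)) := by
  refine aestronglyMeasurable_of_tendsto_ae atTop (f := fun N : ℕ => fun y =>
    ∑ n ∈ Finset.range N, ((volt K)^[n] h) y) (fun N => ?_) ?_
  · exact Finset.aestronglyMeasurable_fun_sum _
      fun n _ => H.aestronglyMeasurable_iterate hm hM hh n
  · exact (ae_restrict_iff' measurableSet_Ioi).2
      (ae_of_all _ fun y hy => (H.hasSum_iterate hM hh hy).tendsto_sum_nat)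

/-- The Neumann series solves the Volterra equation. -/
theorem voltSol_eq (H : VolterraKernel K φ ρ a)
    (hm : AEStronglyMeasurable h (volume.restrict (Ioi a))) (hM : 0 ≤ M)
    (hh : ∀ y, a < y → ‖h y‖ ≤ M * φ y) {x : ℝ} (hx : a < x) :
    voltSol K h x = h x + volt K (voltSol K h) x := by
  have hsub : Ioi x ⊆ Ioi a := Ioi_subset_Ioi hx.le
  set E := Real.exp (2 * tail ρ a)
  have h1 : HasSum (fun n => volt K ((volt K)^[n] h) x) (volt K (voltSol K h) x) := by
    refine hasSum_integral_of_dominated_convergence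
      (bound := fun n y => (φ x * (M * (1 / 2) ^ n * E * ρ y))) (fun n => ?_) (fun n => ?_) ?_ ?_ ?_
    · exact ((H.measurable x hx).mul (H.aestronglyMeasurable_iterate hm hM hh n)).mono_measure
        (Measure.restrict_mono_set _ hsub)
    · filter_upwards [ae_restrict_mem measurableSet_Ioi] with y hy
      exact H.norm_mul_le hx hy (H.norm_iterate_le_const hM hh n (hx.trans hy)) (by positivity)
    · exact ae_of_all _ fun y => (((summable_geometric_two.mul_left M).mul_right _).mul_right
        _).mul_left _
    · have : ∀ y, ∑' n : ℕ, (φ x * (M * (1 / 2) ^ n * E * ρ y)) = φ x * (M * 2 * E * ρ y) :=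
        fun y => ((((hasSum_geometric_two.mul_left M).mul_right _).mul_right _).mul_left _).tsum_eq
      simp only [this]
      exact ((H.integrable.mono_set hsub).const_mul _).const_mul _
    · filter_upwards [ae_restrict_mem measurableSet_Ioi] with y hy
      exact (H.hasSum_iterate hM hh (hx.trans hy)).mul_left _
  have h2 := H.hasSum_iterate hM hh hx
  rw [← hasSum_nat_add_iff' 1] at h2
  simp only [Finset.range_one, Finset.sum_singleton, Function.iterate_zero, id,
    Function.iterate_succ_apply'] at h2
  rw [← h2.unique h1]; ring

/-- A bounded solution of the homogeneous Volterra equation vanishes. -/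
theorem eq_zero (H : VolterraKernel K φ ρ a) {d : ℝ → ℂ} (hM : 0 ≤ M)
    (hd : ∀ y, a < y → ‖d y‖ ≤ M * φ y) (heq : ∀ y, a < y → d y = volt K d y) {x : ℝ}
    (hx : a < x) : d x = 0 := by
  have key : ∀ n : ℕ, ‖d x‖ ≤ M * (1 / 2) ^ n * Real.exp (2 * tail ρ x) * φ x := by
    intro n
    -- A solution of the homogeneous equation is fixed by all iterates, so it inherits their bound,
    -- which decays like 2^{-n}.
    have hfix : ∀ n : ℕ, ∀ y, a < y → ((volt K)^[n] d) y = d y := by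
      intro n
      induction n with
      | zero => intro y _; rfl
      | succ n ih =>
        intro y hy
        rw [Function.iterate_succ_apply', heq y hy]
        exact setIntegral_congr_fun measurableSet_Ioi fun t ht => by
          rw [ih t (hy.trans ht)]
    have := H.norm_iterate_le hM hd n hx
    rwa [hfix n x hx] at this
  have hlim : Tendsto (fun n : ℕ => M * (1 / 2) ^ n * Real.exp (2 * tail ρ x) * φ x) atTop
      (𝓝 0) := by
    have := (((tendsto_pow_atTop_nhds_zero_of_lt_one (r := (1 / 2 : ℝ)) (by norm_num)
      (by norm_num)).const_mul M).mul_const (Real.exp (2 * tail ρ x))).mul_const (φ x)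
    simpa using this
  exact norm_le_zero_iff.1 (ge_of_tendsto' hlim key)

end VolterraKernel

/-! ### Fundamental pairs of solutions and Green kernels -/

theorem hasDerivAt_of_sub_eq_integral {g p : ℝ → ℂ} (hp : ContinuousOn p (Ioi 0))
    (h : ∀ x y, 0 < x → 0 < y → g y - g x = ∫ t in x..y, p t) {x : ℝ} (hx : 0 < x) :
    HasDerivAt g (p x) x := by
  have h1 : HasDerivAt (fun y => ∫ t in x..y, p t) (p x) x :=
    intervalIntegral.integral_hasDerivAt_right (by simp)
      (hp.stronglyMeasurableAtFilter isOpen_Ioi x hx) (hp.continuousAt (Ioi_mem_nhds hx))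
  refine (h1.const_add (g x)).congr_of_eventuallyEq ?_
  filter_upwards [Ioi_mem_nhds hx] with y hy
  rw [← h x y hx hy]; ring

/-- `u`, `v` solve `g'' = V g` on `]0,∞[`, with derivatives `u'`, `v'` and Wronskian one. -/
structure FundPair (V u v u' v' : ℝ → ℂ) : Prop where
  continuousOn : ContinuousOn V (Ioi 0)
  hasDerivAt_u : ∀ x, 0 < x → HasDerivAt u (u' x) x
  hasDerivAt_v : ∀ x, 0 < x → HasDerivAt v (v' x) x
  hasDerivAt_u' : ∀ x, 0 < x → HasDerivAt u' (V x * u x) x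
  hasDerivAt_v' : ∀ x, 0 < x → HasDerivAt v' (V x * v x) x
  wronskian : ∀ x, 0 < x → u x * v' x - u' x * v x = 1

theorem secondPrimitive_of_hasDerivAt {g g' h : ℝ → ℂ} (hc : ContinuousOn h (Ioi 0))
    (h1 : ∀ x, 0 < x → HasDerivAt g (g' x) x) (h2 : ∀ x, 0 < x → HasDerivAt g' (h x) x) :
    SecondPrimitive g g' h := by
  have hi : ∀ x y, 0 < x → 0 < y → IntervalIntegrable h volume x y := fun x y hx hy =>
    (hc.mono fun _ ht => pos_of_mem_uIcc hx hy ht).intervalIntegrable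
  refine ⟨h1, hi, fun x y hx hy => ?_⟩
  exact (intervalIntegral.integral_eq_sub_of_hasDerivAt
    (fun t ht => h2 t (pos_of_mem_uIcc hx hy ht)) (hi x y hx hy)).symm

namespace FundPair

variable {V u v u' v' : ℝ → ℂ}

theorem continuousOn_u (F : FundPair V u v u' v') : ContinuousOn u (Ioi 0) :=
  fun x hx => (F.hasDerivAt_u x hx).continuousAt.continuousWithinAt

theorem continuousOn_v (F : FundPair V u v u' v') : ContinuousOn v (Ioi 0) :=
  fun x hx => (F.hasDerivAt_v x hx).continuousAt.continuousWithinAt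

theorem continuousOn_u' (F : FundPair V u v u' v') : ContinuousOn u' (Ioi 0) :=
  fun x hx => (F.hasDerivAt_u' x hx).continuousAt.continuousWithinAt

theorem continuousOn_v' (F : FundPair V u v u' v') : ContinuousOn v' (Ioi 0) :=
  fun x hx => (F.hasDerivAt_v' x hx).continuousAt.continuousWithinAt

theorem secondPrimitive_u (F : FundPair V u v u' v') :
    SecondPrimitive u u' (fun x => V x * u x) :=
  secondPrimitive_of_hasDerivAt (F.continuousOn.mul F.continuousOn_u) F.hasDerivAt_u
    F.hasDerivAt_u'

theorem secondPrimitive_v (F : FundPair V u v u' v') :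
    SecondPrimitive v v' (fun x => V x * v x) :=
  secondPrimitive_of_hasDerivAt (F.continuousOn.mul F.continuousOn_v) F.hasDerivAt_v
    F.hasDerivAt_v'

/-- Variation of constants on a compact interval. -/
theorem variation_of_constants (F : FundPair V u v u' v') {d d' h : ℝ → ℂ}
    (hd : SecondPrimitive d d' (fun t => V t * d t + h t)) {x X : ℝ} (hx : 0 < x) (hX : 0 < X) :
    d x = u x * (d X * v' X - d' X * v X) + v x * (d' X * u X - d X * u' X)
      + ∫ y in x..X, (u x * v y - v x * u y) * h y := by
  have hsub : uIcc x X ⊆ Ioi 0 := fun _ ht => pos_of_mem_uIcc hx hX ht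
  have hVd : IntervalIntegrable (fun t => V t * d t) volume x X :=
    ((F.continuousOn.mul hd.continuousOn).mono hsub).intervalIntegrable
  have hh : IntervalIntegrable h volume x X := by
    simpa using (hd.intervalIntegrable x X hx hX).sub hVd
  have hvh := hh.continuousOn_mul (F.continuousOn_v.mono hsub)
  have huh := hh.continuousOn_mul (F.continuousOn_u.mono hsub)
  -- The two Lagrange identities, of d with v and of d with u, transport the Wronskians from X to x.
  -- Since u, v have Wronskian one, d(x) is recovered as a combination of these Wronskians.
  have e1 := hd.wronskian_sub F.secondPrimitive_v hx hX
  have e2 := hd.wronskian_sub F.secondPrimitive_u hx hX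
  have e1' : ∫ t in x..X, (d t * (V t * v t) - (V t * d t + h t) * v t)
      = -∫ t in x..X, v t * h t := by
    rw [← intervalIntegral.integral_neg]; congr 1; ext t; ring
  have e2' : ∫ t in x..X, (d t * (V t * u t) - (V t * d t + h t) * u t)
      = -∫ t in x..X, u t * h t := by
    rw [← intervalIntegral.integral_neg]; congr 1; ext t; ring
  have e3 : ∫ y in x..X, (u x * v y - v x * u y) * h y
      = u x * (∫ t in x..X, v t * h t) - v x * ∫ t in x..X, u t * h t := by
    rw [← intervalIntegral.integral_const_mul, ← intervalIntegral.integral_const_mul,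
      ← intervalIntegral.integral_sub (hvh.const_mul _) (huh.const_mul _)]
    congr 1; ext t; ring
  rw [e1'] at e1
  rw [e2'] at e2
  have hw := F.wronskian x hx
  rw [e3]
  linear_combination (-d x) * hw - u x * e1 + v x * e2

/-- The backward Green integral of `h` solves `g'' = V g + h`. -/
theorem secondPrimitive_green (F : FundPair V u v u' v') {h : ℝ → ℂ}
    (hu : ∀ a, 0 < a → IntegrableOn (fun y => u y * h y) (Ioi a))
    (hv : ∀ a, 0 < a → IntegrableOn (fun y => v y * h y) (Ioi a)) :
    SecondPrimitive (fun x => ∫ y in Ioi x, (u x * v y - v x * u y) * h y)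
      (fun x => ∫ y in Ioi x, (u' x * v y - v' x * u y) * h y)
      (fun x => V x * (∫ y in Ioi x, (u x * v y - v x * u y) * h y) + h x) := by
  set A : ℝ → ℂ := fun x => ∫ y in Ioi x, u y * h y with hA
  set B : ℝ → ℂ := fun x => ∫ y in Ioi x, v y * h y with hB
  set p : ℝ → ℂ := fun x => u' x * B x - v' x * A x with hp
  set g : ℝ → ℂ := fun x => u x * B x - v x * A x with hg
  have hlin : ∀ (c d : ℂ) (x : ℝ), 0 < x →
      ∫ y in Ioi x, (c * v y - d * u y) * h y = c * B x - d * A x := fun c d x hx => by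
    rw [hA, hB]
    simp only
    rw [← integral_const_mul, ← integral_const_mul,
      ← integral_sub ((hv x hx).const_mul c) ((hu x hx).const_mul d)]
    congr 1; ext y; ring
  have hIu : ∀ x y, 0 < x → 0 < y → IntervalIntegrable (fun y => u y * h y) volume x y :=
    fun x y hx hy => intervalIntegrable_iff.2 ((hu (min x y / 2) (by positivity)).mono_set
      fun t ht => lt_of_le_of_lt (by linarith [lt_min hx hy]) ht.1)
  have hIv : ∀ x y, 0 < x → 0 < y → IntervalIntegrable (fun y => v y * h y) volume x y :=
    fun x y hx hy => intervalIntegrable_iff.2 ((hv (min x y / 2) (by positivity)).mono_set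
      fun t ht => lt_of_le_of_lt (by linarith [lt_min hx hy]) ht.1)
  have hsub : ∀ x y : ℝ, 0 < x → 0 < y → uIcc x y ⊆ Ioi 0 := fun x y hx hy _ ht =>
    pos_of_mem_uIcc hx hy ht
  -- Integrability of `h` itself is not assumed: the unit Wronskian gives h = v' (u h) - u' (v h).
  have hIh : ∀ x y, 0 < x → 0 < y → IntervalIntegrable h volume x y := by
    intro x y hx hy
    have h1 := ((hIu x y hx hy).continuousOn_mul (F.continuousOn_v'.mono (hsub x y hx hy))).sub
      ((hIv x y hx hy).continuousOn_mul (F.continuousOn_u'.mono (hsub x y hx hy)))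
    refine h1.congr_ae ((ae_restrict_iff' measurableSet_uIoc).2 (ae_of_all _ fun t ht => ?_))
    have hw := F.wronskian t (hsub x y hx hy (uIoc_subset_uIcc ht))
    simp only
    linear_combination h t * hw
  have hA' : ∀ x t, 0 < x → 0 < t → A t = A x - ∫ s in x..t, u s * h s := fun x t hx ht => by
    rw [← intervalIntegral.integral_Ioi_sub_Ioi' (hu x hx) (hu t ht)]; simp [hA]
  have hB' : ∀ x t, 0 < x → 0 < t → B t = B x - ∫ s in x..t, v s * h s := fun x t hx ht => by
    rw [← intervalIntegral.integral_Ioi_sub_Ioi' (hv x hx) (hv t ht)]; simp [hB]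
  have hAac : ∀ x y, 0 < x → 0 < y → AbsolutelyContinuousOnInterval A x y := fun x y hx hy =>
    ac_of_dist_le (K := 1) (ac_intervalIntegral (hIu x y hx hy) left_mem_uIcc)
      fun s hs t ht => by
        rw [hA' x s hx (hsub x y hx hy hs), hA' x t hx (hsub x y hx hy ht), dist_sub_left, one_mul]
  have hBac : ∀ x y, 0 < x → 0 < y → AbsolutelyContinuousOnInterval B x y := fun x y hx hy =>
    ac_of_dist_le (K := 1) (ac_intervalIntegral (hIv x y hx hy) left_mem_uIcc)
      fun s hs t ht => by
        rw [hB' x s hx (hsub x y hx hy hs), hB' x t hx (hsub x y hx hy ht), dist_sub_left, one_mul]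
  have hAd : ∀ x y, 0 < x → 0 < y → ∀ᵐ t, t ∈ uIcc x y → HasDerivAt A (-(u t * h t)) t := by
    intro x y hx hy
    filter_upwards [(hIu x y hx hy).ae_hasDerivAt_integral] with t ht hm
    refine ((ht hm x left_mem_uIcc).const_sub (A x)).congr_of_eventuallyEq ?_
    filter_upwards [Ioi_mem_nhds (hsub x y hx hy hm)] with s hs using hA' x s hx hs
  have hBd : ∀ x y, 0 < x → 0 < y → ∀ᵐ t, t ∈ uIcc x y → HasDerivAt B (-(v t * h t)) t := by
    intro x y hx hy
    filter_upwards [(hIv x y hx hy).ae_hasDerivAt_integral] with t ht hm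
    refine ((ht hm x left_mem_uIcc).const_sub (B x)).congr_of_eventuallyEq ?_
    filter_upwards [Ioi_mem_nhds (hsub x y hx hy hm)] with s hs using hB' x s hx hs
  have hacC1 : ∀ {w w' : ℝ → ℂ} {x y : ℝ}, 0 < x → 0 < y →
      (∀ x, 0 < x → HasDerivAt w (w' x) x) → ContinuousOn w' (Ioi 0) →
      AbsolutelyContinuousOnInterval w x y := fun hx hy h1 h2 =>
    ac_of_hasDerivAt (fun t ht => h1 t (pos_of_mem_uIcc hx hy ht)) (h2.mono (hsub _ _ hx hy))
  have hpac : ∀ x y, 0 < x → 0 < y → AbsolutelyContinuousOnInterval p x y := fun x y hx hy =>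
    (ac_mul (hacC1 hx hy F.hasDerivAt_u' (F.continuousOn.mul F.continuousOn_u))
      (hBac x y hx hy)).sub
    (ac_mul (hacC1 hx hy F.hasDerivAt_v' (F.continuousOn.mul F.continuousOn_v)) (hAac x y hx hy))
  have hgac : ∀ x y, 0 < x → 0 < y → AbsolutelyContinuousOnInterval g x y := fun x y hx hy =>
    (ac_mul (hacC1 hx hy F.hasDerivAt_u F.continuousOn_u') (hBac x y hx hy)).sub
    (ac_mul (hacC1 hx hy F.hasDerivAt_v F.continuousOn_v') (hAac x y hx hy))
  have hcts : ∀ {w : ℝ → ℂ}, (∀ x y, 0 < x → 0 < y → AbsolutelyContinuousOnInterval w x y) →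
      ContinuousOn w (Ioi 0) := by
    intro w hw x hx
    have hx : 0 < x := hx
    refine ((hw (x / 2) (2 * x) (by linarith) (by linarith)).continuousOn.continuousAt
      ?_).continuousWithinAt
    rw [uIcc_of_le (by linarith)]
    exact Icc_mem_nhds (by linarith) (by linarith)
  have hpi : ∀ x y, 0 < x → 0 < y → IntervalIntegrable p volume x y := fun x y hx hy =>
    ((hcts hpac).mono (hsub x y hx hy)).intervalIntegrable
  -- The contributions of A' = -u h and B' = -v h to g' cancel, so g' = p almost everywhere. As p is
  -- continuous, g is then differentiable everywhere; in p' the same contributions combine to h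
  -- through the Wronskian.
  have hgp : ∀ x y, 0 < x → 0 < y → g y - g x = ∫ t in x..y, p t := by
    intro x y hx hy
    refine ac_sub_eq_integral (hgac x y hx hy) ?_ (hpi x y hx hy)
    filter_upwards [hAd x y hx hy, hBd x y hx hy] with t h1 h2 ht
    have ht0 := hsub x y hx hy ht
    convert! ((F.hasDerivAt_u t ht0).mul (h2 ht)).sub ((F.hasDerivAt_v t ht0).mul (h1 ht)) using 1
    simp only [hp]; ring
  have hVg : ∀ x y, 0 < x → 0 < y →
      IntervalIntegrable (fun t => V t * g t + h t) volume x y := fun x y hx hy =>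
    ((F.continuousOn.mul (hcts hgac)).mono (hsub x y hx hy)).intervalIntegrable.add
      (hIh x y hx hy)
  have hmain : SecondPrimitive g p (fun x => V x * g x + h x) := by
    refine ⟨fun x hx => hasDerivAt_of_sub_eq_integral (hcts hpac) hgp hx, hVg, fun x y hx hy => ?_⟩
    refine ac_sub_eq_integral (hpac x y hx hy) ?_ (hVg x y hx hy)
    filter_upwards [hAd x y hx hy, hBd x y hx hy] with t h1 h2 ht
    have ht0 := hsub x y hx hy ht
    convert! ((F.hasDerivAt_u' t ht0).mul (h2 ht)).sub ((F.hasDerivAt_v' t ht0).mul (h1 ht)) using 1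
    have hw := F.wronskian t ht0
    simp only [hg]
    linear_combination -h t * hw
  have hg0 : ∀ x, 0 < x → ∫ y in Ioi x, (u x * v y - v x * u y) * h y = g x :=
    fun x hx => hlin _ _ x hx
  have hp0 : ∀ x, 0 < x → ∫ y in Ioi x, (u' x * v y - v' x * u y) * h y = p x :=
    fun x hx => hlin _ _ x hx
  have h1 := hmain.congr (g₁ := fun x => ∫ y in Ioi x, (u x * v y - v x * u y) * h y) hg0
    (h₁ := fun x => V x * (∫ y in Ioi x, (u x * v y - v x * u y) * h y) + h x)
    ((ae_restrict_iff' measurableSet_Ioi).2 (ae_of_all _ fun x hx => by rw [hg0 x hx]))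
  refine ⟨fun x hx => ?_, h1.intervalIntegrable, fun x y hx hy => ?_⟩
  · rw [hp0 x hx]; exact h1.hasDerivAt x hx
  · rw [← h1.sub_eq x y hx hy, hp0 x hx, hp0 y hy]

end FundPair

/-! ### Uniqueness of recessive solutions -/

/-- Backward uniqueness for a merely locally integrable coefficient: |d| + |d'| satisfies a
homogeneous Grönwall inequality with density 1 + |V|. -/
theorem SecondPrimitive.eq_zero_of_vanish {V d d' : ℝ → ℂ}
    (hd : SecondPrimitive d d' (fun t => V t * d t))
    (hV : ∀ x y, 0 < x → 0 < y → IntervalIntegrable V volume x y) {X : ℝ} (hX : 0 < X)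
    (h0 : ∀ x, X ≤ x → d x = 0) (h0' : ∀ x, X ≤ x → d' x = 0) {x : ℝ} (hx : 0 < x) :
    d x = 0 := by
  rcases le_or_gt X x with hxX | hxX
  · exact h0 x hxX
  set a := x / 2 with ha
  have ha0 : 0 < a := by positivity
  have haX : a ≤ X := by linarith
  -- Cutting off at X makes the density integrable on the half-line and loses nothing, since d and
  -- d' vanish beyond X.
  set ρ : ℝ → ℝ := (Iic X).indicator (fun t => 1 + ‖V t‖) with hρ
  have hρ0 : ∀ t, 0 ≤ ρ t := fun t => indicator_nonneg (fun _ _ => by positivity) t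
  have hρi : IntegrableOn ρ (Ioi a) := by
    rw [hρ, integrableOn_indicator_iff measurableSet_Iic, inter_comm, Ioi_inter_Iic]
    have := (intervalIntegrable_iff_integrableOn_Ioc_of_le haX).1 (hV a X ha0 hX)
    exact (integrableOn_const (by simp)).add this.norm
  set N : ℝ → ℝ := fun t => ‖d t‖ + ‖d' t‖ with hN
  have hNc : ContinuousOn N (Icc a X) := by
    have hs : Icc a X ⊆ Ioi 0 := fun t ht => ha0.trans_le ht.1
    exact (hd.continuousOn.mono hs).norm.add (hd.continuousOn_deriv.mono hs).norm
  obtain ⟨M, hM⟩ := isCompact_Icc.exists_bound_of_continuousOn hNc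
  have hN0 : ∀ t, 0 ≤ N t := fun t => by positivity
  have hM0 : 0 ≤ M := (norm_nonneg _).trans (hM a ⟨le_rfl, haX⟩)
  have hvan : ∀ t, X ≤ t → N t = 0 := fun t ht => by simp [hN, h0 t ht, h0' t ht]
  have key := backward_gronwall (g := N) (A := 0) (M := M) hρi (fun t _ => hρ0 t) le_rfl
    (fun t _ => hN0 t) (fun t ht => ?_) (fun t ht => ?_) (show a < x by linarith)
  · rw [mul_zero, zero_mul] at key
    have : ‖d x‖ ≤ 0 := by
      have := norm_nonneg (d' x)
      simp only [hN] at key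
      linarith
    exact norm_le_zero_iff.1 this
  · rcases le_or_gt t X with h | h
    · exact (le_abs_self _).trans (hM t ⟨ht.le, h⟩)
    · rw [hvan t h.le]; exact hM0
  · rw [zero_add]
    rcases le_or_gt X t with h | h
    · rw [hvan t h]
      exact setIntegral_nonneg measurableSet_Ioi fun s _ => mul_nonneg (hρ0 s) (hN0 s)
    have ht0 : 0 < t := ha0.trans ht
    have hs : uIcc t X ⊆ Ioi 0 := fun _ hs => pos_of_mem_uIcc ht0 hX hs
    have hId' : IntervalIntegrable d' volume t X :=
      (hd.continuousOn_deriv.mono hs).intervalIntegrable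
    have e1 : d t = -∫ s in t..X, d' s := by
      rw [intervalIntegral.integral_eq_sub_of_hasDerivAt (fun s hs' => hd.hasDerivAt s (hs hs'))
        hId', h0 X le_rfl]; ring
    have e2 : d' t = -∫ s in t..X, V s * d s := by
      rw [← hd.sub_eq t X ht0 hX, h0' X le_rfl]; ring
    have hVd := hd.intervalIntegrable t X ht0 hX
    have hsum : N t ≤ ∫ s in t..X, (‖d' s‖ + ‖V s * d s‖) := by
      rw [intervalIntegral.integral_add hId'.norm hVd.norm]
      simp only [hN]
      rw [e1, e2, norm_neg, norm_neg]
      exact add_le_add (intervalIntegral.norm_integral_le_integral_norm h.le)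
        (intervalIntegral.norm_integral_le_integral_norm h.le)
    refine hsum.trans ?_
    have hNi : IntervalIntegrable (fun s => (1 + ‖V s‖) * N s) volume t X := by
      refine (((intervalIntegrable_const (c := (1 : ℝ))).add (hV t X ht0 hX).norm)).mul_continuousOn
        ((hd.continuousOn.mono hs).norm.add (hd.continuousOn_deriv.mono hs).norm)
    have hle : ∫ s in t..X, (‖d' s‖ + ‖V s * d s‖) ≤ ∫ s in t..X, (1 + ‖V s‖) * N s := by
      refine intervalIntegral.integral_mono_on h.le (hId'.norm.add hVd.norm) hNi fun s _ => ?_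
      rw [norm_mul]
      simp only [hN]
      nlinarith [norm_nonneg (d s), norm_nonneg (d' s), norm_nonneg (V s),
        mul_nonneg (norm_nonneg (V s)) (norm_nonneg (d' s))]
    refine hle.trans_eq ?_
    have : ∀ s, ρ s * N s = (Iic X).indicator (fun s => (1 + ‖V s‖) * N s) s := fun s => by
      simp only [hρ, indicator]; split_ifs <;> simp
    simp only [this]
    rw [setIntegral_indicator measurableSet_Iic, Ioi_inter_Iic,
      intervalIntegral.integral_of_le h.le]

/-- A solution `d` whose Wronskian with `q` tends to zero and with `d / q → 0` vanishes. -/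
theorem SecondPrimitive.eq_zero_of_wronskian {V d d' q q' : ℝ → ℂ}
    (hd : SecondPrimitive d d' (fun t => V t * d t))
    (hq : SecondPrimitive q q' (fun t => V t * q t))
    (hV : ∀ x y, 0 < x → 0 < y → IntervalIntegrable V volume x y)
    (hW : Tendsto (fun x => d x * q' x - d' x * q x) atTop (𝓝 0))
    (hq0 : ∀ᶠ x in atTop, q x ≠ 0) (hdq : Tendsto (fun x => d x / q x) atTop (𝓝 0))
    {x : ℝ} (hx : 0 < x) : d x = 0 := by
  have hW0 : ∀ x, 0 < x → d x * q' x - d' x * q x = 0 := by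
    intro x hx
    refine tendsto_nhds_unique ?_ hW
    refine (tendsto_const_nhds).congr' ?_
    filter_upwards [eventually_gt_atTop 0] with y hy
    have := hd.wronskian_sub hq hx hy
    have h0 : ∫ t in x..y, (d t * (V t * q t) - V t * d t * q t) = 0 := by
      rw [← intervalIntegral.integral_zero (a := x) (b := y) (μ := volume) (E := ℂ)]
      congr 1; ext t; ring
    rw [h0] at this
    linear_combination -this
  obtain ⟨X₀, hX₀⟩ := eventually_atTop.1 hq0
  set X := max X₀ 1 with hX
  have hX0 : 0 < X := lt_of_lt_of_le one_pos (le_max_right _ _)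
  have hqX : ∀ y, X ≤ y → q y ≠ 0 := fun y hy => hX₀ y ((le_max_left _ _).trans hy)
  -- The numerator of (d/q)' is minus the Wronskian, now known to vanish.
  have hder : ∀ y, X ≤ y → HasDerivAt (fun y => d y / q y) 0 y := by
    intro y hy
    have hy0 := hX0.trans_le hy
    have := (hd.hasDerivAt y hy0).div (hq.hasDerivAt y hy0) (hqX y hy)
    rwa [show d' y * q y - d y * q' y = 0 by linear_combination -hW0 y hy0, zero_div] at this
  have hconst : ∀ y, X ≤ y → d y = 0 := by
    intro y hy
    have h1 : ∀ z, y ≤ z → d z / q z = d y / q y := by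
      intro z hz
      have := intervalIntegral.integral_eq_sub_of_hasDerivAt (a := y) (b := z)
        (f := fun y => d y / q y) (f' := fun _ => 0)
        (fun t ht => hder t (hy.trans (by rw [uIcc_of_le hz] at ht; exact ht.1))) (by simp)
      simp only [intervalIntegral.integral_zero] at this
      linear_combination -this
    have h2 : d y / q y = 0 := by
      refine tendsto_nhds_unique (tendsto_const_nhds.congr' ?_) hdq
      filter_upwards [eventually_ge_atTop y] with z hz using (h1 z hz).symm
    exact (div_eq_zero_iff.1 h2).resolve_right (hqX y hy)
  refine hd.eq_zero_of_vanish hV hX0 hconst (fun y hy => ?_) hx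
  have := hW0 y (hX0.trans_le hy)
  rw [hconst y hy, zero_mul, zero_sub, neg_eq_zero] at this
  exact (mul_eq_zero.1 this).resolve_right (hqX y hy)

/-! ### The zero-energy fundamental pair -/

/-- The second zero-energy solution, `x^{1/2+m}/(2m)` or, if `m = 0`, `x^{1/2} ln x`. -/
def powSol₂ (m : ℂ) (x : ℝ) : ℂ :=
  if m = 0 then (x : ℂ) ^ (1 / 2 : ℂ) * (Real.log x : ℂ) else (x : ℂ) ^ (1 / 2 + m) / (2 * m)

/-- The derivative of `powSol`. -/
def powSolDeriv (m : ℂ) (x : ℝ) : ℂ := (1 / 2 - m) * (x : ℂ) ^ (-1 / 2 - m)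

/-- The derivative of `powSol₂`. -/
def powSol₂Deriv (m : ℂ) (x : ℝ) : ℂ :=
  if m = 0 then (x : ℂ) ^ (-1 / 2 : ℂ) * ((Real.log x : ℂ) / 2 + 1)
  else (1 / 2 + m) * (x : ℂ) ^ (-1 / 2 + m) / (2 * m)

theorem powSol₂_zero :
    powSol₂ 0 = fun x : ℝ => (x : ℂ) ^ (1 / 2 : ℂ) * (Real.log x : ℂ) :=
  funext fun _ => if_pos rfl

theorem powSol₂_of_ne {m : ℂ} (h : m ≠ 0) :
    powSol₂ m = fun x : ℝ => (x : ℂ) ^ (1 / 2 + m) / (2 * m) :=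
  funext fun _ => if_neg h

theorem powSol₂Deriv_zero :
    powSol₂Deriv 0 = fun x : ℝ => (x : ℂ) ^ (-1 / 2 : ℂ) * ((Real.log x : ℂ) / 2 + 1) :=
  funext fun _ => if_pos rfl

theorem powSol₂Deriv_of_ne {m : ℂ} (h : m ≠ 0) :
    powSol₂Deriv m = fun x : ℝ => (1 / 2 + m) * (x : ℂ) ^ (-1 / 2 + m) / (2 * m) :=
  funext fun _ => if_neg h

theorem bisolution_eq (m : ℂ) (x y : ℝ) :
    bisolution m x y = powSol m x * powSol₂ m y - powSol₂ m x * powSol m y := by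
  unfold bisolution powSol powSol₂
  split_ifs with h
  · subst h; simp only [sub_zero]; ring
  · ring

theorem hasDerivAt_cpow {x : ℝ} (hx : 0 < x) (s : ℂ) :
    HasDerivAt (fun x : ℝ => (x : ℂ) ^ s) (s * (x : ℂ) ^ (s - 1)) x := by
  have h := (Complex.hasStrictDerivAt_cpow_const (c := s)
    (Complex.ofReal_mem_slitPlane.2 hx)).hasDerivAt.comp_ofReal
  simpa using h

theorem cpow_sub_mul {x : ℝ} (hx : 0 < x) (s t : ℂ) :
    (x : ℂ) ^ s * (x : ℂ) ^ t = (x : ℂ) ^ (s + t) :=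
  (Complex.cpow_add _ _ (by exact_mod_cast hx.ne')).symm

theorem fundPair_zero (m : ℂ) :
    FundPair (fun x : ℝ => (m ^ 2 - 1 / 4) / (x : ℂ) ^ 2) (powSol m) (powSol₂ m) (powSolDeriv m)
      (powSol₂Deriv m) := by
  have hsq : ∀ x : ℝ, 0 < x → ∀ s : ℂ, (x : ℂ) ^ (s - 2) = (x : ℂ) ^ s / (x : ℂ) ^ 2 := by
    intro x hx s
    rw [Complex.cpow_sub _ _ (by exact_mod_cast hx.ne')]
    norm_num
  have hone : ∀ x : ℝ, 0 < x → ∀ s : ℂ, (x : ℂ) ^ (s - 1) = (x : ℂ) ^ s / (x : ℂ) := by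
    intro x hx s
    rw [Complex.cpow_sub _ _ (by exact_mod_cast hx.ne'), Complex.cpow_one]
  have hlog : ∀ x : ℝ, 0 < x → HasDerivAt (fun x : ℝ => (Real.log x : ℂ)) ((x : ℂ)⁻¹) x := by
    intro x hx
    have := (Real.hasDerivAt_log hx.ne').ofReal_comp
    simpa using this
  refine ⟨?_, fun x hx => ?_, fun x hx => ?_, fun x hx => ?_, fun x hx => ?_, fun x hx => ?_⟩
  · intro x hx
    have : (x : ℂ) ^ 2 ≠ 0 := pow_ne_zero _ (by exact_mod_cast (mem_Ioi.1 hx).ne')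
    refine ContinuousAt.continuousWithinAt ?_
    fun_prop (disch := exact this)
  · convert! hasDerivAt_cpow hx (1 / 2 - m) using 1
    unfold powSolDeriv
    congr 2; ring
  · have hx0 : (x : ℂ) ≠ 0 := by exact_mod_cast hx.ne'
    by_cases h : m = 0
    · rw [h, powSol₂_zero, powSol₂Deriv_zero]
      simp only
      convert! (hasDerivAt_cpow hx (1 / 2)).mul (hlog x hx) using 1
      rw [show (-1 / 2 : ℂ) = 1 / 2 - 1 by norm_num, hone x hx]
      field_simp
    · rw [powSol₂_of_ne h, powSol₂Deriv_of_ne h]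
      simp only
      convert! (hasDerivAt_cpow hx (1 / 2 + m)).div_const (2 * m) using 1
      ring_nf
  · have hx0 : (x : ℂ) ≠ 0 := by exact_mod_cast hx.ne'
    convert! (hasDerivAt_cpow hx (-1 / 2 - m)).const_mul (1 / 2 - m) using 1
    simp only [powSol]
    rw [show (-1 / 2 - m - 1 : ℂ) = (1 / 2 - m) - 2 by ring, hsq x hx]
    field_simp
    ring
  · have hx0 : (x : ℂ) ≠ 0 := by exact_mod_cast hx.ne'
    by_cases h : m = 0
    · rw [h, powSol₂_zero, powSol₂Deriv_zero]
      simp only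
      convert! (hasDerivAt_cpow hx (-1 / 2)).mul (((hlog x hx).div_const 2).add_const 1) using 1
      rw [show (-1 / 2 - 1 : ℂ) = 1 / 2 - 2 by ring, show (-1 / 2 : ℂ) = 1 / 2 - 1 by norm_num,
        hsq x hx, hone x hx]
      field_simp
      ring
    · rw [powSol₂_of_ne h, powSol₂Deriv_of_ne h]
      simp only
      convert! ((hasDerivAt_cpow hx (-1 / 2 + m)).const_mul (1 / 2 + m)).div_const (2 * m) using 1
      rw [show (-1 / 2 + m - 1 : ℂ) = (1 / 2 + m) - 2 by ring, hsq x hx]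
      field_simp
      ring
  · have hx0 : (x : ℂ) ≠ 0 := by exact_mod_cast hx.ne'
    have hz : ∀ s t : ℂ, s + t = 0 → (x : ℂ) ^ s * (x : ℂ) ^ t = 1 := fun s t hst => by
      rw [cpow_sub_mul hx, hst, Complex.cpow_zero]
    by_cases h : m = 0
    · simp only [powSol, powSolDeriv, powSol₂, powSol₂Deriv, h, if_true, sub_zero]
      linear_combination hz (1 / 2) (-1 / 2) (by norm_num)
    · simp only [powSol, powSolDeriv, powSol₂, powSol₂Deriv, h, if_false]
      have h1 := hz (1 / 2 - m) (-1 / 2 + m) (by ring)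
      have h2 := hz (-1 / 2 - m) (1 / 2 + m) (by ring)
      have h3 : 2 * m * (1 / (2 * m)) = 1 := by field_simp
      rw [div_eq_mul_one_div ((1 / 2 + m) * _), div_eq_mul_one_div ((x : ℂ) ^ (1 / 2 + m))]
      linear_combination (1 / 2 + m) * (1 / (2 * m)) * h1
        - (1 / 2 - m) * (1 / (2 * m)) * h2 + h3

/-- The logarithmic factor in the bounds for `m = 0`. -/
def logFactor (m : ℂ) (x : ℝ) : ℝ := if m = 0 then |Real.log x| else 1

theorem logFactor_nonneg (m : ℂ) (x : ℝ) : 0 ≤ logFactor m x := by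
  unfold logFactor; split_ifs <;> positivity

theorem norm_powSol (m : ℂ) {x : ℝ} (hx : 0 < x) : ‖powSol m x‖ = x ^ (1 / 2 - m.re) := by
  rw [powSol, Complex.norm_cpow_eq_rpow_re_of_pos hx]; simp

theorem norm_powSolDeriv (m : ℂ) {x : ℝ} (hx : 0 < x) :
    ‖powSolDeriv m x‖ = ‖1 / 2 - m‖ * (x ^ (1 / 2 - m.re) * x⁻¹) := by
  rw [powSolDeriv, norm_mul, Complex.norm_cpow_eq_rpow_re_of_pos hx, ← Real.rpow_neg_one x,
    ← Real.rpow_add hx]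
  congr 2
  simp only [Complex.sub_re, Complex.div_ofNat_re, Complex.neg_re, Complex.one_re]
  ring

/-- Factoring out x^{2 Re m} measures the second solution against the size of the first. The same
formula then serves m = 0 and m ≠ 0, the difference being confined to `logFactor`. -/
theorem exists_norm_powSol₂_le (m : ℂ) : ∃ C, 0 ≤ C ∧ ∀ x : ℝ, 0 < x →
    ‖powSol₂ m x‖ ≤ C * (x ^ (2 * m.re) * x ^ (1 / 2 - m.re) * logFactor m x) ∧
    ‖powSol₂Deriv m x‖ ≤
      C * (x ^ (2 * m.re) * x ^ (1 / 2 - m.re) * x⁻¹ * (1 + logFactor m x)) := by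
  by_cases h : m = 0
  · refine ⟨1, zero_le_one, fun x hx => ?_⟩
    have e : x ^ (1 / 2 : ℝ) * x⁻¹ = x ^ (-1 / 2 : ℝ) := by
      rw [← Real.rpow_neg_one x, ← Real.rpow_add hx]; norm_num
    have hp : 0 < x ^ (-1 / 2 : ℝ) := Real.rpow_pos_of_pos hx _
    constructor
    · simp only [powSol₂, logFactor, h, if_true, norm_mul, Complex.norm_real, Real.norm_eq_abs]
      rw [Complex.norm_cpow_eq_rpow_re_of_pos hx]
      simp
    · simp only [powSol₂Deriv, logFactor, h, if_true, norm_mul]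
      rw [Complex.norm_cpow_eq_rpow_re_of_pos hx]
      simp only [Complex.zero_re, mul_zero, Real.rpow_zero, sub_zero, one_mul]
      rw [e]
      have h1 : (-1 / 2 : ℂ).re = -1 / 2 := by
        simp [Complex.div_ofNat_re]
      rw [h1]
      gcongr
      calc ‖(Real.log x : ℂ) / 2 + 1‖ ≤ ‖(Real.log x : ℂ) / 2‖ + ‖(1 : ℂ)‖ := norm_add_le _ _
        _ = |Real.log x| / 2 + 1 := by simp
        _ ≤ 1 + |Real.log x| := by linarith [abs_nonneg (Real.log x)]
  · have hm : 0 < ‖m‖ := norm_pos_iff.2 h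
    refine ⟨(1 + ‖1 / 2 + m‖) / (2 * ‖m‖), by positivity, fun x hx => ?_⟩
    have e1 : x ^ (2 * m.re) * x ^ (1 / 2 - m.re) = x ^ (1 / 2 + m.re) := by
      rw [← Real.rpow_add hx]; ring_nf
    have e2 : x ^ (1 / 2 + m.re) * x⁻¹ = x ^ (-1 / 2 + m.re) := by
      rw [← Real.rpow_neg_one x, ← Real.rpow_add hx]; ring_nf
    have hp1 : 0 < x ^ (1 / 2 + m.re) := Real.rpow_pos_of_pos hx _
    have hp2 : 0 < x ^ (-1 / 2 + m.re) := Real.rpow_pos_of_pos hx _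
    rw [e1, e2]
    constructor
    · simp only [powSol₂, logFactor, h, if_false, norm_div, norm_mul, mul_one]
      rw [Complex.norm_cpow_eq_rpow_re_of_pos hx]
      simp only [Complex.add_re, Complex.div_ofNat_re, Complex.one_re, Complex.norm_ofNat]
      rw [div_mul_eq_mul_div]
      gcongr
      nlinarith [norm_nonneg (1 / 2 + m)]
    · simp only [powSol₂Deriv, logFactor, h, if_false, norm_div, norm_mul]
      rw [Complex.norm_cpow_eq_rpow_re_of_pos hx]
      simp only [Complex.add_re, Complex.div_ofNat_re, Complex.one_re, Complex.norm_ofNat,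
        Complex.neg_re]
      rw [div_mul_eq_mul_div]
      gcongr
      · linarith
      · linarith

/-- The weight controlling `Q` at infinity. -/
def potWeight (m : ℂ) (δ : ℝ) (y : ℝ) : ℝ := y ^ δ * (1 + logFactor m y)

/-- An antitone factor, equal to `x^{1-δ}` for `x ≥ 1`. -/
def lowFactor (δ : ℝ) (x : ℝ) : ℝ := x ^ (1 - δ) * (1 + max (-Real.log x) 0)

theorem lowFactor_nonneg {δ x : ℝ} (hx : 0 < x) : 0 ≤ lowFactor δ x := by
  have := Real.rpow_pos_of_pos hx (1 - δ)
  have := le_max_right (-Real.log x) 0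
  unfold lowFactor
  positivity

theorem lowFactor_anti {δ a x : ℝ} (hδ : 1 ≤ δ) (ha : 0 < a) (hx : a ≤ x) :
    lowFactor δ x ≤ lowFactor δ a := by
  have h1 : x ^ (1 - δ) ≤ a ^ (1 - δ) := Real.rpow_le_rpow_of_nonpos ha hx (by linarith)
  have h2 := Real.log_le_log ha hx
  have h3 := le_max_right (-Real.log x) 0
  have h4 := Real.rpow_pos_of_pos ha (1 - δ)
  unfold lowFactor
  gcongr

theorem lowFactor_of_one_le {δ x : ℝ} (hx : 1 ≤ x) : lowFactor δ x = x ^ (1 - δ) := by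
  have := Real.log_nonneg hx
  rw [lowFactor, max_eq_right (by linarith)]; ring

/-- For m = 0 the sign of ln x decides: if ln x ≥ 0 then |ln x| ≤ |ln y|, and otherwise |ln x| is
absorbed by the first factor. Thus the logarithm in y is charged to Q and the one in x to
`lowFactor`. -/
theorem logFactor_sum_le (m : ℂ) {x y : ℝ} (hx : 0 < x) (hxy : x ≤ y) :
    1 + logFactor m x + logFactor m y ≤
      3 * ((1 + max (-Real.log x) 0) * (1 + logFactor m y)) := by
  have h0 := le_max_right (-Real.log x) 0
  have h1 := le_max_left (-Real.log x) 0
  unfold logFactor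
  split_ifs
  · have hl := Real.log_le_log hx hxy
    have ha := abs_nonneg (Real.log y)
    have hb := le_abs_self (Real.log y)
    rcases abs_cases (Real.log x) with ⟨e, _⟩ | ⟨e, _⟩ <;> rw [e] <;>
      nlinarith [mul_nonneg h0 ha]
  · nlinarith

/-! ### Weighted bounds for the zero-energy Green kernel and its derivative in x. -/

section Bounds

variable {m : ℂ} {δ : ℝ}

/-- Controls the product u(x) v(y) φ(y), of order φ(x) y; it is here that δ ≥ 1 is needed. -/
theorem le_rpow_mul_rpow (hδ : 1 ≤ δ) {x y : ℝ} (hx : 0 < x) (hxy : x ≤ y) :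
    y ≤ x ^ (1 - δ) * y ^ δ := by
  have hy := hx.trans_le hxy
  have h1 : y ^ (1 - δ) ≤ x ^ (1 - δ) := Real.rpow_le_rpow_of_nonpos hx hxy (by linarith)
  calc y = y ^ (1 - δ) * y ^ δ := by rw [← Real.rpow_add hy]; simp
    _ ≤ x ^ (1 - δ) * y ^ δ := by gcongr

/-- Controls the product v(x) u(y) φ(y), of order φ(x) x^{2 Re m} y^{1-2 Re m}; it is here that δ ≥
1 - 2 Re m is needed. -/
theorem rpow_mul_rpow_le {r : ℝ} (hδ : 1 - 2 * r ≤ δ) {x y : ℝ} (hx : 0 < x) (hxy : x ≤ y) :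
    x ^ (2 * r) * y ^ (1 - 2 * r) ≤ x ^ (1 - δ) * y ^ δ := by
  have hy := hx.trans_le hxy
  have h1 : y ^ (1 - 2 * r - δ) ≤ x ^ (1 - 2 * r - δ) :=
    Real.rpow_le_rpow_of_nonpos hx hxy (by linarith)
  calc x ^ (2 * r) * y ^ (1 - 2 * r) = x ^ (2 * r) * (y ^ (1 - 2 * r - δ) * y ^ δ) := by
        rw [← Real.rpow_add hy]; ring_nf
    _ ≤ x ^ (2 * r) * (x ^ (1 - 2 * r - δ) * y ^ δ) := by gcongr
    _ = x ^ (1 - δ) * y ^ δ := by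
        rw [← mul_assoc, ← Real.rpow_add hx]; ring_nf

theorem weight_mul_weight {r y : ℝ} (hy : 0 < y) :
    y ^ (2 * r) * y ^ (1 / 2 - r) * y ^ (1 / 2 - r) = y ∧
      y ^ (1 / 2 - r) * y ^ (1 / 2 - r) = y ^ (1 - 2 * r) := by
  constructor
  · rw [← Real.rpow_add hy, ← Real.rpow_add hy]
    convert Real.rpow_one y using 2; ring
  · rw [← Real.rpow_add hy]; ring_nf

/-- A common bound for the Green kernel and its derivative. -/
theorem kernel_bound (hδ1 : 1 ≤ δ) (hδ2 : 1 - 2 * m.re ≤ δ) {C : ℝ} (hC0 : 0 ≤ C)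
    {x y U : ℝ} {p q r s : ℂ} (hx : 0 < x) (hxy : x ≤ y) (hU : 0 ≤ U)
    (hp : ‖p‖ ≤ C * U) (hq : ‖q‖ ≤ C * (y ^ (2 * m.re) * y ^ (1 / 2 - m.re) * logFactor m y))
    (hr : ‖r‖ ≤ C * (x ^ (2 * m.re) * U * (1 + logFactor m x)))
    (hs : ‖s‖ = y ^ (1 / 2 - m.re)) :
    ‖p * q - r * s‖ * y ^ (1 / 2 - m.re) ≤
      3 * (C * C + C) * (U * lowFactor δ x * potWeight m δ y) := by
  have hy := hx.trans_le hxy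
  obtain ⟨w1, w2⟩ := weight_mul_weight (r := m.re) hy
  have b1 := le_rpow_mul_rpow hδ1 hx hxy
  have b2 := rpow_mul_rpow_le hδ2 hx hxy
  have hφ : 0 < y ^ (1 / 2 - m.re) := Real.rpow_pos_of_pos hy _
  have hlx := logFactor_nonneg m x
  have hly := logFactor_nonneg m y
  have hsum := logFactor_sum_le m hx hxy
  have hZ : 0 ≤ x ^ (1 - δ) * y ^ δ := by positivity
  set Z := x ^ (1 - δ) * y ^ δ with hZdef
  have h1 : ‖p * q‖ * y ^ (1 / 2 - m.re) ≤ C * C * (U * Z * logFactor m y) := by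
    rw [norm_mul]
    calc ‖p‖ * ‖q‖ * y ^ (1 / 2 - m.re)
        ≤ (C * U) * (C * (y ^ (2 * m.re) * y ^ (1 / 2 - m.re) * logFactor m y))
            * y ^ (1 / 2 - m.re) := by gcongr
      _ = C * C * (U * (y ^ (2 * m.re) * y ^ (1 / 2 - m.re) * y ^ (1 / 2 - m.re))
            * logFactor m y) := by ring
      _ ≤ _ := by rw [w1]; gcongr
  have h2 : ‖r * s‖ * y ^ (1 / 2 - m.re) ≤ C * (U * Z * (1 + logFactor m x)) := by
    rw [norm_mul, hs]
    calc ‖r‖ * y ^ (1 / 2 - m.re) * y ^ (1 / 2 - m.re)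
        ≤ (C * (x ^ (2 * m.re) * U * (1 + logFactor m x))) * y ^ (1 / 2 - m.re)
            * y ^ (1 / 2 - m.re) := by gcongr
      _ = C * (U * (x ^ (2 * m.re) * (y ^ (1 / 2 - m.re) * y ^ (1 / 2 - m.re)))
            * (1 + logFactor m x)) := by ring
      _ ≤ _ := by rw [w2]; gcongr
  have h3 : ‖p * q - r * s‖ * y ^ (1 / 2 - m.re) ≤
      (‖p * q‖ + ‖r * s‖) * y ^ (1 / 2 - m.re) := by gcongr; exact norm_sub_le _ _
  have h4 : U * lowFactor δ x * potWeight m δ y =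
      U * Z * ((1 + max (-Real.log x) 0) * (1 + logFactor m y)) := by
    rw [lowFactor, potWeight, hZdef]; ring
  rw [h4]
  have hUZ : 0 ≤ U * Z := by positivity
  have h5 := mul_le_mul_of_nonneg_left hsum (mul_nonneg (add_nonneg (mul_nonneg hC0 hC0) hC0) hUZ)
  nlinarith [mul_nonneg (mul_nonneg hC0 hC0) (mul_nonneg hUZ hlx), mul_nonneg hC0 (mul_nonneg hUZ hly),
    mul_nonneg (mul_nonneg hC0 hC0) hUZ]

/-- Both estimates are `kernel_bound`, with U = φ(x) for the kernel and U = φ(x)/x for its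
derivative. Keeping `lowFactor` at x, instead of a constant, is what later yields the rate x^{1-δ}
of the remainder. -/
theorem exists_bisolution_bound (hδ1 : 1 ≤ δ) (hδ2 : 1 - 2 * m.re ≤ δ) :
    ∃ C, 0 ≤ C ∧ ∀ x y : ℝ, 0 < x → x ≤ y →
      ‖bisolution m x y‖ * y ^ (1 / 2 - m.re) ≤
        x ^ (1 / 2 - m.re) * (C * lowFactor δ x * potWeight m δ y) ∧
      ‖powSolDeriv m x * powSol₂ m y - powSol₂Deriv m x * powSol m y‖ * y ^ (1 / 2 - m.re) ≤
        x ^ (1 / 2 - m.re) * x⁻¹ * (C * lowFactor δ x * potWeight m δ y) := by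
  obtain ⟨C₀, hC₀, hC⟩ := exists_norm_powSol₂_le m
  -- One constant that dominates those of the second solution (C₀), of x^{1/2-m} (1) and of its
  -- derivative (‖1/2 - m‖).
  set C := C₀ + 1 + ‖1 / 2 - m‖ with hCdef
  have hn := norm_nonneg (1 / 2 - m)
  have hCC₀ : C₀ ≤ C := by linarith
  have hCp : 0 ≤ C := by linarith
  refine ⟨3 * (C * C + C), by positivity, fun x y hx hxy => ?_⟩
  have hy := hx.trans_le hxy
  have hφ := Real.rpow_pos_of_pos hx (1 / 2 - m.re)
  have hφy := Real.rpow_pos_of_pos hy (1 / 2 - m.re)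
  have h2x := Real.rpow_pos_of_pos hx (2 * m.re)
  have h2y := Real.rpow_pos_of_pos hy (2 * m.re)
  have hlx := logFactor_nonneg m x
  have hly := logFactor_nonneg m y
  have hq : ‖powSol₂ m y‖ ≤ C * (y ^ (2 * m.re) * y ^ (1 / 2 - m.re) * logFactor m y) :=
    ((hC y hy).1).trans (by gcongr)
  constructor
  · rw [bisolution_eq]
    refine (kernel_bound hδ1 hδ2 hCp hx hxy hφ.le (U := x ^ (1 / 2 - m.re)) ?_ hq ?_
      (norm_powSol m hy)).trans_eq (by ring)
    · rw [norm_powSol m hx]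
      nlinarith
    · refine ((hC x hx).1).trans ?_
      gcongr
      linarith
  · refine (kernel_bound hδ1 hδ2 hCp hx hxy (U := x ^ (1 / 2 - m.re) * x⁻¹) (by positivity)
      ?_ hq ?_ (norm_powSol m hy)).trans_eq (by ring)
    · rw [norm_powSolDeriv m hx]
      gcongr
      linarith
    · refine ((hC x hx).2).trans ?_
      rw [← mul_assoc (x ^ (2 * m.re))]
      gcongr

end Bounds

/-! ### Weighted spaces -/

section Weighted

variable {a : ℝ} {φ : ℝ → ℝ} {f : ℝ → ℂ}

theorem MemWeighted.ae_le (hφ : ∀ x, a < x → 0 < φ x) (hf : MemWeighted a φ f) :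
    ∀ᵐ y ∂(volume.restrict (Ioi a)), ‖f y‖ ≤ (wnorm a φ f).toReal * φ y := by
  have h := ae_le_eLpNormEssSup (μ := volume.restrict (Ioi a)) (f := fun x => f x / (φ x : ℂ))
  filter_upwards [h, ae_restrict_mem measurableSet_Ioi] with y hy hya
  rw [← eLpNorm_exponent_top] at hy
  have hp := hφ y hya
  have h2 : ‖f y / (φ y : ℂ)‖ ≤ (wnorm a φ f).toReal := by
    have := ENNReal.toReal_mono hf.2.ne hy
    rwa [toReal_enorm] at this
  rw [norm_div, Complex.norm_real, Real.norm_of_nonneg hp.le, div_le_iff₀ hp] at h2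
  exact h2

theorem wnorm_le {M : ℝ} (hφ : ∀ x, a < x → 0 < φ x)
    (h : ∀ᵐ y ∂(volume.restrict (Ioi a)), ‖f y‖ ≤ M * φ y) :
    wnorm a φ f ≤ ENNReal.ofReal M := by
  rw [wnorm, eLpNorm_exponent_top]
  refine eLpNormEssSup_le_of_ae_bound ?_
  filter_upwards [h, ae_restrict_mem measurableSet_Ioi] with y hy hya
  have hp := hφ y hya
  rwa [norm_div, Complex.norm_real, Real.norm_of_nonneg hp.le, div_le_iff₀ hp]

theorem memWeighted_of_le {M : ℝ} (hφ : ∀ x, a < x → 0 < φ x)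
    (hm : AEStronglyMeasurable f (volume.restrict (Ioi a)))
    (h : ∀ᵐ y ∂(volume.restrict (Ioi a)), ‖f y‖ ≤ M * φ y) : MemWeighted a φ f :=
  ⟨hm, (wnorm_le hφ h).trans_lt ENNReal.ofReal_lt_top⟩

end Weighted

/-- The integral kernel of the operator `-G⁰_← Q`. -/
def greenK (m : ℂ) (Q : ℝ → ℂ) (x y : ℝ) : ℂ := bisolution m x y * Q y

theorem backwardGreen_eq (m : ℂ) (Q f : ℝ → ℂ) (x : ℝ) :
    backwardGreen m Q f x = -volt (greenK m Q) f x := rfl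

namespace VolterraKernel

variable {m : ℂ} {Q : ℝ → ℂ} {φ ρ : ℝ → ℝ} {a : ℝ}

theorem backwardGreenBounded (H : VolterraKernel (greenK m Q) φ ρ a) :
    BackwardGreenBounded m Q a φ := by
  refine ⟨(tail ρ a).toNNReal, fun f hf => ?_⟩
  have hae := hf.ae_le H.pos
  have hM : 0 ≤ (wnorm a φ f).toReal := ENNReal.toReal_nonneg
  have hb : ∀ᵐ y ∂(volume.restrict (Ioi a)),
      ‖backwardGreen m Q f y‖ ≤ (tail ρ a * (wnorm a φ f).toReal) * φ y := by
    filter_upwards [ae_restrict_mem measurableSet_Ioi] with y hy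
    rw [backwardGreen_eq, norm_neg]
    refine (H.norm_volt_le_tail hM hae hy).trans ?_
    have := (H.pos y hy).le
    rw [mul_comm (tail ρ a)]
    have := tail_anti H.integrable H.nonneg le_rfl (le_of_lt hy)
    gcongr
  have hm : AEStronglyMeasurable (backwardGreen m Q f) (volume.restrict (Ioi a)) :=
    ((H.continuousOn_volt hf.1 hM hae).aestronglyMeasurable measurableSet_Ioi).neg
  refine ⟨fun x hx => H.integrableOn hf.1 hM hae hx, memWeighted_of_le H.pos hm hb, ?_⟩
  refine (wnorm_le H.pos hb).trans_eq ?_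
  rw [ENNReal.ofReal_mul (tail_nonneg H.nonneg le_rfl), ENNReal.ofReal_toReal hf.2.ne]
  rfl

/-- Existence is the Neumann series. The work lies in passing between classes modulo null sets and
the pointwise estimates of the Volterra theory. -/
theorem oneAddBackwardGreenBijective (H : VolterraKernel (greenK m Q) φ ρ a) :
    OneAddBackwardGreenBijective m Q a φ := by
  classical
  intro h hh
  have hae := hh.ae_le H.pos
  set M := (wnorm a φ h).toReal with hMdef
  have hM : 0 ≤ M := ENNReal.toReal_nonneg
  -- This representative satisfies the weighted bound at every point, as the estimates of the
  -- iterates require; integrals do not see the change.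
  set h₁ : ℝ → ℂ := fun y => if ‖h y‖ ≤ M * φ y then h y else 0 with hh₁
  have heq : h =ᵐ[volume.restrict (Ioi a)] h₁ := by
    filter_upwards [hae] with y hy
    simp only [hh₁, if_pos hy]
  have hm₁ : AEStronglyMeasurable h₁ (volume.restrict (Ioi a)) := hh.1.congr heq
  have hb₁ : ∀ y, a < y → ‖h₁ y‖ ≤ M * φ y := by
    intro y hy
    simp only [hh₁]
    split_ifs with hc
    · exact hc
    · have := (H.pos y hy).le
      rw [norm_zero]; positivity
  set f := voltSol (greenK m Q) h₁ with hf
  have hfm : AEStronglyMeasurable f (volume.restrict (Ioi a)) :=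
    H.aestronglyMeasurable_voltSol hm₁ hM hb₁
  have hfb : ∀ᵐ y ∂(volume.restrict (Ioi a)),
      ‖f y‖ ≤ (2 * M * Real.exp (2 * tail ρ a)) * φ y :=
    (ae_restrict_iff' measurableSet_Ioi).2
      (ae_of_all _ fun y hy => H.norm_voltSol_le_const hM hb₁ hy)
  refine ⟨f, memWeighted_of_le H.pos hfm hfb, ?_, fun f' hf' hsol => ?_⟩
  · filter_upwards [heq, ae_restrict_mem measurableSet_Ioi] with y hy hya
    rw [backwardGreen_eq, hy, hf]
    nth_rw 1 [H.voltSol_eq hm₁ hM hb₁ hya]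
    ring
  · have hae' := hf'.ae_le H.pos
    set N := (wnorm a φ f').toReal
    have hN : 0 ≤ N := ENNReal.toReal_nonneg
    have hL : 0 ≤ 2 * M * Real.exp (2 * tail ρ a) := by positivity
    -- The difference of two solutions agrees almost everywhere with `D`, and `D`, being an image of
    -- the operator, solves the homogeneous equation at every point.
    set D : ℝ → ℂ := fun y => volt (greenK m Q) f' y - volt (greenK m Q) f y with hD
    have hfd : (fun y => f' y - f y) =ᵐ[volume.restrict (Ioi a)] D := by
      filter_upwards [hsol, heq, ae_restrict_mem measurableSet_Ioi] with y h1 h2 hya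
      rw [backwardGreen_eq] at h1
      have h3 := H.voltSol_eq hm₁ hM hb₁ hya
      simp only [hD]
      rw [← hf] at h3
      linear_combination h1 - h3 + h2
    have hDeq : ∀ y, a < y → D y = volt (greenK m Q) D y := by
      intro y hy
      have e1 := H.volt_sub hf'.1 hN hae' hfm hL hfb hy
      rw [hD]
      simp only
      rw [← e1]
      refine integral_congr_ae ?_
      filter_upwards [ae_restrict_of_ae_restrict_of_subset (Ioi_subset_Ioi hy.le) hfd] with t ht
      rw [ht]
    have hT := tail_nonneg H.nonneg (le_refl a)
    have hDb : ∀ y, a < y → ‖D y‖ ≤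
        (N * tail ρ a + 2 * M * Real.exp (2 * tail ρ a) * tail ρ a) * φ y := by
      intro y hy
      have hp := (H.pos y hy).le
      have ht := tail_anti H.integrable H.nonneg le_rfl hy.le
      refine (norm_sub_le _ _).trans ?_
      rw [add_mul]
      refine add_le_add ((H.norm_volt_le_tail hN hae' hy).trans ?_)
        ((H.norm_volt_le_tail hL hfb hy).trans ?_) <;> gcongr
    filter_upwards [hfd, ae_restrict_mem measurableSet_Ioi] with y h1 hya
    have h2 := H.eq_zero (by positivity) hDb hDeq hya
    rw [h2] at h1
    exact sub_eq_zero.1 h1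

end VolterraKernel

/-! ### The zero-energy solution -/

/-- The hypotheses on the potential. -/
structure PotAssumption (m : ℂ) (δ : ℝ) (Q : ℝ → ℂ) : Prop where
  one_le : 1 ≤ δ
  le_delta : 1 - 2 * m.re ≤ δ
  locallyIntegrable : LocallyIntegrableOn Q (Ioi 0)
  integrableOn : ∀ a, 0 < a → IntegrableOn (fun y => potWeight m δ y * ‖Q y‖) (Ioi a)

theorem continuousOn_logFactor (m : ℂ) : ContinuousOn (logFactor m) (Ioi 0) := by
  by_cases h : m = 0
  · have : logFactor m = fun x => |Real.log x| := funext fun x => if_pos h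
    rw [this]
    exact (Real.continuousOn_log.mono fun x hx => (mem_Ioi.1 hx).ne').abs
  · have : logFactor m = fun _ => 1 := funext fun x => if_neg h
    rw [this]
    exact continuousOn_const

theorem continuousOn_rpow (s : ℝ) : ContinuousOn (fun x : ℝ => x ^ s) (Ioi 0) :=
  fun x hx => (Real.continuousAt_rpow_const x s (Or.inl (mem_Ioi.1 hx).ne')).continuousWithinAt

theorem potWeight_nonneg (m : ℂ) (δ : ℝ) {y : ℝ} (hy : 0 < y) : 0 ≤ potWeight m δ y := by
  have := Real.rpow_pos_of_pos hy δ
  have := logFactor_nonneg m y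
  unfold potWeight
  positivity

/-- Merges the two cases into one hypothesis: for m ≠ 0 the factor 1 + `logFactor` is the constant
2. Local integrability extends the weighted bound from ]1,∞[ to every ]a,∞[. -/
theorem potAssumption {m : ℂ} {δ : ℝ} (hδ : 1 + 2 * max (-m.re) 0 ≤ δ) {Q : ℝ → ℂ}
    (hQ : m ≠ 0 → Q ∈ potInfty δ) (hQ0 : m = 0 → Q ∈ potInftyLog δ) : PotAssumption m δ Q := by
  have hloc : LocallyIntegrableOn Q (Ioi 0) := by
    by_cases h : m = 0
    · exact (hQ0 h).1
    · exact (hQ h).1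
  have hone : IntegrableOn (fun y => potWeight m δ y * ‖Q y‖) (Ioi 1) := by
    by_cases h : m = 0
    · refine (hQ0 h).2.congr_fun (fun y hy => ?_) measurableSet_Ioi
      simp only [potWeight, logFactor, h, if_true]
      rw [abs_of_nonneg (Real.log_nonneg (le_of_lt hy))]
    · refine IntegrableOn.congr_fun ((hQ h).2.const_mul 2) (fun y hy => ?_) measurableSet_Ioi
      simp only [potWeight, logFactor, h, if_false]
      ring
  refine ⟨?_, ?_, hloc, fun a ha => ?_⟩
  · linarith [le_max_right (-m.re) 0]
  · linarith [le_max_left (-m.re) 0]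
  · have hsub : Ioi a ⊆ Icc a 1 ∪ Ioi 1 := fun y hy => by
      rcases le_or_gt y 1 with h | h
      · exact Or.inl ⟨le_of_lt hy, h⟩
      · exact Or.inr h
    refine (IntegrableOn.union ?_ hone).mono_set hsub
    have hs : Icc a 1 ⊆ Ioi 0 := fun y hy => ha.trans_le hy.1
    refine IntegrableOn.continuousOn_mul ?_
      ((hloc.integrableOn_compact_subset hs isCompact_Icc).norm) isCompact_Icc
    exact ((continuousOn_rpow δ).mul (continuousOn_const.add (continuousOn_logFactor m))).mono hs

theorem aestronglyMeasurable_of_locallyIntegrableOn {Q : ℝ → ℂ}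
    (hQ : LocallyIntegrableOn Q (Ioi 0)) {a : ℝ} (ha : 0 ≤ a) :
    AEStronglyMeasurable Q (volume.restrict (Ioi a)) :=
  hQ.aestronglyMeasurable.mono_measure (Measure.restrict_mono_set _ (Ioi_subset_Ioi ha))

/-- The zero-energy solution `q_{-m}`. -/
def zeroSol (m : ℂ) (Q : ℝ → ℂ) : ℝ → ℂ := voltSol (greenK m Q) (powSol m)

/-- The derivative of `zeroSol`. -/
def zeroSolDeriv (m : ℂ) (Q : ℝ → ℂ) (x : ℝ) : ℂ :=
  powSolDeriv m x + ∫ y in Ioi x,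
    (powSolDeriv m x * powSol₂ m y - powSol₂Deriv m x * powSol m y) * (Q y * zeroSol m Q y)

namespace PotAssumption

variable {m : ℂ} {δ : ℝ} {Q : ℝ → ℂ}

/-- The kernel bound depends on x through `lowFactor`; this factor is antitone, so its value at the
endpoint a gives a density in y alone. -/
theorem volterraKernel (H : PotAssumption m δ Q) {a C : ℝ} (ha : 0 < a) (hC0 : 0 ≤ C)
    (hC : ∀ x y : ℝ, 0 < x → x ≤ y → ‖bisolution m x y‖ * y ^ (1 / 2 - m.re) ≤
        x ^ (1 / 2 - m.re) * (C * lowFactor δ x * potWeight m δ y)) :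
    VolterraKernel (greenK m Q) (fun x => x ^ (1 / 2 - m.re))
      (fun y => C * lowFactor δ a * (potWeight m δ y * ‖Q y‖)) a := by
  have F := fundPair_zero m
  refine ⟨fun x hx => Real.rpow_pos_of_pos (ha.trans hx) _,
    (continuousOn_rpow _).mono fun x hx => ha.trans hx, fun x hx => ?_,
    (H.integrableOn a ha).const_mul _, fun x y hx hxy => ?_, fun x hx => ?_, fun y => ?_⟩
  · have := lowFactor_nonneg (δ := δ) ha
    have := potWeight_nonneg m δ (ha.trans hx)
    positivity
  · have hx0 := ha.trans hx
    have hw := potWeight_nonneg m δ (hx0.trans hxy)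
    have hl := lowFactor_anti H.one_le ha hx.le
    have hφ := Real.rpow_pos_of_pos hx0 (1 / 2 - m.re)
    rw [greenK, norm_mul]
    calc ‖bisolution m x y‖ * ‖Q y‖ * y ^ (1 / 2 - m.re)
        = (‖bisolution m x y‖ * y ^ (1 / 2 - m.re)) * ‖Q y‖ := by ring
      _ ≤ (x ^ (1 / 2 - m.re) * (C * lowFactor δ x * potWeight m δ y)) * ‖Q y‖ := by
          exact mul_le_mul_of_nonneg_right (hC x y hx0 hxy.le) (norm_nonneg _)
      _ ≤ (x ^ (1 / 2 - m.re) * (C * lowFactor δ a * potWeight m δ y)) * ‖Q y‖ := by gcongr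
      _ = _ := by ring
  · refine AEStronglyMeasurable.mul ?_
      (aestronglyMeasurable_of_locallyIntegrableOn H.locallyIntegrable ha.le)
    refine ContinuousOn.aestronglyMeasurable ?_ measurableSet_Ioi
    have hs : Ioi a ⊆ Ioi 0 := Ioi_subset_Ioi ha.le
    rw [show bisolution m x = fun y => powSol m x * powSol₂ m y - powSol₂ m x * powSol m y from
      funext fun y => bisolution_eq m x y]
    exact (continuousOn_const.mul (F.continuousOn_v.mono hs)).sub
      (continuousOn_const.mul (F.continuousOn_u.mono hs))
  · have hs : Ioo a y ⊆ Ioi 0 := fun x hx => ha.trans hx.1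
    simp only [greenK, bisolution_eq]
    exact (((F.continuousOn_u.mono hs).mul continuousOn_const).sub
      ((F.continuousOn_v.mono hs).mul continuousOn_const)).mul continuousOn_const

theorem exists_volterraKernel (H : PotAssumption m δ Q) {a : ℝ} (ha : 0 < a) :
    ∃ ρ, VolterraKernel (greenK m Q) (fun x => x ^ (1 / 2 - m.re)) ρ a := by
  obtain ⟨C, hC0, hC⟩ := exists_bisolution_bound H.one_le H.le_delta
  exact ⟨_, H.volterraKernel ha hC0 fun x y hx hxy => (hC x y hx hxy).1⟩

theorem norm_powSol_le {a y : ℝ} (ha : 0 < a) (hy : a < y) :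
    ‖powSol m y‖ ≤ 1 * y ^ (1 / 2 - m.re) := by
  rw [norm_powSol m (ha.trans hy), one_mul]

theorem aestronglyMeasurable_powSol {a : ℝ} (ha : 0 < a) :
    AEStronglyMeasurable (powSol m) (volume.restrict (Ioi a)) :=
  ((fundPair_zero m).continuousOn_u.mono (Ioi_subset_Ioi ha.le)).aestronglyMeasurable
    measurableSet_Ioi

/-- The Neumann series does not involve the endpoint a, so one function serves all half-lines; the
endpoint x/2 reaches a given x. -/
theorem zeroSol_eq (H : PotAssumption m δ Q) {x : ℝ} (hx : 0 < x) :
    zeroSol m Q x = powSol m x + volt (greenK m Q) (zeroSol m Q) x := by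
  obtain ⟨ρ, K⟩ := H.exists_volterraKernel (a := x / 2) (by linarith)
  exact K.voltSol_eq (aestronglyMeasurable_powSol (by linarith)) zero_le_one
    (fun y hy => norm_powSol_le (by linarith) hy) (by linarith)

theorem exists_zeroSol_bound (H : PotAssumption m δ Q) {a : ℝ} (ha : 0 < a) :
    ∃ M, 0 ≤ M ∧ ∀ y, a < y → ‖zeroSol m Q y‖ ≤ M * y ^ (1 / 2 - m.re) := by
  obtain ⟨ρ, K⟩ := H.exists_volterraKernel ha
  exact ⟨_, by positivity, fun y hy => K.norm_voltSol_le_const zero_le_one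
    (fun y hy => norm_powSol_le ha hy) hy⟩

theorem aestronglyMeasurable_zeroSol (H : PotAssumption m δ Q) {a : ℝ} (ha : 0 < a) :
    AEStronglyMeasurable (zeroSol m Q) (volume.restrict (Ioi a)) := by
  obtain ⟨ρ, K⟩ := H.exists_volterraKernel ha
  exact K.aestronglyMeasurable_voltSol (aestronglyMeasurable_powSol ha) zero_le_one
    (fun y hy => norm_powSol_le ha hy)

theorem isBackwardInverse (H : PotAssumption m δ Q) :
    IsBackwardInverse m Q (fun x : ℝ => x ^ (1 / 2 - m.re)) (powSol m) (zeroSol m Q) := by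
  intro a ha
  obtain ⟨ρ, K⟩ := H.exists_volterraKernel ha
  obtain ⟨M, hM, hb⟩ := H.exists_zeroSol_bound ha
  refine ⟨K.backwardGreenBounded, K.oneAddBackwardGreenBijective, ?_, ?_, fun x hx => ?_⟩
  · exact memWeighted_of_le K.pos (aestronglyMeasurable_powSol ha)
      ((ae_restrict_iff' measurableSet_Ioi).2 (ae_of_all _ fun y hy => norm_powSol_le ha hy))
  · exact memWeighted_of_le K.pos (H.aestronglyMeasurable_zeroSol ha)
      ((ae_restrict_iff' measurableSet_Ioi).2 (ae_of_all _ hb))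
  · rw [backwardGreen_eq]
    nth_rw 1 [H.zeroSol_eq (ha.trans hx)]
    ring

/-- Division by a constant commutes with the operator. At the poles `Complex.Gamma` takes the value
0, and division by zero then gives the zero function on both sides, in accordance with 1/Γ = 0. -/
theorem isBackwardInverse_uZero (H : PotAssumption m δ Q) :
    IsBackwardInverse m Q (fun x : ℝ => x ^ (1 / 2 - m.re)) (uZero (-m))
      (fun x => zeroSol m Q x / Complex.Gamma (1 - m)) := by
  have hu : uZero (-m) = fun x => powSol m x / Complex.Gamma (1 - m) := by
    ext x; simp only [uZero, powSol, ← sub_eq_add_neg]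
  intro a ha
  obtain ⟨h1, h2, h3, h4, h5⟩ := H.isBackwardInverse a ha
  have hpos : ∀ x, a < x → 0 < x ^ (1 / 2 - m.re) :=
    fun x hx => Real.rpow_pos_of_pos (ha.trans hx) _
  have hdiv : ∀ f : ℝ → ℂ, MemWeighted a (fun x : ℝ => x ^ (1 / 2 - m.re)) f →
      MemWeighted a (fun x : ℝ => x ^ (1 / 2 - m.re))
        (fun x => f x / Complex.Gamma (1 - m)) := by
    intro f hf
    refine memWeighted_of_le (M := (wnorm a (fun x : ℝ => x ^ (1 / 2 - m.re)) f).toReal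
      / ‖Complex.Gamma (1 - m)‖) hpos (by simpa only [div_eq_mul_inv] using hf.1.mul_const _) ?_
    filter_upwards [hf.ae_le hpos] with y hy
    rw [norm_div, div_mul_eq_mul_div]
    gcongr
  refine ⟨h1, h2, hu ▸ hdiv _ h3, hdiv _ h4, fun x hx => ?_⟩
  have e : backwardGreen m Q (fun x => zeroSol m Q x / Complex.Gamma (1 - m)) x =
      backwardGreen m Q (zeroSol m Q) x / Complex.Gamma (1 - m) := by
    rw [backwardGreen, backwardGreen, neg_div, ← integral_div]
    congr 2; ext y; ring
  rw [e, hu]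
  simp only
  rw [← add_div, h5 x hx]

/-- Supplies the hypotheses of `FundPair.secondPrimitive_green` for h = Q f; the two halves rest on
the two inequalities behind the kernel bound. -/
theorem integrableOn_solutions (H : PotAssumption m δ Q) {f : ℝ → ℂ} {a M : ℝ} (ha : 0 < a)
    (hM : 0 ≤ M) (hf : AEStronglyMeasurable f (volume.restrict (Ioi a)))
    (hb : ∀ y, a < y → ‖f y‖ ≤ M * y ^ (1 / 2 - m.re)) :
    IntegrableOn (fun y => powSol m y * (Q y * f y)) (Ioi a) ∧
      IntegrableOn (fun y => powSol₂ m y * (Q y * f y)) (Ioi a) := by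
  obtain ⟨C, hC0, hC⟩ := exists_norm_powSol₂_le m
  have F := fundPair_zero m
  have hs : Ioi a ⊆ Ioi 0 := Ioi_subset_Ioi ha.le
  have hQm := aestronglyMeasurable_of_locallyIntegrableOn H.locallyIntegrable ha.le
  constructor
  · refine Integrable.mono' ((H.integrableOn a ha).const_mul
      (M * (a ^ (1 - δ) / a ^ (2 * m.re))))
      (((F.continuousOn_u.mono hs).aestronglyMeasurable measurableSet_Ioi).mul (hQm.mul hf)) ?_
    filter_upwards [ae_restrict_mem measurableSet_Ioi] with y hy
    have hy0 := ha.trans hy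
    have hφ := Real.rpow_pos_of_pos hy0 (1 / 2 - m.re)
    have h2 := rpow_mul_rpow_le H.le_delta ha (le_of_lt hy)
    have ha2 := Real.rpow_pos_of_pos ha (2 * m.re)
    have hl := logFactor_nonneg m y
    have hd := Real.rpow_pos_of_pos hy0 δ
    have ha3 := Real.rpow_pos_of_pos ha (1 - δ)
    rw [norm_mul, norm_mul, norm_powSol m hy0]
    calc y ^ (1 / 2 - m.re) * (‖Q y‖ * ‖f y‖)
        ≤ y ^ (1 / 2 - m.re) * (‖Q y‖ * (M * y ^ (1 / 2 - m.re))) := by gcongr; exact hb y hy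
      _ = M * (y ^ (1 / 2 - m.re) * y ^ (1 / 2 - m.re)) * ‖Q y‖ := by ring
      _ = M * y ^ (1 - 2 * m.re) * ‖Q y‖ := by rw [(weight_mul_weight hy0).2]
      _ ≤ M * (a ^ (1 - δ) / a ^ (2 * m.re) * y ^ δ) * ‖Q y‖ := by
          gcongr
          rw [div_mul_eq_mul_div, le_div_iff₀ ha2]
          linarith
      _ ≤ M * (a ^ (1 - δ) / a ^ (2 * m.re) * potWeight m δ y) * ‖Q y‖ := by
          gcongr
          rw [potWeight]
          nlinarith
      _ = _ := by ring
  · refine Integrable.mono' ((H.integrableOn a ha).const_mul (M * C * a ^ (1 - δ)))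
      (((F.continuousOn_v.mono hs).aestronglyMeasurable measurableSet_Ioi).mul (hQm.mul hf)) ?_
    filter_upwards [ae_restrict_mem measurableSet_Ioi] with y hy
    have hy0 := ha.trans hy
    have hφ := Real.rpow_pos_of_pos hy0 (1 / 2 - m.re)
    have h2 := le_rpow_mul_rpow H.one_le ha (le_of_lt hy)
    have hl := logFactor_nonneg m y
    have hd := Real.rpow_pos_of_pos hy0 δ
    have ha3 := Real.rpow_pos_of_pos ha (1 - δ)
    rw [norm_mul, norm_mul]
    calc ‖powSol₂ m y‖ * (‖Q y‖ * ‖f y‖)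
        ≤ (C * (y ^ (2 * m.re) * y ^ (1 / 2 - m.re) * logFactor m y)) *
            (‖Q y‖ * (M * y ^ (1 / 2 - m.re))) := by
          gcongr
          · exact (hC y hy0).1
          · exact hb y hy
      _ = M * C * ((y ^ (2 * m.re) * y ^ (1 / 2 - m.re) * y ^ (1 / 2 - m.re)) * logFactor m y)
            * ‖Q y‖ := by ring
      _ = M * C * (y * logFactor m y) * ‖Q y‖ := by rw [(weight_mul_weight hy0).1]
      _ ≤ M * C * ((a ^ (1 - δ) * y ^ δ) * (1 + logFactor m y)) * ‖Q y‖ := by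
          gcongr
          linarith
      _ = _ := by rw [potWeight]; ring

theorem secondPrimitive_zeroSol (H : PotAssumption m δ Q) :
    SecondPrimitive (zeroSol m Q) (zeroSolDeriv m Q)
      (fun t : ℝ => ((m ^ 2 - 1 / 4) / (t : ℂ) ^ 2 + (0 : ℂ) ^ 2 + Q t) * zeroSol m Q t) := by
  have F := fundPair_zero m
  have hint : ∀ a, 0 < a → IntegrableOn (fun y => powSol m y * (Q y * zeroSol m Q y)) (Ioi a) ∧
      IntegrableOn (fun y => powSol₂ m y * (Q y * zeroSol m Q y)) (Ioi a) := by
    intro a ha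
    obtain ⟨M, hM, hb⟩ := H.exists_zeroSol_bound ha
    exact H.integrableOn_solutions ha hM (H.aestronglyMeasurable_zeroSol ha) hb
  -- The Volterra term is the backward Green integral of Q q, so the equation can be differentiated
  -- twice.
  have G := F.secondPrimitive_green (h := fun y => Q y * zeroSol m Q y)
    (fun a ha => (hint a ha).1) (fun a ha => (hint a ha).2)
  have hv : ∀ x, 0 < x → zeroSol m Q x = powSol m x +
      ∫ y in Ioi x, (powSol m x * powSol₂ m y - powSol₂ m x * powSol m y) *
        (Q y * zeroSol m Q y) := by
    intro x hx
    rw [H.zeroSol_eq hx]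
    simp only [volt, greenK, bisolution_eq, mul_assoc]
  refine (F.secondPrimitive_u.add G).congr (fun x hx => hv x hx) ?_
  refine (ae_restrict_iff' measurableSet_Ioi).2 (ae_of_all _ fun x hx => ?_)
  have := hv x hx
  linear_combination (-(m ^ 2 - 1 / 4) / (x : ℂ) ^ 2) * this

/-- The rate of the asymptotics: `lowFactor` contributes x^{1-δ}, and the tail of the weighted
potential contributes the o(1). -/
theorem norm_integral_kernel_le (H : PotAssumption m δ Q) {M C x : ℝ} {κ : ℝ} {k : ℝ → ℂ}
    (hx : 1 ≤ x)
    (hk : ∀ y, x ≤ y → ‖k y‖ * y ^ (1 / 2 - m.re) ≤ κ * (C * lowFactor δ x * potWeight m δ y))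
    (hb : ∀ y, x < y → ‖zeroSol m Q y‖ ≤ M * y ^ (1 / 2 - m.re)) (hM : 0 ≤ M) :
    ‖∫ y in Ioi x, k y * (Q y * zeroSol m Q y)‖ ≤
      C * M * (κ * x ^ (1 - δ)) * tail (fun y => potWeight m δ y * ‖Q y‖) x := by
  rw [tail, ← integral_const_mul]
  refine norm_integral_le_of_norm_le
    ((H.integrableOn x (by linarith)).const_mul (C * M * (κ * x ^ (1 - δ)))) ?_
  filter_upwards [ae_restrict_mem measurableSet_Ioi] with y hy
  have hk' := hk y (le_of_lt hy)
  rw [lowFactor_of_one_le hx] at hk'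
  rw [norm_mul, norm_mul]
  calc ‖k y‖ * (‖Q y‖ * ‖zeroSol m Q y‖)
      ≤ ‖k y‖ * (‖Q y‖ * (M * y ^ (1 / 2 - m.re))) := by gcongr; exact hb y hy
    _ = M * ‖Q y‖ * (‖k y‖ * y ^ (1 / 2 - m.re)) := by ring
    _ ≤ M * ‖Q y‖ * (κ * (C * x ^ (1 - δ) * potWeight m δ y)) := by gcongr
    _ = _ := by ring

theorem zeroSol_asymptotics (H : PotAssumption m δ Q) :
    (fun x : ℝ => zeroSol m Q x - powSol m x) =o[atTop] (fun x : ℝ => x ^ (3 / 2 - m.re - δ)) ∧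
    (fun x : ℝ => zeroSolDeriv m Q x - powSolDeriv m x) =o[atTop]
      (fun x : ℝ => x ^ (1 / 2 - m.re - δ)) := by
  obtain ⟨C, hC0, hC⟩ := exists_bisolution_bound H.one_le H.le_delta
  obtain ⟨M, hM, hb⟩ := H.exists_zeroSol_bound (a := 1 / 2) (by norm_num)
  have htail := tendsto_tail (H.integrableOn 1 one_pos)
  have hlit : ∀ {f : ℝ → ℂ} {g : ℝ → ℝ}, (∀ x, 1 ≤ x → ‖f x‖ ≤
      C * M * g x * tail (fun y => potWeight m δ y * ‖Q y‖) x) → f =o[atTop] g := by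
    intro f g hfg
    have h1 : (fun x => C * M * g x * tail (fun y => potWeight m δ y * ‖Q y‖) x)
        =o[atTop] (fun x => g x * 1) :=
      ((isBigO_refl g atTop).const_mul_left (C * M)).mul_isLittleO
        ((isLittleO_one_iff ℝ).2 htail)
    simp only [mul_one] at h1
    refine IsBigO.trans_isLittleO (IsBigO.of_bound 1 ?_) h1
    filter_upwards [eventually_ge_atTop 1] with x hx
    rw [one_mul]
    exact (hfg x hx).trans (le_abs_self _)
  constructor
  · refine hlit fun x hx => ?_
    have hx0 : 0 < x := by linarith
    have e : zeroSol m Q x - powSol m x =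
        ∫ y in Ioi x, bisolution m x y * (Q y * zeroSol m Q y) := by
      rw [H.zeroSol_eq hx0, add_sub_cancel_left]
      simp only [volt, greenK, mul_assoc]
    rw [e, show x ^ (3 / 2 - m.re - δ) = x ^ (1 / 2 - m.re) * x ^ (1 - δ) by
      rw [← Real.rpow_add hx0]; ring_nf]
    exact H.norm_integral_kernel_le hx (fun y hy => (hC x y hx0 hy).1)
      (fun y hy => hb y (by linarith)) hM
  · refine hlit fun x hx => ?_
    have hx0 : 0 < x := by linarith
    rw [zeroSolDeriv, add_sub_cancel_left, show x ^ (1 / 2 - m.re - δ) =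
      x ^ (1 / 2 - m.re) * x⁻¹ * x ^ (1 - δ) by
        rw [← Real.rpow_neg_one x, ← Real.rpow_add hx0, ← Real.rpow_add hx0]; ring_nf]
    exact H.norm_integral_kernel_le hx (fun y hy => (hC x y hx0 hy).2)
      (fun y hy => hb y (by linarith)) hM

theorem isZeroEnergySolution (H : PotAssumption m δ Q) :
    IsZeroEnergySolution m δ Q (zeroSol m Q) := by
  have S := H.secondPrimitive_zeroSol
  have F := fundPair_zero m
  refine ⟨S.isEigensolution, H.zeroSol_asymptotics.1, ?_⟩
  refine H.zeroSol_asymptotics.2.congr' ?_ EventuallyEq.rfl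
  filter_upwards [eventually_gt_atTop 0] with x hx
  rw [S.deriv_eq hx, (F.hasDerivAt_u x hx).deriv]

theorem isBigO_rpow {s t : ℝ} (h : s ≤ t) :
    (fun x : ℝ => x ^ s) =O[atTop] (fun x : ℝ => x ^ t) := by
  refine IsBigO.of_bound 1 ?_
  filter_upwards [eventually_ge_atTop 1] with x hx
  rw [one_mul, Real.norm_of_nonneg (by positivity), Real.norm_of_nonneg (by positivity)]
  exact Real.rpow_le_rpow_of_exponent_le hx h

/-- The remainder class excludes multiples of the second solution even where x^{1/2-m} is the
smaller at infinity or the larger: the Wronskian with q is o(x^{1-2 Re m-δ}), hence o(1), and the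
quotient by q is o(x^{1-δ}), hence o(1). -/
theorem eqOn_of_isZeroEnergySolution (H : PotAssumption m δ Q) {g : ℝ → ℂ}
    (hg : IsZeroEnergySolution m δ Q g) : EqOn g (zeroSol m Q) (Ioi 0) := by
  have S := H.secondPrimitive_zeroSol
  have F := fundPair_zero m
  have G := hg.1.secondPrimitive H.locallyIntegrable
  have hQ := H.isZeroEnergySolution
  have D := G.sub S
  have D' := D.congr (g₁ := fun x => g x - zeroSol m Q x) (fun x _ => rfl)
    (h₁ := fun t : ℝ => ((m ^ 2 - 1 / 4) / (t : ℂ) ^ 2 + (0 : ℂ) ^ 2 + Q t) *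
      (g t - zeroSol m Q t)) (ae_of_all _ fun x => by ring)
  have h1 : (fun x => g x - zeroSol m Q x) =o[atTop] (fun x : ℝ => x ^ (3 / 2 - m.re - δ)) := by
    simpa using hg.2.1.sub hQ.2.1
  have h2 : (fun x => deriv g x - zeroSolDeriv m Q x) =o[atTop]
      (fun x : ℝ => x ^ (1 / 2 - m.re - δ)) := by
    refine (hg.2.2.sub hQ.2.2).congr' ?_ EventuallyEq.rfl
    filter_upwards [eventually_gt_atTop 0] with x hx
    rw [S.deriv_eq hx]; ring
  have hexp : (fun x : ℝ => x ^ (3 / 2 - m.re - δ)) =O[atTop] (fun x : ℝ => x ^ (1 / 2 - m.re)) :=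
    isBigO_rpow (by linarith [H.one_le])
  have hpow : (fun x : ℝ => x ^ (1 / 2 - m.re)) =O[atTop] powSol m := by
    refine IsBigO.of_bound 1 ?_
    filter_upwards [eventually_gt_atTop 0] with x hx
    rw [norm_powSol m hx, one_mul, Real.norm_of_nonneg (by positivity)]
  have hpow' : powSol m =O[atTop] (fun x : ℝ => x ^ (1 / 2 - m.re)) := by
    refine IsBigO.of_bound 1 ?_
    filter_upwards [eventually_gt_atTop 0] with x hx
    rw [norm_powSol m hx, one_mul, Real.norm_of_nonneg (by positivity)]
  have hequiv : IsEquivalent atTop (zeroSol m Q) (powSol m) :=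
    (hQ.2.1.trans_isBigO hexp).trans_isBigO hpow
  have hqbig : zeroSol m Q =O[atTop] (fun x : ℝ => x ^ (1 / 2 - m.re)) :=
    hequiv.isBigO.trans hpow'
  have hqbig' : (fun x : ℝ => x ^ (1 / 2 - m.re)) =O[atTop] zeroSol m Q :=
    hpow.trans hequiv.isBigO_symm
  have hq'big : zeroSolDeriv m Q =O[atTop] (fun x : ℝ => x ^ (-1 / 2 - m.re)) := by
    have e1 : powSolDeriv m =O[atTop] (fun x : ℝ => x ^ (-1 / 2 - m.re)) := by
      refine IsBigO.of_bound ‖1 / 2 - m‖ ?_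
      filter_upwards [eventually_gt_atTop 0] with x hx
      rw [norm_powSolDeriv m hx, Real.norm_of_nonneg (by positivity), ← Real.rpow_neg_one x,
        ← Real.rpow_add hx]
      ring_nf; rfl
    have e2 := (H.zeroSol_asymptotics.2.trans_isBigO
      (isBigO_rpow (t := -1 / 2 - m.re) (by linarith [H.one_le]))).isBigO.add e1
    simpa using e2
  have hmul : ∀ s t : ℝ, s + t ≤ 0 →
      (fun x : ℝ => x ^ s * x ^ t) =O[atTop] (fun _ : ℝ => (1 : ℝ)) := by
    intro s t hst
    refine (IsBigO.congr' (isBigO_rpow hst) ?_ ?_)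
    · filter_upwards [eventually_gt_atTop 0] with x hx
      rw [← Real.rpow_add hx]
    · exact Eventually.of_forall fun x => by simp
  have hd1 := H.le_delta
  -- Both products have order 1 - 2 Re m - δ, which is nonpositive by the second condition on δ.
  have hW1 := ((h1.mul_isBigO hq'big).trans_isBigO (hmul _ _ (by linarith)))
  have hW2 := ((h2.mul_isBigO hqbig).trans_isBigO (hmul _ _ (by linarith)))
  have hne : ∀ᶠ x in atTop, zeroSol m Q x ≠ 0 := by
    obtain ⟨c, hc⟩ := hqbig'.bound
    filter_upwards [hc, eventually_gt_atTop 0] with x hx hx0 h0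
    rw [h0, norm_zero, mul_zero] at hx
    have := Real.rpow_pos_of_pos hx0 (1 / 2 - m.re)
    rw [Real.norm_of_nonneg this.le] at hx
    linarith
  intro x hx
  have hV : ∀ x y, 0 < x → 0 < y → IntervalIntegrable
      (fun t : ℝ => (m ^ 2 - 1 / 4) / (t : ℂ) ^ 2 + (0 : ℂ) ^ 2 + Q t) volume x y := by
    intro x y hx hy
    simpa using intervalIntegrable_potential_mul (m := m) (k := 0) (g := fun _ => 1)
      H.locallyIntegrable continuousOn_const hx hy
  have := D'.eq_zero_of_wronskian S hV ((isLittleO_one_iff ℝ).1 (hW1.sub hW2)) hne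
    (((h1.trans_isBigO hexp).trans_isBigO hqbig').tendsto_div_nhds_zero) hx
  exact sub_eq_zero.1 this

end PotAssumption

/-! ### The Macdonald function -/

/-- The integrand of the Macdonald function, in the form `e^{-s} s^ν (k + s/(2x))^ν`. -/
def macInt (ν k : ℂ) (x s : ℝ) : ℂ :=
  Complex.exp (-(s : ℂ)) * (s : ℂ) ^ ν * (k + (s : ℂ) / (2 * (x : ℂ))) ^ ν

/-- The ratio `s / (2xk + s)`. -/
def macRatio (k : ℂ) (x s : ℝ) : ℂ := (s : ℂ) / (2 * (x : ℂ) * k + (s : ℂ))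

theorem norm_ge_of_re {z : ℂ} {s : ℝ} (h : s ≤ z.re) : s ≤ ‖z‖ :=
  h.trans (Complex.re_le_norm z)

/-! ### Elementary estimates of the base k + s/(2x) for Re k ≥ 0. -/

section Base

variable {k : ℂ} {x s : ℝ}

theorem base_re :
    (k + (s : ℂ) / (2 * (x : ℂ))).re = k.re + s / (2 * x) := by
  have : (s : ℂ) / (2 * (x : ℂ)) = ((s / (2 * x) : ℝ) : ℂ) := by push_cast; ring
  rw [this, Complex.add_re, Complex.ofReal_re]

theorem base_re_pos (hk : 0 ≤ k.re) (hx : 0 < x) (hs : 0 < s) :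
    0 < (k + (s : ℂ) / (2 * (x : ℂ))).re := by
  rw [base_re]; positivity

theorem base_mem_slitPlane (hk : 0 ≤ k.re) (hx : 0 < x) (hs : 0 < s) :
    k + (s : ℂ) / (2 * (x : ℂ)) ∈ Complex.slitPlane := Or.inl (base_re_pos hk hx hs)

theorem le_norm_base (hk : 0 ≤ k.re) :
    s / (2 * x) ≤ ‖k + (s : ℂ) / (2 * (x : ℂ))‖ :=
  norm_ge_of_re (by rw [base_re]; linarith)

/-- Adding a positive real number to a point of the closed right half-plane does not decrease the
modulus. -/
theorem norm_le_norm_base (hk : 0 ≤ k.re) (hx : 0 < x) (hs : 0 < s) :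
    ‖k‖ ≤ ‖k + (s : ℂ) / (2 * (x : ℂ))‖ := by
  have e : (s : ℂ) / (2 * (x : ℂ)) = ((s / (2 * x) : ℝ) : ℂ) := by push_cast; ring
  have hp : 0 < s / (2 * x) := by positivity
  rw [e]
  refine (sq_le_sq₀ (norm_nonneg _) (norm_nonneg _)).1 ?_
  rw [Complex.sq_norm, Complex.sq_norm, Complex.normSq_apply, Complex.normSq_apply]
  simp only [Complex.add_re, Complex.ofReal_re, Complex.add_im, Complex.ofReal_im, add_zero]
  nlinarith

theorem norm_base_le (hx : 0 < x) (hs : 0 < s) :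
    ‖k + (s : ℂ) / (2 * (x : ℂ))‖ ≤ ‖k‖ + s / (2 * x) := by
  refine (norm_add_le _ _).trans_eq ?_
  rw [norm_div, norm_mul, Complex.norm_real, Complex.norm_real, Complex.norm_ofNat,
    Real.norm_of_nonneg hs.le, Real.norm_of_nonneg hx.le]

theorem ratio_denom_ne (hk : 0 ≤ k.re) (hx : 0 < x) (hs : 0 < s) :
    2 * (x : ℂ) * k + (s : ℂ) ≠ 0 := by
  intro h
  have h2 := congrArg Complex.re h
  simp only [Complex.add_re, Complex.mul_re, Complex.re_ofNat, Complex.ofReal_re,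
    Complex.im_ofNat, Complex.ofReal_im, Complex.mul_im, Complex.zero_re] at h2
  have : 0 ≤ 2 * x * k.re := by positivity
  nlinarith

theorem norm_macRatio_le (hk : 0 ≤ k.re) (hx : 0 < x) (hs : 0 < s) : ‖macRatio k x s‖ ≤ 1 := by
  rw [macRatio, norm_div, Complex.norm_real, Real.norm_of_nonneg hs.le]
  refine div_le_one_of_le₀ (norm_ge_of_re ?_) (norm_nonneg _)
  simp only [Complex.add_re, Complex.mul_re, Complex.re_ofNat, Complex.ofReal_re,
    Complex.im_ofNat, Complex.ofReal_im, Complex.mul_im]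
  have : 0 ≤ 2 * x * k.re := by positivity
  nlinarith

theorem base_eq (hx : 0 < x) :
    k + (s : ℂ) / (2 * (x : ℂ)) = (2 * (x : ℂ) * k + (s : ℂ)) / (2 * (x : ℂ)) := by
  have : (x : ℂ) ≠ 0 := by exact_mod_cast hx.ne'
  field_simp

end Base

theorem norm_cpow_le_exp (z w : ℂ) :
    ‖z ^ w‖ ≤ ‖z‖ ^ w.re * Real.exp (Real.pi * |w.im|) := by
  refine (Complex.norm_cpow_le z w).trans ?_
  rw [div_eq_mul_inv, ← Real.exp_neg]
  gcongr
  calc -(z.arg * w.im) ≤ |z.arg * w.im| := neg_le_abs _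
    _ = |z.arg| * |w.im| := abs_mul _ _
    _ ≤ Real.pi * |w.im| := by gcongr; exact Complex.abs_arg_le_pi z

/-- A bound for powers of numbers between `t₁ min(1,s)` and `t₂ (1+s)`. -/
theorem rpow_le_of_between {σ t₁ t₂ s β : ℝ} (ht₁ : 0 < t₁) (ht₂ : 0 < t₂) (hs : 0 < s)
    (h1 : t₁ * min 1 s ≤ β) (h2 : β ≤ t₂ * (1 + s)) :
    β ^ σ ≤ (t₁ ^ σ + t₂ ^ σ) * (2 ^ |σ| * (1 + s ^ σ)) := by
  have hm : 0 < min 1 s := lt_min one_pos hs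
  have hβ : 0 < β := lt_of_lt_of_le (by positivity) h1
  have hone : (1 : ℝ) ≤ 2 ^ |σ| := Real.one_le_rpow (by norm_num) (abs_nonneg _)
  have hsσ := Real.rpow_pos_of_pos hs σ
  have ht1 := Real.rpow_pos_of_pos ht₁ σ
  have ht2 := Real.rpow_pos_of_pos ht₂ σ
  rcases le_total σ 0 with hσ | hσ
  · have e1 : β ^ σ ≤ (t₁ * min 1 s) ^ σ := Real.rpow_le_rpow_of_nonpos (by positivity) h1 hσ
    have e2 : (min 1 s) ^ σ ≤ 1 + s ^ σ := by
      rcases le_total 1 s with h | h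
      · rw [min_eq_left h, Real.one_rpow]; linarith
      · rw [min_eq_right h]; linarith
    rw [Real.mul_rpow ht₁.le hm.le] at e1
    calc β ^ σ ≤ t₁ ^ σ * (min 1 s) ^ σ := e1
      _ ≤ t₁ ^ σ * (1 + s ^ σ) := by gcongr
      _ ≤ (t₁ ^ σ + t₂ ^ σ) * (1 * (1 + s ^ σ)) := by nlinarith
      _ ≤ _ := by gcongr
  · have e1 : β ^ σ ≤ (t₂ * (1 + s)) ^ σ := Real.rpow_le_rpow hβ.le h2 hσ
    rw [Real.mul_rpow ht₂.le (by linarith)] at e1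
    have e2 : (1 + s) ^ σ ≤ 2 ^ |σ| * (1 + s ^ σ) := by
      rw [abs_of_nonneg hσ]
      have h2σ : (0 : ℝ) < 2 ^ σ := Real.rpow_pos_of_pos two_pos σ
      rcases le_total 1 s with h | h
      · calc (1 + s) ^ σ ≤ (2 * s) ^ σ := Real.rpow_le_rpow (by linarith) (by linarith) hσ
          _ = 2 ^ σ * s ^ σ := Real.mul_rpow (by norm_num) hs.le
          _ ≤ _ := by gcongr; linarith
      · calc (1 + s) ^ σ ≤ 2 ^ σ := Real.rpow_le_rpow (by linarith) (by linarith) hσ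
          _ = 2 ^ σ * 1 := (mul_one _).symm
          _ ≤ _ := by gcongr; linarith
    calc β ^ σ ≤ t₂ ^ σ * (1 + s) ^ σ := e1
      _ ≤ t₂ ^ σ * (2 ^ |σ| * (1 + s ^ σ)) := by gcongr
      _ ≤ _ := by gcongr; linarith

/-- The dominating function of the Macdonald integrand. -/
def macDom (σ : ℝ) (s : ℝ) : ℝ := Real.exp (-s) * (s ^ σ + s ^ (2 * σ))

theorem macDom_nonneg {σ s : ℝ} (hs : 0 < s) : 0 ≤ macDom σ s := by
  unfold macDom; positivity

/-- Near s = 0 the exponent 2σ must exceed -1. With ν = m - 1/2 this says Re m > 0, which is how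
that condition enters the uniform bounds down to k = 0. -/
theorem integrableOn_macDom {σ : ℝ} (hσ : -1 / 2 < σ) : IntegrableOn (macDom σ) (Ioi 0) := by
  have h1 := Real.GammaIntegral_convergent (s := σ + 1) (by linarith)
  have h2 := Real.GammaIntegral_convergent (s := 2 * σ + 1) (by linarith)
  simp only [add_sub_cancel_right] at h1 h2
  refine (h1.add h2).congr (ae_of_all _ fun s => ?_)
  simp only [macDom, Pi.add_apply]; ring

/-- Two-sided bounds of the base are needed because the sign of Re ν is free: the lower one serves
negative exponents, the upper one the others. The argument of the base costs only the factor e^{π|Im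
ν|}. -/
theorem norm_macInt_le {ν k : ℂ} {x s t₁ t₂ : ℝ} (ht₁ : 0 < t₁) (ht₂ : 0 < t₂) (hs : 0 < s)
    (h1 : t₁ * min 1 s ≤ ‖k + (s : ℂ) / (2 * (x : ℂ))‖)
    (h2 : ‖k + (s : ℂ) / (2 * (x : ℂ))‖ ≤ t₂ * (1 + s)) :
    ‖macInt ν k x s‖ ≤ (t₁ ^ ν.re + t₂ ^ ν.re) *
      (Real.exp (Real.pi * |ν.im|) * 2 ^ |ν.re| * macDom ν.re s) := by
  have hb := rpow_le_of_between (σ := ν.re) ht₁ ht₂ hs h1 h2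
  have hsp := Real.rpow_pos_of_pos hs ν.re
  rw [macInt, norm_mul, norm_mul, Complex.norm_exp, Complex.norm_cpow_eq_rpow_re_of_pos hs]
  have e0 : (-(s : ℂ)).re = -s := by simp
  have e1 : s ^ (2 * ν.re) = s ^ ν.re * s ^ ν.re := by rw [← Real.rpow_add hs]; ring_nf
  rw [e0, macDom, e1]
  calc Real.exp (-s) * s ^ ν.re * ‖(k + (s : ℂ) / (2 * (x : ℂ))) ^ ν‖
      ≤ Real.exp (-s) * s ^ ν.re * (((t₁ ^ ν.re + t₂ ^ ν.re) * (2 ^ |ν.re| * (1 + s ^ ν.re))) *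
          Real.exp (Real.pi * |ν.im|)) := by
        gcongr
        exact (norm_cpow_le_exp _ _).trans (by gcongr)
    _ = _ := by ring

theorem measurable_macInt (ν k : ℂ) (x : ℝ) : Measurable (macInt ν k x) := by
  unfold macInt
  fun_prop

theorem measurable_macRatio (k : ℂ) (x : ℝ) : Measurable (macRatio k x) := by
  unfold macRatio
  fun_prop

/-- Uniform domination for bounded `k` and `x` in a compact subinterval. -/
theorem exists_macInt_bound (ν : ℂ) {a A κ : ℝ} (ha : 0 < a) (hA : 0 < A) (hκ : 0 ≤ κ) :
    ∃ C, 0 ≤ C ∧ ∀ (k : ℂ) (x s : ℝ), 0 ≤ k.re → ‖k‖ ≤ κ → a ≤ x → x ≤ A → 0 < s →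
      ‖macInt ν k x s‖ ≤ C * macDom ν.re s := by
  refine ⟨((1 / (2 * A)) ^ ν.re + (κ + 1 / (2 * a)) ^ ν.re) *
    (Real.exp (Real.pi * |ν.im|) * 2 ^ |ν.re|), by positivity, fun k x s hk hkκ hax hxA hs => ?_⟩
  have hx := ha.trans_le hax
  -- The lower bound comes from s/(2x) alone, so k = 0 is allowed.
  refine (norm_macInt_le (t₁ := 1 / (2 * A)) (t₂ := κ + 1 / (2 * a)) (by positivity)
    (by positivity) hs ?_ ?_).trans_eq (by ring)
  · refine le_trans ?_ (le_norm_base hk)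
    calc 1 / (2 * A) * min 1 s ≤ 1 / (2 * x) * s := by
          gcongr
          exact min_le_right _ _
      _ = s / (2 * x) := by ring
  · refine (norm_base_le hx hs).trans ?_
    have e : s / (2 * x) ≤ 1 / (2 * a) * s := by
      rw [div_eq_mul_one_div, mul_comm]
      gcongr
    have : 0 < 1 / (2 * a) := by positivity
    nlinarith [mul_nonneg hκ hs.le]

/-- Domination for fixed `k ≠ 0` and `x ≥ 1`. -/
theorem exists_macInt_bound_atTop (ν : ℂ) {k : ℂ} (hk : 0 ≤ k.re) (hk0 : k ≠ 0) :
    ∃ C, 0 ≤ C ∧ ∀ x s : ℝ, 1 ≤ x → 0 < s → ‖macInt ν k x s‖ ≤ C * macDom ν.re s := by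
  have hkn : 0 < ‖k‖ := norm_pos_iff.2 hk0
  refine ⟨(‖k‖ ^ ν.re + (‖k‖ + 1) ^ ν.re) *
    (Real.exp (Real.pi * |ν.im|) * 2 ^ |ν.re|), by positivity, fun x s hx hs => ?_⟩
  have hx0 : 0 < x := by linarith
  -- As x → ∞ the bound s/(2x) degenerates, and |k| takes its place as lower bound.
  refine (norm_macInt_le (t₁ := ‖k‖) (t₂ := ‖k‖ + 1) hkn (by positivity) hs ?_ ?_).trans_eq
    (by ring)
  · refine le_trans ?_ (norm_le_norm_base hk hx0 hs)
    nlinarith [min_le_left 1 s]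
  · refine (norm_base_le hx0 hs).trans ?_
    have e : s / (2 * x) ≤ s := div_le_self hs.le (by linarith)
    nlinarith [mul_nonneg hkn.le hs.le]

/-- Uniform bound in the region `x ‖k‖ ≤ 1`. -/
theorem exists_macInt_bound_small (ν : ℂ) :
    ∃ C, 0 ≤ C ∧ ∀ (k : ℂ) (x s : ℝ), 0 ≤ k.re → 0 < x → x * ‖k‖ ≤ 1 → 0 < s →
      ‖macInt ν k x s‖ ≤ C * x ^ (-ν.re) * macDom ν.re s := by
  refine ⟨((1 / 2 : ℝ) ^ ν.re + 1) *
    (Real.exp (Real.pi * |ν.im|) * 2 ^ |ν.re|), by positivity, fun k x s hk hx hxk hs => ?_⟩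
  have hkx : ‖k‖ ≤ 1 / x := by rw [le_div_iff₀ hx]; linarith
  have e1 : (1 / (2 * x)) ^ ν.re = (1 / 2 : ℝ) ^ ν.re * x ^ (-ν.re) := by
    rw [show 1 / (2 * x) = (1 / 2) * x⁻¹ by field_simp, Real.mul_rpow (by norm_num) (by positivity),
      Real.inv_rpow hx.le, Real.rpow_neg hx.le]
  have e2 : (1 / x) ^ ν.re = x ^ (-ν.re) := by
    rw [one_div, Real.inv_rpow hx.le, Real.rpow_neg hx.le]
  -- Both constants are multiples of 1/x, the upper one because |k| ≤ 1/x; this lets the power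
  -- x^{-Re ν} factor out.
  refine (norm_macInt_le (t₁ := 1 / (2 * x)) (t₂ := 1 / x) (by positivity) (by positivity)
    hs ?_ ?_).trans_eq (by rw [e1, e2]; ring)
  · refine le_trans ?_ (le_norm_base hk)
    calc 1 / (2 * x) * min 1 s ≤ 1 / (2 * x) * s := by gcongr; exact min_le_right _ _
      _ = s / (2 * x) := by ring
  · refine (norm_base_le hx hs).trans ?_
    have : s / (2 * x) = 1 / 2 * (1 / x * s) := by field_simp
    have h3 : 0 ≤ 1 / x * s := by positivity
    nlinarith

/-- The integral `∫₀^∞ e^{-s} s^ν (k + s/(2x))^ν ds`. -/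
def macI (ν k : ℂ) (x : ℝ) : ℂ := ∫ s in Ioi (0 : ℝ), macInt ν k x s

/-- The first derivative of the integrand. -/
def macInt₁ (ν k : ℂ) (x s : ℝ) : ℂ := macInt ν k x s * (-(ν * macRatio k x s) / x)

/-- The second derivative of the integrand. -/
def macInt₂ (ν k : ℂ) (x s : ℝ) : ℂ :=
  macInt ν k x s * ((ν * (ν - 1) * macRatio k x s ^ 2 + 2 * ν * macRatio k x s) / (x : ℂ) ^ 2)

/-! ### Derivatives of the Macdonald integral in x and its differential equation. -/

section Deriv

variable {ν k : ℂ} {x s : ℝ}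

/-- Expressing the x-derivative as the integrand times a multiple of `macRatio`, of modulus at most
1, shows that derivatives are dominated by the integrand itself. -/
theorem hasDerivAt_macInt (hk : 0 ≤ k.re) (hx : 0 < x) (hs : 0 < s) :
    HasDerivAt (fun x => macInt ν k x s) (macInt₁ ν k x s) x := by
  have hx0 : (x : ℂ) ≠ 0 := by exact_mod_cast hx.ne'
  have hb0 : HasDerivAt (fun z : ℂ => k + (s : ℂ) / (2 * z)) (-((s : ℂ) / (2 * (x : ℂ) ^ 2)))
      (x : ℂ) := by
    have h1 : HasDerivAt (fun z : ℂ => 2 * z) 2 (x : ℂ) := by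
      simpa using (hasDerivAt_id (x : ℂ)).const_mul 2
    have := ((hasDerivAt_const (x : ℂ) (s : ℂ)).div h1 (by simpa using hx0)).const_add k
    refine this.congr_deriv ?_
    field_simp
    ring
  have hb := hb0.cpow_const (c := ν) (base_mem_slitPlane hk hx hs)
  have h := (hb.const_mul (Complex.exp (-(s : ℂ)) * (s : ℂ) ^ ν)).comp_ofReal
  refine h.congr_deriv ?_
  have hne : k + (s : ℂ) / (2 * (x : ℂ)) ≠ 0 :=
    Complex.slitPlane_ne_zero (base_mem_slitPlane hk hx hs)
  have hd := ratio_denom_ne hk hx hs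
  rw [Complex.cpow_sub _ _ hne, Complex.cpow_one, macInt₁, macInt, macRatio]
  have e : (k + (s : ℂ) / (2 * (x : ℂ)))⁻¹ = 2 * x / (2 * (x : ℂ) * k + (s : ℂ)) := by
    rw [base_eq hx, inv_div]
  rw [div_eq_mul_inv _ (k + (s : ℂ) / (2 * (x : ℂ))), e]
  field_simp

theorem hasDerivAt_macInt₁ (hk : 0 ≤ k.re) (hx : 0 < x) (hs : 0 < s) :
    HasDerivAt (fun x => macInt₁ ν k x s) (macInt₂ ν k x s) x := by
  have hx0 : (x : ℂ) ≠ 0 := by exact_mod_cast hx.ne'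
  have hd := ratio_denom_ne hk hx hs
  have hθ : HasDerivAt (fun z : ℂ => -(ν * ((s : ℂ) / (2 * z * k + (s : ℂ)))) / z)
      (ν * ((s : ℂ) / (2 * (x : ℂ) * k + (s : ℂ))) *
        (2 - (s : ℂ) / (2 * (x : ℂ) * k + (s : ℂ))) / (x : ℂ) ^ 2) (x : ℂ) := by
    have h1 : HasDerivAt (fun z : ℂ => 2 * z * k + (s : ℂ)) (2 * k) (x : ℂ) := by
      simpa using (((hasDerivAt_id (x : ℂ)).const_mul 2).mul_const k).add_const (s : ℂ)
    have h2 := (((hasDerivAt_const (x : ℂ) (s : ℂ)).div h1 hd).const_mul ν).neg.div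
      (hasDerivAt_id (x : ℂ)) hx0
    refine h2.congr_deriv ?_
    simp only [id, Pi.neg_apply, Pi.div_apply]
    field_simp
    ring
  have h := (hasDerivAt_macInt (ν := ν) hk hx hs).mul hθ.comp_ofReal
  refine h.congr_deriv ?_
  rw [macInt₂, macInt₁, macRatio]
  field_simp
  ring

theorem norm_macInt₁_le (hk : 0 ≤ k.re) (hx : 0 < x) (hs : 0 < s) :
    ‖macInt₁ ν k x s‖ ≤ ‖macInt ν k x s‖ * (‖ν‖ / x) := by
  rw [macInt₁, norm_mul, norm_div, norm_neg, norm_mul, Complex.norm_real,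
    Real.norm_of_nonneg hx.le]
  gcongr
  exact mul_le_of_le_one_right (norm_nonneg _) (norm_macRatio_le hk hx hs)

theorem norm_macInt₂_le (hk : 0 ≤ k.re) (hx : 0 < x) (hs : 0 < s) :
    ‖macInt₂ ν k x s‖ ≤ ‖macInt ν k x s‖ * ((‖ν‖ * ‖ν - 1‖ + 2 * ‖ν‖) / x ^ 2) := by
  have h1 := norm_macRatio_le hk hx hs
  rw [macInt₂, norm_mul, norm_div, norm_pow, Complex.norm_real, Real.norm_of_nonneg hx.le]
  gcongr
  refine (norm_add_le _ _).trans ?_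
  rw [norm_mul, norm_mul, norm_mul, norm_mul, norm_pow, Complex.norm_ofNat]
  refine add_le_add (mul_le_of_le_one_right (by positivity) (pow_le_one₀ (norm_nonneg _) h1))
    (mul_le_of_le_one_right (by positivity) h1)

theorem measurable_macInt₁ (ν k : ℂ) (x : ℝ) : Measurable (macInt₁ ν k x) := by
  have := measurable_macInt ν k x
  have := measurable_macRatio k x
  unfold macInt₁
  fun_prop

theorem measurable_macInt₂ (ν k : ℂ) (x : ℝ) : Measurable (macInt₂ ν k x) := by
  have := measurable_macInt ν k x
  have := measurable_macRatio k x
  unfold macInt₂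
  fun_prop

theorem integrableOn_macInt (hν : -1 / 2 < ν.re) (hk : 0 ≤ k.re) (hx : 0 < x) :
    IntegrableOn (macInt ν k x) (Ioi 0) := by
  obtain ⟨C, hC0, hC⟩ := exists_macInt_bound ν hx hx (norm_nonneg k)
  refine Integrable.mono' ((integrableOn_macDom hν).const_mul C)
    (measurable_macInt ν k x).aestronglyMeasurable ?_
  filter_upwards [ae_restrict_mem measurableSet_Ioi] with s hs
  exact hC k x s hk le_rfl le_rfl le_rfl hs

/-- Differentiation of the Macdonald integral under the integral sign. -/
theorem hasDerivAt_macI (hν : -1 / 2 < ν.re) (hk : 0 ≤ k.re) (hx : 0 < x) :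
    (IntegrableOn (macInt₁ ν k x) (Ioi 0) ∧
      HasDerivAt (macI ν k) (∫ s in Ioi (0 : ℝ), macInt₁ ν k x s) x) ∧
    (IntegrableOn (macInt₂ ν k x) (Ioi 0) ∧
      HasDerivAt (fun x => ∫ s in Ioi (0 : ℝ), macInt₁ ν k x s)
        (∫ s in Ioi (0 : ℝ), macInt₂ ν k x s) x) := by
  obtain ⟨C, hC0, hC⟩ := exists_macInt_bound ν (a := x / 2) (A := 2 * x) (by linarith)
    (by linarith) (norm_nonneg k)
  have hnhds : Icc (x / 2) (2 * x) ∈ 𝓝 x := Icc_mem_nhds (by linarith) (by linarith)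
  have hb : ∀ t ∈ Icc (x / 2) (2 * x), ∀ s, 0 < s → ‖macInt ν k t s‖ ≤ C * macDom ν.re s :=
    fun t ht s hs => hC k t s hk le_rfl ht.1 ht.2 hs
  have hb1 : ∀ t ∈ Icc (x / 2) (2 * x), ∀ s, 0 < s →
      ‖macInt₁ ν k t s‖ ≤ C * macDom ν.re s * (‖ν‖ / (x / 2)) := by
    intro t ht s hs
    have ht0 : 0 < t := by linarith [ht.1]
    have := macDom_nonneg (σ := ν.re) hs
    refine (norm_macInt₁_le hk ht0 hs).trans ?_
    gcongr
    · exact hb t ht s hs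
    · exact ht.1
  have hb2 : ∀ t ∈ Icc (x / 2) (2 * x), ∀ s, 0 < s →
      ‖macInt₂ ν k t s‖ ≤ C * macDom ν.re s * ((‖ν‖ * ‖ν - 1‖ + 2 * ‖ν‖) / (x / 2) ^ 2) := by
    intro t ht s hs
    have ht0 : 0 < t := by linarith [ht.1]
    have := macDom_nonneg (σ := ν.re) hs
    refine (norm_macInt₂_le hk ht0 hs).trans ?_
    gcongr
    · exact hb t ht s hs
    · exact ht.1
  have hx_mem : x ∈ Icc (x / 2) (2 * x) := mem_of_mem_nhds hnhds
  have hdom := (integrableOn_macDom hν).const_mul C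
  have hpos : ∀ t ∈ Icc (x / 2) (2 * x), 0 < t := fun t ht => by linarith [ht.1]
  have hint1 : IntegrableOn (macInt₁ ν k x) (Ioi 0) :=
    Integrable.mono' (hdom.mul_const _) (measurable_macInt₁ ν k x).aestronglyMeasurable
      ((ae_restrict_iff' measurableSet_Ioi).2 (ae_of_all _ fun s hs => hb1 x hx_mem s hs))
  refine ⟨hasDerivAt_integral_of_dominated_loc_of_deriv_le (F := macInt ν k)
      (F' := macInt₁ ν k) hnhds
      (Eventually.of_forall fun t => (measurable_macInt ν k t).aestronglyMeasurable)
      (integrableOn_macInt hν hk hx) (measurable_macInt₁ ν k x).aestronglyMeasurable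
      ((ae_restrict_iff' measurableSet_Ioi).2 (ae_of_all _ fun s hs t ht => hb1 t ht s hs))
      (hdom.mul_const _)
      ((ae_restrict_iff' measurableSet_Ioi).2 (ae_of_all _ fun s hs t ht =>
        hasDerivAt_macInt hk (hpos t ht) hs)),
    hasDerivAt_integral_of_dominated_loc_of_deriv_le (F := macInt₁ ν k)
      (F' := macInt₂ ν k) hnhds
      (Eventually.of_forall fun t => (measurable_macInt₁ ν k t).aestronglyMeasurable)
      hint1 (measurable_macInt₂ ν k x).aestronglyMeasurable
      ((ae_restrict_iff' measurableSet_Ioi).2 (ae_of_all _ fun s hs t ht => hb2 t ht s hs))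
      (hdom.mul_const _)
      ((ae_restrict_iff' measurableSet_Ioi).2 (ae_of_all _ fun s hs t ht =>
        hasDerivAt_macInt₁ hk (hpos t ht) hs))⟩

/-- The differential equation of the Macdonald integral. -/
theorem macI_ode (hν : -1 / 2 < ν.re) (hk : 0 ≤ k.re) (hk0 : k ≠ 0) (hx : 0 < x) :
    (x : ℂ) ^ 2 * ((∫ s in Ioi (0 : ℝ), macInt₂ ν k x s) -
      2 * k * ∫ s in Ioi (0 : ℝ), macInt₁ ν k x s) = ν * (ν + 1) * macI ν k x := by
  have hx0 : (x : ℂ) ≠ 0 := by exact_mod_cast hx.ne'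
  obtain ⟨⟨i1, -⟩, ⟨i2, -⟩⟩ := hasDerivAt_macI (ν := ν) hν hk hx
  have i0 := integrableOn_macInt (ν := ν) hν hk hx
  -- The combination of integrands in the differential equation is an exact derivative in s, with
  -- primitive `g`. This primitive vanishes at 0, where Re ν + 1 > 0, and at infinity.
  set g : ℝ → ℂ := fun s => -(ν * k) * (Complex.exp (-(s : ℂ)) * (s : ℂ) ^ (ν + 1) *
    (k + (s : ℂ) / (2 * (x : ℂ))) ^ (ν - 1)) with hg
  set L : ℝ → ℂ := fun s => (x : ℂ) ^ 2 * (macInt₂ ν k x s - 2 * k * macInt₁ ν k x s)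
    - ν * (ν + 1) * macInt ν k x s with hL
  have hkslit : k ∈ Complex.slitPlane := by
    rcases hk.lt_or_eq with h | h
    · exact Or.inl h
    · refine Or.inr fun h2 => hk0 (Complex.ext h.symm h2)
  have hLint : IntegrableOn L (Ioi 0) :=
    ((i2.sub (i1.const_mul (2 * k))).const_mul _).sub (i0.const_mul _)
  have hcont : ContinuousWithinAt g (Ici 0) 0 := by
    -- At s = 0 the base equals k, which is off the branch cut because k ≠ 0 and Re k ≥ 0.
    refine ContinuousAt.continuousWithinAt ?_
    have c1 : ContinuousAt (fun s : ℝ => (s : ℂ) ^ (ν + 1)) 0 :=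
      Complex.continuousAt_ofReal_cpow_const 0 (ν + 1) (Or.inl (by
        rw [Complex.add_re, Complex.one_re]; linarith))
    have c2 : ContinuousAt (fun s : ℝ => (k + (s : ℂ) / (2 * (x : ℂ))) ^ (ν - 1)) 0 := by
      have : ContinuousAt (fun s : ℝ => k + (s : ℂ) / (2 * (x : ℂ))) 0 := by fun_prop
      exact ContinuousAt.comp (g := fun z : ℂ => z ^ (ν - 1))
        (_root_.continuousAt_cpow_const (by simpa using hkslit)) this
    have c3 : ContinuousAt (fun s : ℝ => Complex.exp (-(s : ℂ))) 0 := by fun_prop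
    exact continuousAt_const.mul ((c3.mul c1).mul c2)
  have hν1 : ν + 1 ≠ 0 := fun h => by
    have := congrArg Complex.re h
    rw [Complex.add_re, Complex.one_re, Complex.zero_re] at this
    linarith
  have hg0 : g 0 = 0 := by
    simp [hg, Complex.zero_cpow hν1]
  have hderiv : ∀ s ∈ Ioi (0 : ℝ), HasDerivAt g (L s) s := by
    intro s hs
    have hs : 0 < s := hs
    have hs0 : (s : ℂ) ≠ 0 := by exact_mod_cast hs.ne'
    have hb : HasDerivAt (fun z : ℂ => k + z / (2 * (x : ℂ))) (1 / (2 * (x : ℂ))) (s : ℂ) := by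
      simpa using ((hasDerivAt_id (s : ℂ)).div_const (2 * (x : ℂ))).const_add k
    have hne : k + (s : ℂ) / (2 * (x : ℂ)) ≠ 0 :=
      Complex.slitPlane_ne_zero (base_mem_slitPlane hk hx hs)
    have hd := ratio_denom_ne hk hx hs
    have h1 := hb.cpow_const (c := ν - 1) (base_mem_slitPlane hk hx hs)
    have h2 := (hasDerivAt_id (s : ℂ)).cpow_const (c := ν + 1)
      (Complex.ofReal_mem_slitPlane.2 hs)
    have h3 : HasDerivAt (fun z : ℂ => Complex.exp (-z)) (-Complex.exp (-(s : ℂ))) (s : ℂ) := by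
      simpa using (hasDerivAt_id (s : ℂ)).neg.cexp
    have h := (((h3.mul h2).mul h1).const_mul (-(ν * k))).comp_ofReal
    refine h.congr_deriv ?_
    have eb : (k + (s : ℂ) / (2 * (x : ℂ)))⁻¹ = 2 * x / (2 * (x : ℂ) * k + (s : ℂ)) := by
      rw [base_eq hx, inv_div]
    have p1 : (k + (s : ℂ) / (2 * (x : ℂ))) ^ (ν - 1) =
        (k + (s : ℂ) / (2 * (x : ℂ))) ^ ν * (2 * x / (2 * (x : ℂ) * k + (s : ℂ))) := by
      rw [Complex.cpow_sub _ _ hne, Complex.cpow_one, div_eq_mul_inv, eb]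
    have p2 : (k + (s : ℂ) / (2 * (x : ℂ))) ^ (ν - 1 - 1) =
        (k + (s : ℂ) / (2 * (x : ℂ))) ^ ν * (2 * x / (2 * (x : ℂ) * k + (s : ℂ))) ^ 2 := by
      rw [Complex.cpow_sub _ _ hne, Complex.cpow_one, div_eq_mul_inv, eb, p1]; ring
    have p3 : (s : ℂ) ^ (ν + 1) = (s : ℂ) ^ ν * s := by
      rw [Complex.cpow_add _ _ hs0, Complex.cpow_one]
    simp only [hL, macInt₂, macInt₁, macInt, macRatio, id, Pi.mul_apply, add_sub_cancel_right]
    rw [p1, p2, p3]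
    generalize (k + (s : ℂ) / (2 * (x : ℂ))) ^ ν = B
    generalize (s : ℂ) ^ ν = S
    generalize Complex.exp (-(s : ℂ)) = E
    -- With t the inverse of 2xk + s, the claim becomes a polynomial identity modulo (2xk + s) t =
    -- 1.
    obtain ⟨t, ht⟩ : ∃ t, (2 * (x : ℂ) * k + (s : ℂ)) * t = 1 := ⟨_, mul_inv_cancel₀ hd⟩
    have hk2 : 2 * (x : ℂ) * k * t = 1 - s * t := by linear_combination ht
    have hinv : (2 * (x : ℂ) * k + (s : ℂ))⁻¹ = t := inv_eq_of_mul_eq_one_right ht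
    simp only [div_eq_mul_inv, hinv]
    generalize (x : ℂ) = X at *
    generalize (s : ℂ) = T at *
    field_simp
    linear_combination
      (-(ν * E * S * B * (-T + (ν + 1) + T * t * (ν - 1))) - ν * E * S * B * T) * hk2
  have hlim : Tendsto g atTop (𝓝 0) := by
    obtain ⟨C, hC0, hC⟩ := exists_macInt_bound ν hx hx (norm_nonneg k)
    have hbound : ∀ s : ℝ, 0 < s → ‖g s‖ ≤ ‖ν * k‖ * (2 * x) * C * macDom ν.re s := by
      intro s hs
      have hs0 : (s : ℂ) ≠ 0 := by exact_mod_cast hs.ne'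
      have hne : k + (s : ℂ) / (2 * (x : ℂ)) ≠ 0 :=
        Complex.slitPlane_ne_zero (base_mem_slitPlane hk hx hs)
      have e : g s = -(ν * k) * (2 * x * macRatio k x s) * macInt ν k x s := by
        simp only [hg, macInt, macRatio]
        rw [Complex.cpow_sub _ _ hne, Complex.cpow_one, Complex.cpow_add _ _ hs0,
          Complex.cpow_one, div_eq_mul_inv _ (k + (s : ℂ) / (2 * (x : ℂ))), base_eq hx, inv_div]
        ring
      rw [e, norm_mul, norm_mul, norm_neg, norm_mul (2 * (x : ℂ)), norm_mul 2, Complex.norm_ofNat,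
        Complex.norm_real, Real.norm_of_nonneg hx.le, mul_assoc _ C]
      have h1 := norm_macRatio_le hk hx hs
      have h2 : 2 * x * ‖macRatio k x s‖ ≤ 2 * x := mul_le_of_le_one_right (by positivity) h1
      exact mul_le_mul (mul_le_mul_of_nonneg_left h2 (norm_nonneg _))
        (hC k x s hk le_rfl le_rfl le_rfl hs) (norm_nonneg _) (by positivity)
    have hdlim : Tendsto (macDom ν.re) atTop (𝓝 0) := by
      have t1 := tendsto_rpow_mul_exp_neg_mul_atTop_nhds_zero ν.re 1 one_pos
      have t2 := tendsto_rpow_mul_exp_neg_mul_atTop_nhds_zero (2 * ν.re) 1 one_pos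
      have := t1.add t2
      rw [add_zero] at this
      refine this.congr fun s => ?_
      simp only [macDom, neg_mul, one_mul]; ring
    have hdlim' := hdlim.const_mul (‖ν * k‖ * (2 * x) * C)
    rw [mul_zero] at hdlim'
    refine squeeze_zero_norm' ?_ hdlim'
    filter_upwards [eventually_gt_atTop 0] with s hs using hbound s hs
  have hmain := integral_Ioi_of_hasDerivAt_of_tendsto hcont hderiv hLint hlim
  rw [hg0, sub_zero] at hmain
  have hsplit : ∫ s in Ioi (0 : ℝ), L s = (x : ℂ) ^ 2 * ((∫ s in Ioi (0 : ℝ), macInt₂ ν k x s) -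
      2 * k * ∫ s in Ioi (0 : ℝ), macInt₁ ν k x s) - ν * (ν + 1) * macI ν k x := by
    have j1 : Integrable (fun s => macInt₂ ν k x s - 2 * k * macInt₁ ν k x s)
        (volume.restrict (Ioi 0)) := i2.sub (i1.const_mul (2 * k))
    simp only [hL, macI]
    rw [integral_sub (j1.const_mul _) (i0.const_mul _),
      integral_const_mul, integral_const_mul, integral_sub i2 (i1.const_mul (2 * k)),
      integral_const_mul]
  rw [hsplit] at hmain
  exact sub_eq_zero.1 hmain

end Deriv

/-! ### Jost solutions of `g'' = (k² + P) g` with `P` integrable at infinity -/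

/-- The solution `e^{-kx}` of `g'' = k² g`. -/
def expSol (k : ℂ) (x : ℝ) : ℂ := Complex.exp (-(k * x))

/-- The solution `e^{kx} / (2k)` of `g'' = k² g`. -/
def expSol₂ (k : ℂ) (x : ℝ) : ℂ := Complex.exp (k * x) / (2 * k)

theorem fundPair_exp {k : ℂ} (hk0 : k ≠ 0) :
    FundPair (fun _ => k ^ 2) (expSol k) (expSol₂ k) (fun x => -k * expSol k x)
      (fun x => k * expSol₂ k x) := by
  have h1 : ∀ x : ℝ, HasDerivAt (expSol k) (-k * expSol k x) x := by
    intro x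
    have : HasDerivAt (fun z : ℂ => Complex.exp (-(k * z))) (Complex.exp (-(k * x)) * -(k * 1))
      (x : ℂ) := ((hasDerivAt_id (x : ℂ)).const_mul k).neg.cexp
    refine this.comp_ofReal.congr_deriv ?_
    rw [expSol]; ring
  have h2 : ∀ x : ℝ, HasDerivAt (expSol₂ k) (k * expSol₂ k x) x := by
    intro x
    have : HasDerivAt (fun z : ℂ => Complex.exp (k * z) / (2 * k))
      (Complex.exp (k * x) * (k * 1) / (2 * k))
      (x : ℂ) := (((hasDerivAt_id (x : ℂ)).const_mul k).cexp).div_const _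
    refine this.comp_ofReal.congr_deriv ?_
    rw [expSol₂]; ring
  refine ⟨continuousOn_const, fun x _ => h1 x, fun x _ => h2 x, fun x _ => ?_, fun x _ => ?_,
    fun x _ => ?_⟩
  · exact ((h1 x).const_mul (-k)).congr_deriv (by ring)
  · exact ((h2 x).const_mul k).congr_deriv (by ring)
  · have e : Complex.exp (-(k * x)) * Complex.exp (k * x) = 1 := by
      rw [← Complex.exp_add, neg_add_cancel, Complex.exp_zero]
    simp only [expSol, expSol₂]
    field_simp
    linear_combination 2 * e

/-- The weight `e^{-x Re k}`. -/
def expWeight (k : ℂ) (x : ℝ) : ℝ := Real.exp (-x * k.re)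

theorem expWeight_pos (k : ℂ) (x : ℝ) : 0 < expWeight k x := Real.exp_pos _

theorem expWeight_le_one {k : ℂ} (hk : 0 ≤ k.re) {x : ℝ} (hx : 0 ≤ x) : expWeight k x ≤ 1 :=
  Real.exp_le_one_iff.2 (by nlinarith)

theorem continuous_expWeight (k : ℂ) : Continuous (expWeight k) := by
  unfold expWeight; fun_prop

theorem norm_expSol (k : ℂ) (x : ℝ) : ‖expSol k x‖ = expWeight k x := by
  rw [expSol, Complex.norm_exp, expWeight]
  congr 1
  simp
  ring

theorem norm_expSol₂ (k : ℂ) (x : ℝ) : ‖expSol₂ k x‖ = (expWeight k x)⁻¹ / (2 * ‖k‖) := by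
  rw [expSol₂, norm_div, norm_mul, Complex.norm_exp, expWeight, ← Real.exp_neg, Complex.norm_ofNat]
  congr 2
  simp
  ring

/-- The bound for the Green kernel of `g'' = k² g` and its derivative. -/
theorem norm_exp_kernel_le {k : ℂ} (hk : 0 ≤ k.re) {x y : ℝ} (hxy : x ≤ y) {c d : ℂ}
    {C : ℝ} (hc : ‖c‖ ≤ C) (hd : ‖d‖ ≤ C) :
    ‖c * expSol k x * expSol₂ k y - d * expSol₂ k x * expSol k y‖ * expWeight k y ≤
      expWeight k x * (C / ‖k‖) := by
  have hx := expWeight_pos k x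
  have hy := expWeight_pos k y
  have hC : 0 ≤ C := (norm_nonneg _).trans hc
  have hyx : expWeight k y ≤ expWeight k x := Real.exp_le_exp.2 (by nlinarith)
  have e1 : ‖c * expSol k x * expSol₂ k y‖ * expWeight k y ≤ expWeight k x * (C / (2 * ‖k‖)) := by
    rw [norm_mul, norm_mul, norm_expSol, norm_expSol₂]
    calc ‖c‖ * expWeight k x * ((expWeight k y)⁻¹ / (2 * ‖k‖)) * expWeight k y
        = expWeight k x * (‖c‖ / (2 * ‖k‖)) * ((expWeight k y)⁻¹ * expWeight k y) := by ring
      _ = expWeight k x * (‖c‖ / (2 * ‖k‖)) := by rw [inv_mul_cancel₀ hy.ne', mul_one]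
      _ ≤ _ := by gcongr
  have e2 : ‖d * expSol₂ k x * expSol k y‖ * expWeight k y ≤ expWeight k x * (C / (2 * ‖k‖)) := by
    rw [norm_mul, norm_mul, norm_expSol, norm_expSol₂]
    calc ‖d‖ * ((expWeight k x)⁻¹ / (2 * ‖k‖)) * expWeight k y * expWeight k y
        ≤ C * ((expWeight k x)⁻¹ / (2 * ‖k‖)) * expWeight k x * expWeight k x := by gcongr
      _ = expWeight k x * (C / (2 * ‖k‖)) * ((expWeight k x)⁻¹ * expWeight k x) := by ring
      _ = _ := by rw [inv_mul_cancel₀ hx.ne', mul_one]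
  calc _ ≤ (‖c * expSol k x * expSol₂ k y‖ + ‖d * expSol₂ k x * expSol k y‖) * expWeight k y := by
        gcongr; exact norm_sub_le _ _
    _ ≤ expWeight k x * (C / (2 * ‖k‖)) + expWeight k x * (C / (2 * ‖k‖)) := by linarith
    _ = expWeight k x * (C / ‖k‖) := by ring

/-- The kernel of the Volterra equation of the Jost solution. -/
def jostK (k : ℂ) (P : ℝ → ℂ) (x y : ℝ) : ℂ :=
  (expSol k x * expSol₂ k y - expSol₂ k x * expSol k y) * P y

/-- The Jost solution of `g'' = (k² + P) g`, asymptotic to `e^{-kx}`. -/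
def jostSol (k : ℂ) (P : ℝ → ℂ) : ℝ → ℂ := voltSol (jostK k P) (expSol k)

/-- The derivative of `jostSol`. -/
def jostSolDeriv (k : ℂ) (P : ℝ → ℂ) (x : ℝ) : ℂ :=
  -k * expSol k x + ∫ y in Ioi x,
    (-k * expSol k x * expSol₂ k y - k * expSol₂ k x * expSol k y) * (P y * jostSol k P y)

section Jost

variable {k : ℂ} {P : ℝ → ℂ}

/-- The density |P|/|k| is singular as k → 0. It will be integrated only from 1/(2|k|) on when that
limit is taken, where the centrifugal part has bounded mass. -/
theorem volterraKernel_jostK (hk : 0 ≤ k.re) (hk0 : k ≠ 0) {a : ℝ} (ha : 0 < a)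
    (hP : IntegrableOn P (Ioi a)) :
    VolterraKernel (jostK k P) (expWeight k) (fun y => ‖P y‖ / ‖k‖) a := by
  have F := fundPair_exp hk0
  refine ⟨fun x _ => expWeight_pos k x, (continuous_expWeight k).continuousOn,
    fun x _ => by positivity, hP.norm.div_const _, fun x y _ hxy => ?_, fun x _ => ?_, fun y => ?_⟩
  · have := norm_exp_kernel_le hk hxy.le (c := 1) (d := 1) (C := 1) (by simp) (by simp)
    rw [one_mul, one_mul] at this
    rw [jostK, norm_mul]
    calc _ = ‖expSol k x * expSol₂ k y - expSol₂ k x * expSol k y‖ * expWeight k y * ‖P y‖ := by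
          ring
      _ ≤ expWeight k x * (1 / ‖k‖) * ‖P y‖ := by gcongr
      _ = _ := by ring
  · have hs : Ioi a ⊆ Ioi 0 := Ioi_subset_Ioi ha.le
    exact (((continuousOn_const.mul (F.continuousOn_v.mono hs)).sub
      (continuousOn_const.mul (F.continuousOn_u.mono hs))).aestronglyMeasurable
        measurableSet_Ioi).mul hP.aestronglyMeasurable
  · have hs : Ioo a y ⊆ Ioi 0 := fun x hx => ha.trans hx.1
    exact (((F.continuousOn_u.mono hs).mul continuousOn_const).sub
      ((F.continuousOn_v.mono hs).mul continuousOn_const)).mul continuousOn_const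

theorem aestronglyMeasurable_expSol (k : ℂ) (a : ℝ) :
    AEStronglyMeasurable (expSol k) (volume.restrict (Ioi a)) := by
  have : Continuous (expSol k) := by unfold expSol; fun_prop
  exact this.aestronglyMeasurable

theorem norm_expSol_le (k : ℂ) (y : ℝ) : ‖expSol k y‖ ≤ 1 * expWeight k y := by
  rw [norm_expSol, one_mul]

variable (hk : 0 ≤ k.re) (hk0 : k ≠ 0) (hP : ∀ a, 0 < a → IntegrableOn P (Ioi a))

include hk hk0 hP

theorem jostSol_eq {x : ℝ} (hx : 0 < x) :
    jostSol k P x = expSol k x + volt (jostK k P) (jostSol k P) x :=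
  (volterraKernel_jostK hk hk0 (half_pos hx) (hP _ (half_pos hx))).voltSol_eq
    (aestronglyMeasurable_expSol k _) zero_le_one (fun y _ => norm_expSol_le k y) (by linarith)

/-- The explicit constant depends on k only through tail/|k|, so it is uniform in k when a is of
order 1/|k|. -/
theorem norm_jostSol_le {a x : ℝ} (ha : 0 < a) (hx : a < x) :
    ‖jostSol k P x‖ ≤ 2 * Real.exp (2 * (tail (fun y => ‖P y‖) a / ‖k‖)) * expWeight k x := by
  have := (volterraKernel_jostK hk hk0 ha (hP _ ha)).norm_voltSol_le_const zero_le_one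
    (fun y _ => norm_expSol_le k y) hx
  rwa [mul_one, tail, integral_div] at this

theorem aestronglyMeasurable_jostSol {a : ℝ} (ha : 0 < a) :
    AEStronglyMeasurable (jostSol k P) (volume.restrict (Ioi a)) :=
  (volterraKernel_jostK hk hk0 ha (hP _ ha)).aestronglyMeasurable_voltSol
    (aestronglyMeasurable_expSol k _) zero_le_one (fun y _ => norm_expSol_le k y)

theorem integrableOn_exp_solutions {f : ℝ → ℂ} {a M : ℝ} (ha : 0 < a)
    (hf : AEStronglyMeasurable f (volume.restrict (Ioi a)))
    (hb : ∀ y, a < y → ‖f y‖ ≤ M * expWeight k y) :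
    IntegrableOn (fun y => expSol k y * (P y * f y)) (Ioi a) ∧
      IntegrableOn (fun y => expSol₂ k y * (P y * f y)) (Ioi a) := by
  have F := fundPair_exp hk0
  have hs : Ioi a ⊆ Ioi 0 := Ioi_subset_Ioi ha.le
  have hPm := (hP a ha).aestronglyMeasurable
  have hM : 0 ≤ M := by
    have := (norm_nonneg _).trans (hb (a + 1) (by linarith))
    exact nonneg_of_mul_nonneg_left this (expWeight_pos k _)
  constructor
  · refine Integrable.mono' ((hP a ha).norm.const_mul M)
      (((F.continuousOn_u.mono hs).aestronglyMeasurable measurableSet_Ioi).mul (hPm.mul hf)) ?_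
    filter_upwards [ae_restrict_mem measurableSet_Ioi] with y hy
    have h1 := expWeight_le_one hk (ha.trans hy).le
    have h0 := expWeight_pos k y
    rw [norm_mul, norm_mul, norm_expSol]
    calc expWeight k y * (‖P y‖ * ‖f y‖) ≤ 1 * (‖P y‖ * (M * 1)) := by
          gcongr
          exact (hb y hy).trans (by gcongr)
      _ = _ := by ring
  · refine Integrable.mono' ((hP a ha).norm.const_mul (M / (2 * ‖k‖)))
      (((F.continuousOn_v.mono hs).aestronglyMeasurable measurableSet_Ioi).mul (hPm.mul hf)) ?_
    filter_upwards [ae_restrict_mem measurableSet_Ioi] with y hy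
    have h0 := expWeight_pos k y
    rw [norm_mul, norm_mul, norm_expSol₂]
    calc (expWeight k y)⁻¹ / (2 * ‖k‖) * (‖P y‖ * ‖f y‖)
        ≤ (expWeight k y)⁻¹ / (2 * ‖k‖) * (‖P y‖ * (M * expWeight k y)) := by
          gcongr
          exact hb y hy
      _ = M / (2 * ‖k‖) * ‖P y‖ * ((expWeight k y)⁻¹ * expWeight k y) := by ring
      _ = _ := by rw [inv_mul_cancel₀ h0.ne', mul_one]

theorem secondPrimitive_jostSol :
    SecondPrimitive (jostSol k P) (jostSolDeriv k P)
      (fun t : ℝ => (k ^ 2 + P t) * jostSol k P t) := by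
  have F := fundPair_exp hk0
  have hint : ∀ a, 0 < a → IntegrableOn (fun y => expSol k y * (P y * jostSol k P y)) (Ioi a) ∧
      IntegrableOn (fun y => expSol₂ k y * (P y * jostSol k P y)) (Ioi a) := fun a ha =>
    integrableOn_exp_solutions hk hk0 hP ha (aestronglyMeasurable_jostSol hk hk0 hP ha)
      fun y hy => norm_jostSol_le hk hk0 hP ha hy
  have G := F.secondPrimitive_green (h := fun y => P y * jostSol k P y)
    (fun a ha => (hint a ha).1) (fun a ha => (hint a ha).2)
  have hv : ∀ x, 0 < x → jostSol k P x = expSol k x +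
      ∫ y in Ioi x, (expSol k x * expSol₂ k y - expSol₂ k x * expSol k y) *
        (P y * jostSol k P y) := by
    intro x hx
    rw [jostSol_eq hk hk0 hP hx]
    simp only [volt, jostK, mul_assoc]
  refine (F.secondPrimitive_u.add G).congr (fun x hx => hv x hx) ?_
  refine (ae_restrict_iff' measurableSet_Ioi).2 (ae_of_all _ fun x hx => ?_)
  have := hv x hx
  linear_combination (-k ^ 2) * this

theorem jostSol_asymptotics :
    (fun x : ℝ => jostSol k P x - expSol k x) =o[atTop] expWeight k ∧
    (fun x : ℝ => jostSolDeriv k P x - -k * expSol k x) =o[atTop] expWeight k := by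
  set M := 2 * Real.exp (2 * (tail (fun y => ‖P y‖) 1 / ‖k‖)) with hM
  have hb : ∀ y, 1 < y → ‖jostSol k P y‖ ≤ M * expWeight k y := fun y hy =>
    norm_jostSol_le hk hk0 hP one_pos hy
  have htail := tendsto_tail (hP 1 one_pos).norm
  have hkn := norm_pos_iff.2 hk0
  have hlit : ∀ {f : ℝ → ℂ} {C : ℝ}, (∀ x, 1 < x → ‖f x‖ ≤
      C * expWeight k x * tail (fun y => ‖P y‖) x) → f =o[atTop] expWeight k := by
    intro f C hfg
    have h1 : (fun x => C * expWeight k x * tail (fun y => ‖P y‖) x)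
        =o[atTop] (fun x => expWeight k x * 1) :=
      ((isBigO_refl (expWeight k) atTop).const_mul_left C).mul_isLittleO
        ((isLittleO_one_iff ℝ).2 htail)
    simp only [mul_one] at h1
    refine IsBigO.trans_isLittleO (IsBigO.of_bound 1 ?_) h1
    filter_upwards [eventually_gt_atTop 1] with x hx
    rw [one_mul]
    exact (hfg x hx).trans (le_abs_self _)
  -- The coefficients c = d = 1 give the remainder of the solution, and c = -k, d = k that of its
  -- derivative.
  have hgen : ∀ {c d : ℂ} {C x : ℝ}, ‖c‖ ≤ C → ‖d‖ ≤ C → 1 < x →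
      ‖∫ y in Ioi x, (c * expSol k x * expSol₂ k y - d * expSol₂ k x * expSol k y) *
        (P y * jostSol k P y)‖ ≤ (C / ‖k‖ * M) * expWeight k x * tail (fun y => ‖P y‖) x := by
    intro c d C x hc hd hx
    rw [tail, ← integral_const_mul]
    refine norm_integral_le_of_norm_le ((hP x (by linarith)).norm.const_mul _) ?_
    filter_upwards [ae_restrict_mem measurableSet_Ioi] with y hy
    have h1 := norm_exp_kernel_le hk (le_of_lt hy) hc hd
    rw [norm_mul, norm_mul]
    calc _ ≤ ‖c * expSol k x * expSol₂ k y - d * expSol₂ k x * expSol k y‖ *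
          (‖P y‖ * (M * expWeight k y)) := by gcongr; exact hb y (hx.trans hy)
      _ = ‖c * expSol k x * expSol₂ k y - d * expSol₂ k x * expSol k y‖ * expWeight k y *
          (‖P y‖ * M) := by ring
      _ ≤ expWeight k x * (C / ‖k‖) * (‖P y‖ * M) := by gcongr
      _ = _ := by ring
  constructor
  · refine hlit (C := 1 / ‖k‖ * M) fun x hx => ?_
    rw [jostSol_eq hk hk0 hP (by linarith), add_sub_cancel_left]
    have := hgen (c := 1) (d := 1) (C := 1) (by simp) (by simp) hx
    simpa only [volt, jostK, one_mul, mul_assoc] using this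
  · refine hlit (C := ‖k‖ / ‖k‖ * M) fun x hx => ?_
    rw [jostSolDeriv, add_sub_cancel_left]
    exact hgen (by rw [norm_neg]) le_rfl hx

/-- Uniqueness of the Jost solution. -/
theorem eq_jostSol {w w' : ℝ → ℂ}
    (hw : SecondPrimitive w w' (fun t : ℝ => (k ^ 2 + P t) * w t))
    (h1 : (fun x : ℝ => w x - expSol k x) =o[atTop] expWeight k)
    (h2 : (fun x : ℝ => w' x - -k * expSol k x) =o[atTop] expWeight k) {x : ℝ} (hx : 0 < x) :
    w x = jostSol k P x := by
  have S := secondPrimitive_jostSol hk hk0 hP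
  obtain ⟨a1, a2⟩ := jostSol_asymptotics hk hk0 hP
  have D := (hw.sub S).congr (g₁ := fun x => w x - jostSol k P x) (fun x _ => rfl)
    (h₁ := fun t : ℝ => (k ^ 2 + P t) * (w t - jostSol k P t)) (ae_of_all _ fun x => by ring)
  have d1 : (fun x => w x - jostSol k P x) =o[atTop] expWeight k := by simpa using h1.sub a1
  have d2 : (fun x => w' x - jostSolDeriv k P x) =o[atTop] expWeight k := by
    refine (h2.sub a2).congr (fun x => ?_) fun _ => rfl
    ring
  have hE : expWeight k =O[atTop] expSol k := IsBigO.of_bound 1 (Eventually.of_forall fun x => by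
    rw [norm_expSol, one_mul, Real.norm_of_nonneg (expWeight_pos k x).le])
  have hE' : expSol k =O[atTop] expWeight k := IsBigO.of_bound 1 (Eventually.of_forall fun x => by
    rw [norm_expSol, one_mul, Real.norm_of_nonneg (expWeight_pos k x).le])
  have hone : (fun x => expWeight k x * expWeight k x) =O[atTop] (fun _ : ℝ => (1 : ℝ)) := by
    refine IsBigO.of_bound 1 ?_
    filter_upwards [eventually_ge_atTop 0] with x hx
    have h1 := expWeight_le_one hk hx
    have h0 := expWeight_pos k x
    rw [Real.norm_of_nonneg (by positivity), norm_one]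
    nlinarith
  have hequiv : IsEquivalent atTop (jostSol k P) (expSol k) := a1.trans_isBigO hE
  have hqb : jostSol k P =O[atTop] expWeight k := hequiv.isBigO.trans hE'
  have hqb' : expWeight k =O[atTop] jostSol k P := hE.trans hequiv.isBigO_symm
  have hq'b : jostSolDeriv k P =O[atTop] expWeight k := by
    have := a2.isBigO.add (hE'.const_mul_left (-k))
    simpa using this
  have hW1 := (d1.mul_isBigO hq'b).trans_isBigO hone
  have hW2 := (d2.mul_isBigO hqb).trans_isBigO hone
  have hne : ∀ᶠ x in atTop, jostSol k P x ≠ 0 := by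
    obtain ⟨c, hc⟩ := hqb'.bound
    filter_upwards [hc] with x hx h0
    rw [h0, norm_zero, mul_zero, Real.norm_of_nonneg (expWeight_pos k x).le] at hx
    linarith [expWeight_pos k x]
  have hV : ∀ x y, 0 < x → 0 < y → IntervalIntegrable (fun t : ℝ => k ^ 2 + P t) volume x y :=
    fun x y hx hy => intervalIntegrable_const.add (intervalIntegrable_iff.2
      ((hP (min x y / 2) (by positivity)).mono_set
        fun t ht => lt_of_le_of_lt (by linarith [lt_min hx hy]) ht.1))
  exact sub_eq_zero.1 (D.eq_zero_of_wronskian S hV ((isLittleO_one_iff ℝ).1 (hW1.sub hW2)) hne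
    ((d1.trans_isBigO hqb').tendsto_div_nhds_zero) hx)

end Jost

/-! ### The unperturbed Jost solution -/

theorem macInt_zero {ν : ℂ} {x s : ℝ} (hx : 0 < x) (hs : 0 < s) :
    macInt ν 0 x s = ((2 * x : ℝ) : ℂ) ^ (-ν) * (Complex.exp (-(s : ℂ)) * (s : ℂ) ^ (2 * ν)) := by
  have hs0 : (s : ℂ) ≠ 0 := by exact_mod_cast hs.ne'
  have e : (0 : ℂ) + (s : ℂ) / (2 * (x : ℂ)) = ((s : ℝ) : ℂ) * (((2 * x)⁻¹ : ℝ) : ℂ) := by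
    push_cast; ring
  have h2x : ((2 * x : ℝ) : ℂ).arg ≠ Real.pi := by
    rw [Complex.arg_ofReal_of_nonneg (by positivity)]; exact Real.pi_pos.ne
  rw [macInt, e, Complex.mul_cpow_ofReal_nonneg hs.le (by positivity), Complex.ofReal_inv,
    Complex.inv_cpow _ _ h2x, Complex.cpow_neg, two_mul ν, Complex.cpow_add _ _ hs0]
  ring

theorem integral_exp_mul_cpow {μ : ℂ} (hμ : -1 < μ.re) :
    ∫ s in Ioi (0 : ℝ), Complex.exp (-(s : ℂ)) * (s : ℂ) ^ μ = Complex.Gamma (μ + 1) := by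
  rw [Complex.Gamma_eq_integral (by rw [Complex.add_re, Complex.one_re]; linarith),
    Complex.GammaIntegral]
  refine integral_congr_ae (ae_of_all _ fun s => ?_)
  simp only [add_sub_cancel_right, Complex.ofReal_exp, Complex.ofReal_neg]

/-- At k = 0 the two powers of s merge into s^{2ν}, and the integral becomes a Gamma integral. -/
theorem macI_zero {ν : ℂ} (hν : -1 / 2 < ν.re) {x : ℝ} (hx : 0 < x) :
    macI ν 0 x = ((2 * x : ℝ) : ℂ) ^ (-ν) * Complex.Gamma (2 * ν + 1) := by
  rw [macI, setIntegral_congr_fun measurableSet_Ioi fun s hs => macInt_zero hx hs,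
    integral_const_mul, integral_exp_mul_cpow]
  simp only [Complex.mul_re, Complex.re_ofNat, Complex.im_ofNat, zero_mul, sub_zero]
  linarith

/-- The filter `k → 0`, `Re k ≥ 0`, `k ≠ 0`. -/
def kFilter : Filter ℂ := 𝓝[{k : ℂ | 0 ≤ k.re ∧ k ≠ 0}] 0

theorem eventually_kFilter : ∀ᶠ k in kFilter, 0 ≤ k.re ∧ k ≠ 0 := self_mem_nhdsWithin

theorem kFilter_le : kFilter ≤ 𝓝 0 := nhdsWithin_le_nhds

instance : kFilter.IsCountablyGenerated := by unfold kFilter; infer_instance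

/-- With k inside the base, the integrand is continuous at k = 0, where the base is s/(2x) > 0; no
power of k remains outside. -/
theorem tendsto_macI_zero {ν : ℂ} (hν : -1 / 2 < ν.re) {x : ℝ} (hx : 0 < x) :
    Tendsto (fun k => macI ν k x) kFilter (𝓝 (macI ν 0 x)) := by
  obtain ⟨C, hC0, hC⟩ := exists_macInt_bound ν hx hx zero_le_one
  refine tendsto_integral_filter_of_dominated_convergence (fun s => C * macDom ν.re s) ?_ ?_
    ((integrableOn_macDom hν).const_mul C) ?_
  · exact Eventually.of_forall fun k => (measurable_macInt ν k x).aestronglyMeasurable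
  · have h1 : ∀ᶠ k in kFilter, ‖k‖ < 1 := by
      have := (continuous_norm.tendsto (0 : ℂ)).mono_left kFilter_le
      rw [norm_zero] at this
      exact this.eventually_lt_const one_pos
    filter_upwards [eventually_kFilter, h1] with k hk hk1
    filter_upwards [ae_restrict_mem measurableSet_Ioi] with s hs
    exact hC k x s hk.1 hk1.le le_rfl le_rfl hs
  · filter_upwards [ae_restrict_mem measurableSet_Ioi] with s hs
    have hb : (0 : ℂ) + (s : ℂ) / (2 * (x : ℂ)) ∈ Complex.slitPlane :=
      base_mem_slitPlane le_rfl hx hs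
    have : ContinuousAt (fun k : ℂ => macInt ν k x s) 0 := by
      refine continuousAt_const.mul (ContinuousAt.comp (g := fun z : ℂ => z ^ ν)
        (f := fun k : ℂ => k + (s : ℂ) / (2 * (x : ℂ)))
        (_root_.continuousAt_cpow_const hb) (by fun_prop))
    exact this.tendsto.mono_left kFilter_le

theorem tendsto_macI_atTop {ν k : ℂ} (hν : -1 / 2 < ν.re) (hk : 0 ≤ k.re) (hk0 : k ≠ 0) :
    Tendsto (macI ν k) atTop (𝓝 (k ^ ν * Complex.Gamma (ν + 1))) := by
  have hkslit : k ∈ Complex.slitPlane := by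
    rcases hk.lt_or_eq with h | h
    · exact Or.inl h
    · exact Or.inr fun h2 => hk0 (Complex.ext h.symm h2)
  obtain ⟨C, hC0, hC⟩ := exists_macInt_bound_atTop ν hk hk0
  rw [← integral_exp_mul_cpow (by linarith), ← integral_const_mul]
  refine tendsto_integral_filter_of_dominated_convergence (fun s => C * macDom ν.re s) ?_ ?_
    ((integrableOn_macDom hν).const_mul C) ?_
  · exact Eventually.of_forall fun x => (measurable_macInt ν k x).aestronglyMeasurable
  · filter_upwards [eventually_ge_atTop 1] with x hx
    filter_upwards [ae_restrict_mem measurableSet_Ioi] with s hs using hC x s hx hs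
  · filter_upwards [ae_restrict_mem measurableSet_Ioi] with s hs
    have h1 : Tendsto (fun x : ℝ => k + (s : ℂ) / (2 * (x : ℂ))) atTop (𝓝 k) := by
      have h2 : Tendsto (fun x : ℝ => ((s / 2 * x⁻¹ : ℝ) : ℂ)) atTop (𝓝 ((0 : ℝ) : ℂ)) := by
        refine (Complex.continuous_ofReal.tendsto _).comp ?_
        simpa using tendsto_inv_atTop_zero.const_mul (s / 2)
      have h3 := h2.const_add k
      simp only [Complex.ofReal_zero, add_zero] at h3
      refine h3.congr fun x => ?_
      push_cast; ring
    have h4 := ((_root_.continuousAt_cpow_const (b := ν) hkslit).tendsto.comp h1).const_mul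
      (Complex.exp (-(s : ℂ)) * (s : ℂ) ^ ν)
    rw [mul_comm (k ^ ν)]
    exact h4

/-- The power is multiplicative here because |arg k| ≤ π/2, while 1 + s/(2kx) has positive real part
and so argument less than π/2 in modulus; the sum stays inside ]-π,π[. This includes imaginary k. -/
theorem cpow_mul_base {ν k : ℂ} {x s : ℝ} (hk : 0 ≤ k.re) (hk0 : k ≠ 0) (hx : 0 < x)
    (hs : 0 < s) : k ^ ν * (1 + (s : ℂ) / (2 * (k * x))) ^ ν = (k + (s : ℂ) / (2 * (x : ℂ))) ^ ν := by
  have hx0 : (x : ℂ) ≠ 0 := by exact_mod_cast hx.ne'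
  set z : ℂ := 1 + (s : ℂ) / (2 * (k * x)) with hz
  have hzk : k + (s : ℂ) / (2 * (x : ℂ)) = k * z := by
    rw [hz]; field_simp
  have hzre : 0 < z.re := by
    have e : z = 1 + ((s / (2 * x) : ℝ) : ℂ) * k⁻¹ := by
      rw [hz]; push_cast; field_simp
    rw [e, Complex.add_re, Complex.one_re, Complex.re_ofReal_mul, Complex.inv_re]
    have : 0 ≤ k.re / Complex.normSq k := div_nonneg hk (Complex.normSq_nonneg _)
    positivity
  have hz0 : z ≠ 0 := fun h => by rw [h] at hzre; simp at hzre
  have h1 := abs_le.1 (Complex.abs_arg_le_pi_div_two_iff.2 hk)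
  have h2 := abs_lt.1 (Complex.abs_arg_lt_pi_div_two_iff.2 (Or.inl hzre))
  have hlog : Complex.log (k * z) = Complex.log k + Complex.log z :=
    (Complex.log_mul_eq_add_log_iff hk0 hz0).2 ⟨by linarith [h1.1, h2.1], by linarith [h1.2, h2.2]⟩
  rw [hzk, Complex.cpow_def_of_ne_zero hk0, Complex.cpow_def_of_ne_zero hz0,
    Complex.cpow_def_of_ne_zero (mul_ne_zero hk0 hz0), ← Complex.exp_add, hlog, add_mul]

section WZero

variable {m k : ℂ} (hm : 0 < m.re)

include hm

theorem half_lt_re_sub : -1 / 2 < (m - 1 / 2).re := by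
  simp only [Complex.sub_re, Complex.div_ofNat_re, Complex.one_re]
  linarith

theorem Gamma_add_half_ne_zero : Complex.Gamma (m + 1 / 2) ≠ 0 :=
  Complex.Gamma_ne_zero_of_re_pos (by
    simp only [Complex.add_re, Complex.div_ofNat_re, Complex.one_re]
    linarith)

/-- Isolates the whole singularity in k as the prefactor k^{1/2-m}, which the normalization of v_m
will cancel. -/
theorem wZero_eq (hk : 0 ≤ k.re) (hk0 : k ≠ 0) {x : ℝ} (hx : 0 < x) :
    wZero m k x = (k ^ (m - 1 / 2) * Complex.Gamma (m + 1 / 2))⁻¹ *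
      (expSol k x * macI (m - 1 / 2) k x) := by
  have hkν : k ^ (m - 1 / 2) ≠ 0 := by simp [Complex.cpow_eq_zero_iff, hk0]
  have hG := Gamma_add_half_ne_zero hm
  have e : macI (m - 1 / 2) k x = k ^ (m - 1 / 2) * ∫ s in Ioi (0 : ℝ), Complex.exp (-(s : ℂ)) *
      (s : ℂ) ^ (m - 1 / 2) * (1 + (s : ℂ) / (2 * (k * x))) ^ (m - 1 / 2) := by
    rw [macI, ← integral_const_mul]
    refine setIntegral_congr_fun measurableSet_Ioi fun s hs => ?_
    simp only [macInt]
    rw [← cpow_mul_base hk hk0 hx hs]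
    ring
  rw [e, wZero, macdonald1d]
  simp only [hm.le, if_true, expSol]
  generalize (∫ s in Ioi (0 : ℝ), Complex.exp (-(s : ℂ)) * (s : ℂ) ^ (m - 1 / 2) *
    (1 + (s : ℂ) / (2 * (k * x))) ^ (m - 1 / 2)) = J
  generalize k ^ (m - 1 / 2) = K at *
  generalize Complex.Gamma (m + 1 / 2) = G at *
  field_simp

/-- The derivative of `wZero`. -/
def wZeroDeriv (m k : ℂ) (x : ℝ) : ℂ :=
  (k ^ (m - 1 / 2) * Complex.Gamma (m + 1 / 2))⁻¹ *
    (-k * expSol k x * macI (m - 1 / 2) k x +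
      expSol k x * ∫ s in Ioi (0 : ℝ), macInt₁ (m - 1 / 2) k x s)

theorem secondPrimitive_wZero (hk : 0 ≤ k.re) (hk0 : k ≠ 0) :
    SecondPrimitive (wZero m k) (wZeroDeriv m k)
      (fun t : ℝ => (k ^ 2 + (m ^ 2 - 1 / 4) / (t : ℂ) ^ 2) * wZero m k t) := by
  have hν := half_lt_re_sub hm
  have F := fundPair_exp hk0
  have hE : ∀ x : ℝ, 0 < x → HasDerivAt (expSol k) (-k * expSol k x) x := F.hasDerivAt_u
  set V : ℝ → ℂ := fun t => k ^ 2 + (m ^ 2 - 1 / 4) / (t : ℂ) ^ 2 with hV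
  have d1 : ∀ x : ℝ, 0 < x → HasDerivAt (fun x => expSol k x * macI (m - 1 / 2) k x)
      (-k * expSol k x * macI (m - 1 / 2) k x +
        expSol k x * ∫ s in Ioi (0 : ℝ), macInt₁ (m - 1 / 2) k x s) x := fun x hx =>
    (hE x hx).mul (hasDerivAt_macI hν hk hx).1.2
  have d2 : ∀ x : ℝ, 0 < x → HasDerivAt (fun x => -k * expSol k x * macI (m - 1 / 2) k x +
        expSol k x * ∫ s in Ioi (0 : ℝ), macInt₁ (m - 1 / 2) k x s)
      (V x * (expSol k x * macI (m - 1 / 2) k x)) x := by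
    intro x hx
    have hx0 : (x : ℂ) ≠ 0 := by exact_mod_cast hx.ne'
    obtain ⟨⟨-, h1⟩, ⟨-, h2⟩⟩ := hasDerivAt_macI hν hk hx
    have h := ((((hE x hx).const_mul (-k)).mul h1).add ((hE x hx).mul h2))
    refine h.congr_deriv ?_
    -- With ν = m - 1/2 the constant ν(ν+1) is m² - 1/4, and the term -2k I' comes from conjugation
    -- by e^{-kx}.
    have hode := macI_ode hν hk hk0 hx
    simp only [hV]
    generalize (∫ s in Ioi (0 : ℝ), macInt₂ (m - 1 / 2) k x s) = I₂ at hode ⊢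
    generalize (∫ s in Ioi (0 : ℝ), macInt₁ (m - 1 / 2) k x s) = I₁ at hode ⊢
    generalize macI (m - 1 / 2) k x = I₀ at hode ⊢
    field_simp
    linear_combination (4 * expSol k x) * hode
  have hVc : ContinuousOn V (Ioi 0) := continuousOn_const.add (fundPair_zero m).continuousOn
  have S := (secondPrimitive_of_hasDerivAt (hVc.mul fun x hx =>
    (d1 x hx).continuousAt.continuousWithinAt) d1 d2).const_mul
      (k ^ (m - 1 / 2) * Complex.Gamma (m + 1 / 2))⁻¹
  refine S.congr (fun x hx => wZero_eq hm hk hk0 hx) ?_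
  refine (ae_restrict_iff' measurableSet_Ioi).2 (ae_of_all _ fun x hx => ?_)
  simp only [Pi.mul_apply, hV]
  rw [wZero_eq hm hk hk0 hx]
  ring

theorem wZero_asymptotics (hk : 0 ≤ k.re) (hk0 : k ≠ 0) :
    (fun x : ℝ => wZero m k x - expSol k x) =o[atTop] expWeight k ∧
    (fun x : ℝ => wZeroDeriv m k x - -k * expSol k x) =o[atTop] expWeight k := by
  have hν := half_lt_re_sub hm
  have hkν : k ^ (m - 1 / 2) ≠ 0 := by simp [Complex.cpow_eq_zero_iff, hk0]
  have hG := Gamma_add_half_ne_zero hm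
  have hE' : expSol k =O[atTop] expWeight k := IsBigO.of_bound 1 (Eventually.of_forall fun x => by
    rw [norm_expSol, one_mul, Real.norm_of_nonneg (expWeight_pos k x).le])
  set A := (k ^ (m - 1 / 2) * Complex.Gamma (m + 1 / 2))⁻¹ with hA
  have hlim : Tendsto (fun x => A * macI (m - 1 / 2) k x - 1) atTop (𝓝 0) := by
    have := ((tendsto_macI_atTop hν hk hk0).const_mul A).sub_const 1
    rwa [show m - 1 / 2 + 1 = m + 1 / 2 by ring, hA, inv_mul_cancel₀ (mul_ne_zero hkν hG),
      sub_self] at this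
  have hlim1 : Tendsto (fun x => ∫ s in Ioi (0 : ℝ), macInt₁ (m - 1 / 2) k x s) atTop (𝓝 0) := by
    obtain ⟨C, hC0, hC⟩ := exists_macInt_bound_atTop (m - 1 / 2) hk hk0
    have hd := (integrableOn_macDom hν).const_mul C
    have h2 : Tendsto (fun x : ℝ => (∫ s in Ioi (0 : ℝ), C * macDom (m - 1 / 2).re s) *
        (‖m - 1 / 2‖ * x⁻¹)) atTop (𝓝 0) := by
      simpa using (tendsto_inv_atTop_zero.const_mul ‖m - 1 / 2‖).const_mul
        (∫ s in Ioi (0 : ℝ), C * macDom (m - 1 / 2).re s)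
    refine squeeze_zero_norm' ?_ h2
    filter_upwards [eventually_ge_atTop 1] with x hx
    have hx0 : 0 < x := by linarith
    rw [← integral_mul_const]
    refine norm_integral_le_of_norm_le (hd.mul_const _) ?_
    filter_upwards [ae_restrict_mem measurableSet_Ioi] with s hs
    refine (norm_macInt₁_le hk hx0 hs).trans ?_
    rw [div_eq_mul_inv ‖m - 1 / 2‖]
    exact mul_le_mul_of_nonneg_right (hC x s hx hs) (by positivity)
  constructor
  · have := hE'.mul_isLittleO ((isLittleO_one_iff ℝ).2 hlim)
    simp only [mul_one] at this
    refine this.congr' ?_ EventuallyEq.rfl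
    filter_upwards [eventually_gt_atTop 0] with x hx
    rw [wZero_eq hm hk hk0 hx]; ring
  · have h3 : Tendsto (fun x => -k * (A * macI (m - 1 / 2) k x - 1) +
        A * ∫ s in Ioi (0 : ℝ), macInt₁ (m - 1 / 2) k x s) atTop (𝓝 0) := by
      simpa using (hlim.const_mul (-k)).add (hlim1.const_mul A)
    have := hE'.mul_isLittleO ((isLittleO_one_iff ℝ).2 h3)
    simp only [mul_one] at this
    refine this.congr' ?_ EventuallyEq.rfl
    filter_upwards with x
    rw [wZeroDeriv]; ring

/-- The normalization `√(π/(2k)) (k/2)^m`. -/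
def vFactor (m k : ℂ) : ℂ := ((Real.pi : ℂ) / (2 * k)) ^ (1 / 2 : ℂ) * (k / 2) ^ m

omit hm in
-- Since |arg k| ≤ π/2, principal logarithms are additive for k^{-1} and for positive multiples, so
-- the two branches combine into the single power k^{m-1/2}.
theorem vFactor_eq (hk : 0 ≤ k.re) (hk0 : k ≠ 0) :
    vFactor m k = Complex.exp ((Real.log (Real.pi / 2) : ℂ) / 2 - (Real.log 2 : ℂ) * m) *
      k ^ (m - 1 / 2) := by
  have harg : k.arg ≠ Real.pi := by
    have := abs_le.1 (Complex.abs_arg_le_pi_div_two_iff.2 hk)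
    linarith [this.2, Real.pi_pos]
  have e1 : (Real.pi : ℂ) / (2 * k) = ((Real.pi / 2 : ℝ) : ℂ) * k⁻¹ := by
    push_cast; field_simp
  have e2 : k / 2 = ((2⁻¹ : ℝ) : ℂ) * k := by push_cast; ring
  have hk2 : ((2⁻¹ : ℝ) : ℂ) * k ≠ 0 := by simp [hk0]
  have hk1 : ((Real.pi / 2 : ℝ) : ℂ) * k⁻¹ ≠ 0 := by simp [hk0, Real.pi_ne_zero]
  rw [vFactor, e1, e2, Complex.cpow_def_of_ne_zero hk1, Complex.cpow_def_of_ne_zero hk2,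
    Complex.cpow_def_of_ne_zero hk0, Complex.log_ofReal_mul (by positivity) (inv_ne_zero hk0),
    Complex.log_ofReal_mul (by positivity) hk0, Complex.log_inv _ harg, Real.log_inv,
    ← Complex.exp_add, ← Complex.exp_add]
  congr 1
  push_cast
  ring

/-- The constant in front of the Macdonald integral in the renormalized Jost solution. -/
def macConst (m : ℂ) : ℂ :=
  Complex.exp ((Real.log (Real.pi / 2) : ℂ) / 2 - (Real.log 2 : ℂ) * m) /
    Complex.Gamma (m + 1 / 2)

theorem vFactor_mul_wZero (hk : 0 ≤ k.re) (hk0 : k ≠ 0) {x : ℝ} (hx : 0 < x) :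
    vFactor m k * wZero m k x = macConst m * (expSol k x * macI (m - 1 / 2) k x) := by
  have hkν : k ^ (m - 1 / 2) ≠ 0 := by simp [Complex.cpow_eq_zero_iff, hk0]
  have hG := Gamma_add_half_ne_zero hm
  rw [vFactor_eq hk hk0, wZero_eq hm hk hk0 hx, macConst]
  generalize k ^ (m - 1 / 2) = K at *
  generalize Complex.Gamma (m + 1 / 2) = G at *
  generalize macI (m - 1 / 2) k x = I₀
  field_simp

/-- This evaluates the limit constant: the duplication formula turns Γ(2m)/Γ(m+1/2) into Γ(m), and
the powers of 2 and π cancel up to the factor 1/2. -/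
theorem macConst_mul {x : ℝ} (hx : 0 < x) :
    macConst m * macI (m - 1 / 2) 0 x = 1 / 2 * Complex.Gamma m * powSol m x := by
  have hG := Gamma_add_half_ne_zero hm
  have hdup := Complex.Gamma_mul_Gamma_add_half m
  have h2 : (2 : ℂ) ≠ 0 := two_ne_zero
  have hπ : ((√Real.pi : ℝ) : ℂ) = Complex.exp ((Real.log Real.pi : ℂ) / 2) := by
    rw [Real.sqrt_eq_rpow, Real.rpow_def_of_pos Real.pi_pos]
    push_cast
    congr 1; ring
  have hl2 : Complex.log 2 = (Real.log 2 : ℂ) := by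
    rw [Complex.ofReal_log (by norm_num)]; norm_num
  have e1 : Complex.exp ((Real.log (Real.pi / 2) : ℂ) / 2 - (Real.log 2 : ℂ) * m) *
      (2 : ℂ) ^ (1 / 2 - m) = 2⁻¹ * ((2 : ℂ) ^ (1 - 2 * m) * ((√Real.pi : ℝ) : ℂ)) := by
    have h12 : (2⁻¹ : ℂ) = Complex.exp (-(Real.log 2 : ℂ)) := by
      rw [← hl2, Complex.exp_neg, Complex.exp_log h2]
    rw [hπ, Complex.cpow_def_of_ne_zero h2, Complex.cpow_def_of_ne_zero h2, hl2,
      Real.log_div Real.pi_ne_zero (by norm_num)]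
    rw [h12, ← Complex.exp_add, ← Complex.exp_add, ← Complex.exp_add]
    congr 1
    push_cast
    ring
  rw [macI_zero (half_lt_re_sub hm) hx, macConst, powSol, Complex.ofReal_mul, Complex.ofReal_ofNat,
    show -(m - 1 / 2) = 1 / 2 - m by ring, show 2 * (m - 1 / 2) + 1 = 2 * m by ring]
  have e2 : ((2 : ℂ) * (x : ℂ)) ^ (1 / 2 - m) = (2 : ℂ) ^ (1 / 2 - m) * (x : ℂ) ^ (1 / 2 - m) := by
    have := Complex.mul_cpow_ofReal_nonneg (a := 2) (b := x) zero_le_two hx.le (1 / 2 - m)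
    simpa using this
  rw [e2]
  generalize (x : ℂ) ^ (1 / 2 - m) = Y
  generalize (2 : ℂ) ^ (1 / 2 - m) = T at *
  generalize Complex.exp ((Real.log (Real.pi / 2) : ℂ) / 2 - (Real.log 2 : ℂ) * m) = W at *
  generalize Complex.Gamma (m + 1 / 2) = G at *
  field_simp
  linear_combination (2 * Complex.Gamma (2 * m) * Y) * e1 - Y * hdup

theorem tendsto_vFactor_mul_wZero {x : ℝ} (hx : 0 < x) :
    Tendsto (fun k => vFactor m k * wZero m k x) kFilter
      (𝓝 (1 / 2 * Complex.Gamma m * powSol m x)) := by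
  have h1 : Tendsto (fun k => expSol k x) kFilter (𝓝 1) := by
    have : Continuous (fun k => expSol k x) := by unfold expSol; fun_prop
    simpa [expSol] using (this.tendsto 0).mono_left kFilter_le
  have h2 := (h1.mul (tendsto_macI_zero (half_lt_re_sub hm) hx)).const_mul (macConst m)
  rw [one_mul, macConst_mul hm hx] at h2
  refine h2.congr' ?_
  filter_upwards [eventually_kFilter] with k hk
  rw [vFactor_mul_wZero hm hk.1 hk.2 hx]

/-- Uniformity in the region x|k| ≤ 1 provides the majorant for dominated convergence in the inner
region. -/
theorem exists_vFactor_mul_wZero_bound : ∃ C, 0 ≤ C ∧ ∀ (k : ℂ) (x : ℝ), 0 ≤ k.re → k ≠ 0 →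
    0 < x → x * ‖k‖ ≤ 1 → ‖vFactor m k * wZero m k x‖ ≤ C * x ^ (1 / 2 - m.re) := by
  obtain ⟨C, hC0, hC⟩ := exists_macInt_bound_small (m - 1 / 2)
  have hd := integrableOn_macDom (half_lt_re_sub hm)
  have hd0 : 0 ≤ ∫ s in Ioi (0 : ℝ), macDom (m - 1 / 2).re s :=
    setIntegral_nonneg measurableSet_Ioi fun s hs => macDom_nonneg hs
  refine ⟨‖macConst m‖ * (C * ∫ s in Ioi (0 : ℝ), macDom (m - 1 / 2).re s), by positivity,
    fun k x hk hk0 hx hxk => ?_⟩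
  have hI : ‖macI (m - 1 / 2) k x‖ ≤ C * x ^ (-(m - 1 / 2).re) *
      ∫ s in Ioi (0 : ℝ), macDom (m - 1 / 2).re s := by
    rw [← integral_const_mul]
    refine norm_integral_le_of_norm_le (hd.const_mul _) ?_
    filter_upwards [ae_restrict_mem measurableSet_Ioi] with s hs using hC k x s hk hx hxk hs
  rw [vFactor_mul_wZero hm hk hk0 hx, norm_mul, norm_mul, norm_expSol]
  have hre : -(m - 1 / 2).re = 1 / 2 - m.re := by
    simp only [Complex.sub_re, Complex.div_ofNat_re, Complex.one_re]; ring
  rw [hre] at hI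
  have h1 := expWeight_le_one hk hx.le
  calc ‖macConst m‖ * (expWeight k x * ‖macI (m - 1 / 2) k x‖)
      ≤ ‖macConst m‖ * (1 * ‖macI (m - 1 / 2) k x‖) := by gcongr
    _ ≤ ‖macConst m‖ * (1 * (C * x ^ (1 / 2 - m.re) *
        ∫ s in Ioi (0 : ℝ), macDom (m - 1 / 2).re s)) := by gcongr
    _ = _ := by ring

omit hm in
theorem exists_vFactor_bound (m : ℂ) : ∃ C, 0 ≤ C ∧ ∀ k : ℂ, 0 ≤ k.re → k ≠ 0 →
    ‖vFactor m k‖ ≤ C * (1 / ‖k‖) ^ (1 / 2 - m.re) := by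
  refine ⟨‖Complex.exp ((Real.log (Real.pi / 2) : ℂ) / 2 - (Real.log 2 : ℂ) * m)‖ *
    Real.exp (Real.pi * |(m - 1 / 2).im|), by positivity, fun k hk hk0 => ?_⟩
  rw [vFactor_eq hk hk0, norm_mul, mul_assoc]
  refine mul_le_mul_of_nonneg_left ((norm_cpow_le_exp _ _).trans_eq ?_) (norm_nonneg _)
  rw [mul_comm, one_div ‖k‖, Real.inv_rpow (norm_nonneg k), ← Real.rpow_neg (norm_nonneg k)]
  congr 2
  simp only [Complex.sub_re, Complex.div_ofNat_re, Complex.one_re]; ring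

end WZero

/-! ### Jost solutions of the perturbed Bessel operator -/

/-- The full potential `(m² - 1/4) / x² + Q`. -/
def fullPot (m : ℂ) (Q : ℝ → ℂ) (t : ℝ) : ℂ := (m ^ 2 - 1 / 4) / (t : ℂ) ^ 2 + Q t

theorem norm_centrifugal (c : ℂ) {t : ℝ} (ht : 0 < t) :
    ‖c / (t : ℂ) ^ 2‖ = ‖c‖ * t ^ (-2 : ℝ) := by
  rw [norm_div, norm_pow, Complex.norm_real, Real.norm_of_nonneg ht.le, Real.rpow_neg ht.le,
    div_eq_mul_inv]
  norm_num

theorem integrableOn_centrifugal (c : ℂ) {a : ℝ} (ha : 0 < a) :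
    IntegrableOn (fun t : ℝ => c / (t : ℂ) ^ 2) (Ioi a) := by
  refine Integrable.mono' ((integrableOn_Ioi_rpow_of_lt (a := -2) (by norm_num) ha).const_mul ‖c‖)
    ?_ ?_
  · refine Measurable.aestronglyMeasurable ?_
    fun_prop
  · filter_upwards [ae_restrict_mem measurableSet_Ioi] with t ht
    rw [norm_centrifugal c (ha.trans ht)]

/-- By scaling, the centrifugal tail from a = 1/(2|k|) divided by |k| is 2‖c‖, independent of k. -/
theorem tail_centrifugal (c : ℂ) {a : ℝ} (ha : 0 < a) :
    tail (fun t : ℝ => ‖c / (t : ℂ) ^ 2‖) a = ‖c‖ / a := by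
  rw [tail, setIntegral_congr_fun measurableSet_Ioi fun t ht => norm_centrifugal c (ha.trans ht),
    integral_const_mul, integral_Ioi_rpow_of_lt (by norm_num) ha]
  norm_num
  rw [Real.rpow_neg_one, div_eq_mul_inv]

namespace PotAssumption

variable {m k : ℂ} {δ : ℝ} {Q : ℝ → ℂ}

theorem integrableOn_id_mul (H : PotAssumption m δ Q) {a : ℝ} (ha : 0 < a) :
    IntegrableOn (fun y => y * ‖Q y‖) (Ioi a) := by
  have hQm := aestronglyMeasurable_of_locallyIntegrableOn H.locallyIntegrable ha.le
  refine Integrable.mono' ((H.integrableOn a ha).const_mul (a ^ (1 - δ)))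
    (aestronglyMeasurable_id.mul hQm.norm) ?_
  filter_upwards [ae_restrict_mem measurableSet_Ioi] with y hy
  have hy0 := ha.trans hy
  have h1 := le_rpow_mul_rpow H.one_le ha (le_of_lt hy)
  have hl := logFactor_nonneg m y
  have hd := Real.rpow_pos_of_pos hy0 δ
  have ha3 := Real.rpow_pos_of_pos ha (1 - δ)
  rw [Real.norm_of_nonneg (by positivity), ← mul_assoc]
  refine mul_le_mul_of_nonneg_right (h1.trans ?_) (norm_nonneg _)
  rw [potWeight]
  gcongr
  nlinarith

theorem norm_le_id_mul {a y : ℝ} (ha : 0 < a) (hy : a < y) : ‖Q y‖ ≤ a⁻¹ * (y * ‖Q y‖) := by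
  rw [← mul_assoc]
  refine le_mul_of_one_le_left (norm_nonneg _) ?_
  rw [inv_mul_eq_div, one_le_div ha]
  exact hy.le

theorem integrableOn_potential (H : PotAssumption m δ Q) {a : ℝ} (ha : 0 < a) :
    IntegrableOn Q (Ioi a) := by
  refine Integrable.mono' ((H.integrableOn_id_mul ha).const_mul a⁻¹)
    (aestronglyMeasurable_of_locallyIntegrableOn H.locallyIntegrable ha.le) ?_
  filter_upwards [ae_restrict_mem measurableSet_Ioi] with y hy using norm_le_id_mul ha hy

theorem tail_potential_le (H : PotAssumption m δ Q) {a : ℝ} (ha : 0 < a) :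
    tail (fun y => ‖Q y‖) a ≤ a⁻¹ * tail (fun y => y * ‖Q y‖) a := by
  rw [tail, tail, ← integral_const_mul]
  exact setIntegral_mono_on (H.integrableOn_potential ha).norm
    ((H.integrableOn_id_mul ha).const_mul _) measurableSet_Ioi fun y hy => norm_le_id_mul ha hy

theorem integrableOn_fullPot (H : PotAssumption m δ Q) {a : ℝ} (ha : 0 < a) :
    IntegrableOn (fullPot m Q) (Ioi a) :=
  (integrableOn_centrifugal _ ha).add (H.integrableOn_potential ha)

/-- The uniqueness theorem identifies the Macdonald function with an abstract Jost solution, so both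
Jost solutions can be compared through their Volterra equations. -/
theorem wZero_eq_jostSol (hm : 0 < m.re) (hk : 0 ≤ k.re) (hk0 : k ≠ 0) {x : ℝ} (hx : 0 < x) :
    wZero m k x = jostSol k (fun t : ℝ => (m ^ 2 - 1 / 4) / (t : ℂ) ^ 2) x :=
  eq_jostSol hk hk0 (fun _ ha => integrableOn_centrifugal _ ha)
    (secondPrimitive_wZero hm hk hk0) (wZero_asymptotics hm hk hk0).1
    (wZero_asymptotics hm hk hk0).2 hx

theorem secondPrimitive_jostSol_fullPot (H : PotAssumption m δ Q) (hk : 0 ≤ k.re) (hk0 : k ≠ 0) :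
    SecondPrimitive (jostSol k (fullPot m Q)) (jostSolDeriv k (fullPot m Q))
      (fun t : ℝ => ((m ^ 2 - 1 / 4) / (t : ℂ) ^ 2 + k ^ 2 + Q t) *
        jostSol k (fullPot m Q) t) :=
  (secondPrimitive_jostSol hk hk0 fun _ ha => H.integrableOn_fullPot ha).congr (fun _ _ => rfl)
    (ae_of_all _ fun t => by rw [fullPot]; ring)

theorem isJostSolution_jostSol (H : PotAssumption m δ Q) (hm : 0 < m.re) (hk : 0 ≤ k.re)
    (hk0 : k ≠ 0) : IsJostSolution m k Q (jostSol k (fullPot m Q)) := by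
  have S := H.secondPrimitive_jostSol_fullPot hk hk0
  have S₀ := secondPrimitive_wZero hm hk hk0
  obtain ⟨a1, a2⟩ := jostSol_asymptotics hk hk0 fun _ ha => H.integrableOn_fullPot ha
  obtain ⟨b1, b2⟩ := wZero_asymptotics hm hk hk0
  refine ⟨S.isEigensolution, ?_, ?_⟩
  · refine (a1.sub b1).congr' (Eventually.of_forall fun x => ?_) EventuallyEq.rfl
    ring
  · refine (a2.sub b2).congr' ?_ EventuallyEq.rfl
    filter_upwards [eventually_gt_atTop 0] with x hx
    rw [S.deriv_eq hx, S₀.deriv_eq hx]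
    ring

theorem eqOn_jostSol (H : PotAssumption m δ Q) (hm : 0 < m.re) (hk : 0 ≤ k.re) (hk0 : k ≠ 0)
    {w : ℝ → ℂ} (hw : IsJostSolution m k Q w) : EqOn w (jostSol k (fullPot m Q)) (Ioi 0) := by
  have S₀ := secondPrimitive_wZero hm hk hk0
  obtain ⟨b1, b2⟩ := wZero_asymptotics hm hk hk0
  intro x hx
  refine eq_jostSol hk hk0 (fun _ ha => H.integrableOn_fullPot ha)
    ((hw.1.secondPrimitive H.locallyIntegrable).congr (fun _ _ => rfl)
      (ae_of_all _ fun t => by rw [fullPot]; ring)) ?_ ?_ hx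
  · refine (IsLittleO.add hw.2.1 b1).congr' (Eventually.of_forall fun x => ?_) EventuallyEq.rfl
    ring
  · refine (IsLittleO.add hw.2.2 b2).congr' ?_ EventuallyEq.rfl
    filter_upwards [eventually_gt_atTop 0] with x hx
    rw [S₀.deriv_eq hx]
    ring

theorem isJostSolution_jostW (H : PotAssumption m δ Q) (hm : 0 < m.re) (hk : 0 ≤ k.re)
    (hk0 : k ≠ 0) : IsJostSolution m k Q (jostW m k Q) := by
  have h : ∃ w, IsJostSolution m k Q w := ⟨_, H.isJostSolution_jostSol hm hk hk0⟩
  rw [jostW, dif_pos h]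
  exact h.choose_spec

theorem jostV_eq (H : PotAssumption m δ Q) (hm : 0 < m.re) (hk : 0 ≤ k.re) (hk0 : k ≠ 0)
    {x : ℝ} (hx : 0 < x) : jostV m k Q x = vFactor m k * jostSol k (fullPot m Q) x := by
  rw [jostV, H.eqOn_jostSol hm hk hk0 (H.isJostSolution_jostW hm hk hk0) hx, vFactor]

end PotAssumption

/-! ### Comparison of two Jost solutions -/

section Compare

variable {k : ℂ} {P₀ P₁ : ℝ → ℂ}

/-- The difference of the two Volterra equations is a Volterra equation for w₁ - w₀ with source (P₁
- P₀) w₁, to which Grönwall's inequality applies in the weight e^{-x Re k}. All constants involve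
tails divided by |k|, and the derivative costs only a factor |k|. -/
theorem norm_jostSol_sub_le (hk : 0 ≤ k.re) (hk0 : k ≠ 0)
    (hP₀ : ∀ a, 0 < a → IntegrableOn P₀ (Ioi a)) (hP₁ : ∀ a, 0 < a → IntegrableOn P₁ (Ioi a))
    {a x τ σ : ℝ} (ha : 0 < a) (hx : a < x) (h0 : tail (fun y => ‖P₀ y‖) a / ‖k‖ ≤ τ)
    (h1 : tail (fun y => ‖P₁ y‖) a / ‖k‖ ≤ τ)
    (hσ : tail (fun y => ‖P₁ y - P₀ y‖) a / ‖k‖ ≤ σ) :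
    ‖jostSol k P₁ x - jostSol k P₀ x‖ ≤ 4 * Real.exp (4 * τ) * σ ∧
    ‖jostSolDeriv k P₁ x - jostSolDeriv k P₀ x‖ ≤
      ‖k‖ * (4 * Real.exp (4 * τ) * (1 + τ) * σ) := by
  have hkn := norm_pos_iff.2 hk0
  set w₀ := jostSol k P₀ with hw₀
  set w₁ := jostSol k P₁ with hw₁
  set M := 2 * Real.exp (2 * τ) with hM
  have hτ : 0 ≤ τ := le_trans (div_nonneg (tail_nonneg (fun _ _ => norm_nonneg _) le_rfl)
    hkn.le) h0
  have hσ0 : 0 ≤ σ := le_trans (div_nonneg (tail_nonneg (fun _ _ => norm_nonneg _) le_rfl)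
    hkn.le) hσ
  have b0 : ∀ y, a < y → ‖w₀ y‖ ≤ M * expWeight k y := fun y hy =>
    (norm_jostSol_le hk hk0 hP₀ ha hy).trans (mul_le_mul_of_nonneg_right
      (mul_le_mul_of_nonneg_left (Real.exp_le_exp.2 (by linarith)) zero_le_two)
      (expWeight_pos k y).le)
  have b1 : ∀ y, a < y → ‖w₁ y‖ ≤ M * expWeight k y := fun y hy =>
    (norm_jostSol_le hk hk0 hP₁ ha hy).trans (mul_le_mul_of_nonneg_right
      (mul_le_mul_of_nonneg_left (Real.exp_le_exp.2 (by linarith)) zero_le_two)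
      (expWeight_pos k y).le)
  have m0 := aestronglyMeasurable_jostSol hk hk0 hP₀ ha
  have m1 := aestronglyMeasurable_jostSol hk hk0 hP₁ ha
  obtain ⟨i0u, i0v⟩ := integrableOn_exp_solutions hk hk0 hP₀ ha m0 b0
  obtain ⟨i1u, i1v⟩ := integrableOn_exp_solutions hk hk0 hP₁ ha m1 b1
  set g : ℝ → ℝ := fun y => ‖w₁ y - w₀ y‖ / expWeight k y with hg
  have hg0 : ∀ y, 0 ≤ g y := fun y => div_nonneg (norm_nonneg _) (expWeight_pos k y).le
  have hgψ : ∀ y, ‖w₁ y - w₀ y‖ = g y * expWeight k y := fun y => by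
    rw [hg]; exact (div_mul_cancel₀ _ (expWeight_pos k y).ne').symm
  have hgM : ∀ y, a < y → g y ≤ 2 * M := by
    intro y hy
    rw [hg]
    refine (div_le_iff₀ (expWeight_pos k y)).2 ?_
    linarith [norm_sub_le (w₁ y) (w₀ y), b0 y hy, b1 y hy]
  have hgm : AEStronglyMeasurable g (volume.restrict (Ioi a)) :=
    ((m1.sub m0).norm.aemeasurable.div
      (continuous_expWeight k).measurable.aemeasurable).aestronglyMeasurable
  have hgi : IntegrableOn (fun y => ‖P₀ y‖ * g y) (Ioi a) := by
    refine Integrable.mul_bdd (c := 2 * M) (hP₀ a ha).norm hgm ?_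
    filter_upwards [ae_restrict_mem measurableSet_Ioi] with y hy
    rw [Real.norm_of_nonneg (hg0 y)]
    exact hgM y hy
  have hdi : IntegrableOn (fun y => M * ‖P₁ y - P₀ y‖) (Ioi a) :=
    ((hP₁ a ha).sub (hP₀ a ha)).norm.const_mul M
  have hgen : ∀ {c d : ℂ} {C x : ℝ}, ‖c‖ ≤ C → ‖d‖ ≤ C → a < x →
      ‖∫ y in Ioi x, (c * expSol k x * expSol₂ k y - d * expSol₂ k x * expSol k y) *
        (P₁ y * w₁ y - P₀ y * w₀ y)‖ ≤
      C * expWeight k x * (M * σ + ∫ y in Ioi x, ‖P₀ y‖ / ‖k‖ * g y) := by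
    intro c d C x hc hd hx
    have hC : 0 ≤ C := (norm_nonneg _).trans hc
    have hsub : Ioi x ⊆ Ioi a := Ioi_subset_Ioi hx.le
    have hj := (hdi.mono_set hsub).add (hgi.mono_set hsub)
    have step : ‖∫ y in Ioi x, (c * expSol k x * expSol₂ k y - d * expSol₂ k x * expSol k y) *
        (P₁ y * w₁ y - P₀ y * w₀ y)‖ ≤
        ∫ y in Ioi x, expWeight k x * (C / ‖k‖) * (M * ‖P₁ y - P₀ y‖ + ‖P₀ y‖ * g y) := by
      refine norm_integral_le_of_norm_le (hj.const_mul (expWeight k x * (C / ‖k‖))) ?_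
      filter_upwards [ae_restrict_mem measurableSet_Ioi] with y hy
      have hy' : x < y := hy
      -- The solution w₁ is bounded a priori, so the first term is of size σ and the second feeds
      -- Grönwall's inequality.
      have e : P₁ y * w₁ y - P₀ y * w₀ y = (P₁ y - P₀ y) * w₁ y + P₀ y * (w₁ y - w₀ y) := by ring
      have hf : ‖P₁ y * w₁ y - P₀ y * w₀ y‖ ≤
          expWeight k y * (M * ‖P₁ y - P₀ y‖ + ‖P₀ y‖ * g y) := by
        rw [e]
        refine (norm_add_le _ _).trans ?_
        rw [norm_mul, norm_mul, hgψ]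
        have := mul_le_mul_of_nonneg_left (b1 y (hx.trans hy')) (norm_nonneg (P₁ y - P₀ y))
        nlinarith
      have h5 := norm_exp_kernel_le hk hy'.le hc hd
      have h6 : 0 ≤ M * ‖P₁ y - P₀ y‖ + ‖P₀ y‖ * g y := by
        have := hg0 y
        positivity
      rw [norm_mul]
      calc _ ≤ ‖c * expSol k x * expSol₂ k y - d * expSol₂ k x * expSol k y‖ *
            (expWeight k y * (M * ‖P₁ y - P₀ y‖ + ‖P₀ y‖ * g y)) := by gcongr
        _ = ‖c * expSol k x * expSol₂ k y - d * expSol₂ k x * expSol k y‖ * expWeight k y *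
            (M * ‖P₁ y - P₀ y‖ + ‖P₀ y‖ * g y) := by ring
        _ ≤ _ := by gcongr
    refine step.trans ?_
    rw [integral_const_mul, integral_add (hdi.mono_set hsub) (hgi.mono_set hsub),
      integral_const_mul]
    have e2 : ∫ y in Ioi x, ‖P₀ y‖ / ‖k‖ * g y = (∫ y in Ioi x, ‖P₀ y‖ * g y) / ‖k‖ := by
      rw [← integral_div]; congr 1; ext y; ring
    have e3 : (∫ y in Ioi x, ‖P₁ y - P₀ y‖) / ‖k‖ ≤ σ := by
      refine le_trans ?_ hσ
      gcongr
      exact tail_anti ((hP₁ a ha).sub (hP₀ a ha)).norm (fun _ _ => norm_nonneg _) le_rfl hx.le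
    rw [e2]
    calc expWeight k x * (C / ‖k‖) * (M * (∫ y in Ioi x, ‖P₁ y - P₀ y‖) +
          ∫ y in Ioi x, ‖P₀ y‖ * g y)
        = C * expWeight k x * (M * ((∫ y in Ioi x, ‖P₁ y - P₀ y‖) / ‖k‖) +
          (∫ y in Ioi x, ‖P₀ y‖ * g y) / ‖k‖) := by ring
      _ ≤ _ := by
        have := expWeight_pos k x
        gcongr
  have hlin : ∀ (c d : ℂ) {x : ℝ}, a < x →
      (∫ y in Ioi x, (c * expSol k x * expSol₂ k y - d * expSol₂ k x * expSol k y) *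
        (P₁ y * w₁ y)) - (∫ y in Ioi x, (c * expSol k x * expSol₂ k y -
          d * expSol₂ k x * expSol k y) * (P₀ y * w₀ y)) =
      ∫ y in Ioi x, (c * expSol k x * expSol₂ k y - d * expSol₂ k x * expSol k y) *
        (P₁ y * w₁ y - P₀ y * w₀ y) := by
    intro c d x hx
    have hsub : Ioi x ⊆ Ioi a := Ioi_subset_Ioi hx.le
    have key : ∀ {f : ℝ → ℂ}, IntegrableOn (fun y => expSol k y * f y) (Ioi a) →
        IntegrableOn (fun y => expSol₂ k y * f y) (Ioi a) →
        IntegrableOn (fun y => (c * expSol k x * expSol₂ k y - d * expSol₂ k x * expSol k y) *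
          f y) (Ioi x) := by
      intro f h1 h2
      refine (((h2.mono_set hsub).const_mul (c * expSol k x)).sub
        ((h1.mono_set hsub).const_mul (d * expSol₂ k x))).congr (ae_of_all _ fun y => ?_)
      simp only [Pi.sub_apply]
      ring
    rw [← integral_sub (key i1u i1v) (key i0u i0v)]
    congr 1; ext y; ring
  have hD : ∀ x, a < x → ‖w₁ x - w₀ x‖ ≤
      expWeight k x * (M * σ + ∫ y in Ioi x, ‖P₀ y‖ / ‖k‖ * g y) := by
    intro x hx
    have h := hgen (c := 1) (d := 1) (C := 1) (by simp) (by simp) hx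
    rw [← hlin 1 1 hx] at h
    have e1 := jostSol_eq hk hk0 hP₁ (ha.trans hx)
    have e0 := jostSol_eq hk hk0 hP₀ (ha.trans hx)
    rw [← hw₁] at e1
    rw [← hw₀] at e0
    simp only [one_mul] at h
    refine le_of_eq_of_le ?_ h
    rw [e1, e0, add_sub_add_left_eq_sub]
    simp only [volt, jostK, mul_assoc]
  have hgr : ∀ x, a < x → g x ≤ M * σ + ∫ y in Ioi x, ‖P₀ y‖ / ‖k‖ * g y := by
    intro x hx
    rw [hg]
    refine (div_le_iff₀ (expWeight_pos k x)).2 ?_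
    linarith [hD x hx]
  have hρ : IntegrableOn (fun y => ‖P₀ y‖ / ‖k‖) (Ioi a) := (hP₀ a ha).norm.div_const _
  have htail : ∀ x, a ≤ x → tail (fun y => ‖P₀ y‖ / ‖k‖) x ≤ τ := by
    intro x hx
    refine (tail_anti hρ (fun _ _ => by positivity) le_rfl hx).trans ?_
    rwa [tail, integral_div]
  have hMσ : 0 ≤ M * σ := by positivity
  have hgb : ∀ x, a < x → g x ≤ 4 * Real.exp (4 * τ) * σ := by
    intro x hx
    refine (backward_gronwall hρ (fun _ _ => by positivity) hMσ (fun y _ => hg0 y) hgM hgr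
      hx).trans ?_
    calc 2 * (M * σ) * Real.exp (2 * tail (fun y => ‖P₀ y‖ / ‖k‖) x)
        ≤ 2 * (M * σ) * Real.exp (2 * τ) := by
          gcongr
          exact htail x hx.le
      _ = 4 * (Real.exp (2 * τ) * Real.exp (2 * τ)) * σ := by rw [hM]; ring
      _ = 4 * Real.exp (4 * τ) * σ := by rw [← Real.exp_add]; ring_nf
  have hψ1 := expWeight_le_one hk (ha.trans hx).le
  have hψ0 := expWeight_pos k x
  constructor
  · rw [hgψ]
    exact (mul_le_of_le_one_right (hg0 x) hψ1).trans (hgb x hx)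
  · have h := hgen (c := -k) (d := k) (C := ‖k‖) (by rw [norm_neg]) le_rfl hx
    rw [← hlin (-k) k hx] at h
    have hint : ∫ y in Ioi x, ‖P₀ y‖ / ‖k‖ * g y ≤ τ * (4 * Real.exp (4 * τ) * σ) := by
      calc ∫ y in Ioi x, ‖P₀ y‖ / ‖k‖ * g y
          ≤ ∫ y in Ioi x, ‖P₀ y‖ / ‖k‖ * (4 * Real.exp (4 * τ) * σ) := by
            refine integral_mono_of_nonneg (ae_of_all _ fun y => ?_)
              ((hρ.mono_set (Ioi_subset_Ioi hx.le)).mul_const _) ?_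
            · have := hg0 y
              simp only [Pi.zero_apply]
              positivity
            · filter_upwards [ae_restrict_mem measurableSet_Ioi] with y hy
              exact mul_le_mul_of_nonneg_left (hgb y (hx.trans hy)) (by positivity)
        _ = tail (fun y => ‖P₀ y‖ / ‖k‖) x * (4 * Real.exp (4 * τ) * σ) := by
            rw [integral_mul_const, tail]
        _ ≤ _ := by gcongr; exact htail x hx.le
    have hMle : M ≤ 4 * Real.exp (4 * τ) := by
      have : Real.exp (2 * τ) ≤ Real.exp (4 * τ) := Real.exp_le_exp.2 (by linarith)
      have := Real.exp_pos (4 * τ)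
      rw [hM]; linarith
    rw [jostSolDeriv, jostSolDeriv, add_sub_add_left_eq_sub]
    refine h.trans ?_
    have hI0 : 0 ≤ ∫ y in Ioi x, ‖P₀ y‖ / ‖k‖ * g y :=
      integral_nonneg fun y => mul_nonneg (by positivity) (hg0 y)
    calc ‖k‖ * expWeight k x * (M * σ + ∫ y in Ioi x, ‖P₀ y‖ / ‖k‖ * g y)
        ≤ ‖k‖ * 1 * (4 * Real.exp (4 * τ) * σ + τ * (4 * Real.exp (4 * τ) * σ)) := by gcongr
      _ = _ := by ring

end Compare

/-! ### Estimates in the region `x ≤ 1 / |k|` -/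

/-- Bounds the homogeneous part of variation of constants from X. For x ≤ X and Re m > 0 the growing
solution satisfies x^{1/2+Re m} ≤ X^{2 Re m} x^{1/2-Re m}, and the remaining powers of X cancel. -/
theorem exists_data_bound {m : ℂ} (hm : 0 < m.re) : ∃ C, 0 ≤ C ∧
    ∀ (ε x X : ℝ) (d d' : ℂ), 0 ≤ ε → 0 < x → x ≤ X → ‖d‖ ≤ ε * X ^ (1 / 2 - m.re) →
      ‖d'‖ ≤ ε * (X ^ (1 / 2 - m.re) * X⁻¹) →
      ‖powSol m x * (d * powSol₂Deriv m X - d' * powSol₂ m X) +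
        powSol₂ m x * (d' * powSol m X - d * powSolDeriv m X)‖ ≤
          C * ε * x ^ (1 / 2 - m.re) := by
  obtain ⟨C, hC0, hC⟩ := exists_norm_powSol₂_le m
  have hm0 : m ≠ 0 := fun h => by simp [h] at hm
  simp only [logFactor, hm0, if_false, mul_one] at hC
  refine ⟨C * (4 + ‖1 / 2 - m‖), by positivity, fun ε x X d d' hε hx hxX hd hd' => ?_⟩
  have hX := hx.trans_le hxX
  have hp : X ^ (2 * m.re) * X ^ (1 / 2 - m.re) * X ^ (1 / 2 - m.re) * X⁻¹ = 1 := by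
    rw [(weight_mul_weight hX).1, mul_inv_cancel₀ hX.ne']
  have hφ := Real.rpow_pos_of_pos hx (1 / 2 - m.re)
  have hqx : x ^ (2 * m.re) ≤ X ^ (2 * m.re) := Real.rpow_le_rpow hx.le hxX (by linarith)
  have hux := norm_powSol m hx
  have huX := norm_powSol m hX
  have hu'X := norm_powSolDeriv m hX
  have hvx : ‖powSol₂ m x‖ ≤ C * (X ^ (2 * m.re) * x ^ (1 / 2 - m.re)) :=
    (hC x hx).1.trans (by gcongr)
  obtain ⟨hvX, hv'X⟩ := hC X hX
  set q := X ^ (2 * m.re)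
  set p := X ^ (1 / 2 - m.re)
  set f := x ^ (1 / 2 - m.re)
  have hp0 : 0 < p := Real.rpow_pos_of_pos hX _
  have hq0 : 0 < q := Real.rpow_pos_of_pos hX _
  calc _ ≤ ‖powSol m x‖ * (‖d‖ * ‖powSol₂Deriv m X‖ + ‖d'‖ * ‖powSol₂ m X‖) +
        ‖powSol₂ m x‖ * (‖d'‖ * ‖powSol m X‖ + ‖d‖ * ‖powSolDeriv m X‖) := by
        refine (norm_add_le _ _).trans ?_
        rw [norm_mul, norm_mul (powSol₂ m x)]
        gcongr <;> exact (norm_sub_le _ _).trans_eq (by rw [norm_mul, norm_mul])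
    _ ≤ f * ((ε * p) * (C * (q * p * X⁻¹ * (1 + 1))) + (ε * (p * X⁻¹)) * (C * (q * p))) +
        (C * (q * f)) * ((ε * (p * X⁻¹)) * p + (ε * p) * (‖1 / 2 - m‖ * (p * X⁻¹))) := by
        rw [hux, huX, hu'X]
        gcongr
    _ = C * (4 + ‖1 / 2 - m‖) * ε * f * (q * p * p * X⁻¹) := by ring
    _ = _ := by rw [hp, mul_one]

/-- The case δ = 1 of the kernel bound, admissible because Re m > 0. The limit k → 0 thus needs only
the integrability of y|Q(y)|. -/
theorem exists_kernel_bound {m : ℂ} (hm : 0 < m.re) {a : ℝ} (ha : 0 < a) : ∃ L, 0 ≤ L ∧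
    ∀ x y, a < x → x ≤ y →
      ‖bisolution m x y‖ * y ^ (1 / 2 - m.re) ≤ x ^ (1 / 2 - m.re) * (L * y) := by
  obtain ⟨C, hC0, hC⟩ := exists_bisolution_bound (m := m) le_rfl (by linarith)
  have hm0 : m ≠ 0 := fun h => by simp [h] at hm
  have hl0 := lowFactor_nonneg (δ := 1) ha
  refine ⟨C * lowFactor 1 a * 2, by positivity, fun x y hx hxy => ?_⟩
  have hx0 := ha.trans hx
  have hy0 := hx0.trans_le hxy
  refine ((hC x y hx0 hxy).1).trans ?_
  have hl := lowFactor_anti (δ := 1) le_rfl ha hx.le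
  have hφ := Real.rpow_pos_of_pos hx0 (1 / 2 - m.re)
  simp only [potWeight, logFactor, hm0, if_false, Real.rpow_one]
  calc _ ≤ x ^ (1 / 2 - m.re) * (C * lowFactor 1 a * (y * (1 + 1))) := by gcongr
    _ = _ := by ring

/-- A backward Grönwall inequality with a variable inhomogeneity. -/
theorem backward_gronwall_inhomogeneous {ρ h η : ℝ → ℝ} {a M : ℝ} (hρ : IntegrableOn ρ (Ioi a))
    (h0 : ∀ x, a < x → 0 ≤ ρ x) (hh0 : ∀ x, a < x → 0 ≤ h x) (hhM : ∀ x, a < x → h x ≤ M)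
    (hhm : AEStronglyMeasurable h (volume.restrict (Ioi a))) (hη0 : ∀ x, a < x → 0 ≤ η x)
    (hη : IntegrableOn (fun y => ρ y * η y) (Ioi a))
    (hle : ∀ x, a < x → h x ≤ η x + ∫ y in Ioi x, ρ y * h y) {x : ℝ} (hx : a < x) :
    h x ≤ η x + 2 * (∫ y in Ioi a, ρ y * η y) * Real.exp (2 * tail ρ a) := by
  have hρh : IntegrableOn (fun y => ρ y * h y) (Ioi a) := by
    refine Integrable.mul_bdd (c := M) hρ hhm ?_
    filter_upwards [ae_restrict_mem measurableSet_Ioi] with y hy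
    rw [Real.norm_of_nonneg (hh0 y hy)]
    exact hhM y hy
  have hρh0 : ∀ y, a < y → 0 ≤ ρ y * h y := fun y hy => mul_nonneg (h0 y hy) (hh0 y hy)
  -- Grönwall's inequality is applied to this tail, so that η enters only through its ρ-integral and
  -- its value at x, not through a supremum.
  set T := tail (fun y => ρ y * h y) with hT
  have hT0 : ∀ y, a < y → 0 ≤ T y := fun y hy => tail_nonneg hρh0 hy.le
  have hTle : ∀ y, a < y → T y ≤ T a := fun y hy => tail_anti hρh hρh0 le_rfl hy.le
  have hanti : AntitoneOn T (Ioi a) := fun s hs t _ hst =>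
    tail_anti hρh hρh0 (le_of_lt hs) hst
  have hρT : IntegrableOn (fun y => ρ y * T y) (Ioi a) := by
    refine Integrable.mul_bdd (c := T a) hρ
      (aemeasurable_restrict_of_antitoneOn measurableSet_Ioi hanti).aestronglyMeasurable ?_
    filter_upwards [ae_restrict_mem measurableSet_Ioi] with y hy
    rw [Real.norm_of_nonneg (hT0 y hy)]
    exact hTle y hy
  have hA : 0 ≤ ∫ y in Ioi a, ρ y * η y :=
    setIntegral_nonneg measurableSet_Ioi fun y hy => mul_nonneg (h0 y hy) (hη0 y hy)
  have hTgr : ∀ y, a < y → T y ≤ (∫ y in Ioi a, ρ y * η y) + ∫ t in Ioi y, ρ t * T t := by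
    intro y hy
    have hsub : Ioi y ⊆ Ioi a := Ioi_subset_Ioi hy.le
    calc T y ≤ ∫ t in Ioi y, (ρ t * η t + ρ t * T t) := by
          refine setIntegral_mono_on (hρh.mono_set hsub)
            ((hη.mono_set hsub).add (hρT.mono_set hsub)) measurableSet_Ioi fun t ht => ?_
          have h1 := mul_le_mul_of_nonneg_left (hle t (hy.trans ht)) (h0 t (hy.trans ht))
          rw [hT, tail]
          linarith
      _ = (∫ t in Ioi y, ρ t * η t) + ∫ t in Ioi y, ρ t * T t :=
          integral_add (hη.mono_set hsub) (hρT.mono_set hsub)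
      _ ≤ _ := by
          refine add_le_add ?_ le_rfl
          exact setIntegral_mono_set hη ((ae_restrict_iff' measurableSet_Ioi).2
            (ae_of_all _ fun t ht => mul_nonneg (h0 t ht) (hη0 t ht))) hsub.eventuallyLE
  have hfin := backward_gronwall hρ h0 hA hT0 hTle hTgr hx
  have hexp : Real.exp (2 * tail ρ x) ≤ Real.exp (2 * tail ρ a) :=
    Real.exp_le_exp.2 (by linarith [tail_anti hρ h0 le_rfl hx.le])
  calc h x ≤ η x + T x := hle x hx
    _ ≤ η x + 2 * (∫ y in Ioi a, ρ y * η y) * Real.exp (2 * tail ρ x) := by gcongr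
    _ ≤ _ := by gcongr

theorem intervalIntegral_eq_indicator {F : ℝ → ℂ} {x X : ℝ} (h : x ≤ X) :
    ∫ y in x..X, F y = ∫ y in Ioi x, (Iic X).indicator F y := by
  rw [setIntegral_indicator measurableSet_Iic, Ioi_inter_Iic, intervalIntegral.integral_of_le h]

theorem integral_indicator_const_le {x Y c : ℝ} (hx : 0 ≤ x) (hY : 0 ≤ Y) (hc : 0 ≤ c) :
    ∫ y in Ioi x, (Iic Y).indicator (fun _ => c) y ≤ c * Y := by
  rw [setIntegral_indicator measurableSet_Iic, Ioi_inter_Iic, setIntegral_const,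
    Real.volume_real_Ioc, smul_eq_mul, mul_comm]
  gcongr
  exact max_le (by linarith) hY

theorem integrableOn_indicator_const (x Y c : ℝ) :
    IntegrableOn ((Iic Y).indicator fun _ => c) (Ioi x) := by
  rw [integrableOn_indicator_iff measurableSet_Iic, inter_comm, Ioi_inter_Iic]
  exact integrableOn_const (by simp)

/-- The size of `f` relative to `x^{1/2 - Re m}` on `]0,X]`, extended by zero. -/
def relSize (m : ℂ) (X : ℝ) (f : ℝ → ℂ) : ℝ → ℝ :=
  (Iic X).indicator fun y => ‖f y‖ / y ^ (1 / 2 - m.re)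

section RelSize

variable {m : ℂ} {X : ℝ} {f : ℝ → ℂ}

theorem relSize_of_le {y : ℝ} (hy : y ≤ X) : relSize m X f y = ‖f y‖ / y ^ (1 / 2 - m.re) :=
  indicator_of_mem (show y ∈ Iic X from hy) _

theorem relSize_of_gt {y : ℝ} (hy : X < y) : relSize m X f y = 0 :=
  indicator_of_notMem (show y ∉ Iic X from not_le.2 hy) _

theorem relSize_nonneg {y : ℝ} (hy : 0 < y) : 0 ≤ relSize m X f y := by
  rcases le_or_gt y X with h | h
  · rw [relSize_of_le h]; positivity
  · rw [relSize_of_gt h]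

theorem norm_eq_relSize {y : ℝ} (hy : 0 < y) (hyX : y ≤ X) :
    ‖f y‖ = relSize m X f y * y ^ (1 / 2 - m.re) := by
  rw [relSize_of_le hyX, div_mul_cancel₀ _ (Real.rpow_pos_of_pos hy _).ne']

theorem relSize_le {y M : ℝ} (hM : 0 ≤ M) (hy : 0 < y)
    (h : y ≤ X → ‖f y‖ ≤ M * y ^ (1 / 2 - m.re)) : relSize m X f y ≤ M := by
  rcases le_or_gt y X with hX | hX
  · rw [relSize_of_le hX]
    exact (div_le_iff₀ (Real.rpow_pos_of_pos hy _)).2 (h hX)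
  · rwa [relSize_of_gt hX]

theorem aestronglyMeasurable_relSize {a : ℝ} (ha : 0 ≤ a) (hf : ContinuousOn f (Ioi 0)) :
    AEStronglyMeasurable (relSize m X f) (volume.restrict (Ioi a)) := by
  have hs : Ioi a ⊆ Ioi 0 := Ioi_subset_Ioi ha
  exact (ContinuousOn.aestronglyMeasurable ((hf.mono hs).norm.div ((continuousOn_rpow _).mono hs)
    fun x hx => (Real.rpow_pos_of_pos (hs hx) _).ne') measurableSet_Ioi).indicator
      measurableSet_Iic

theorem exists_relSize_le {a : ℝ} (ha : 0 < a) (X : ℝ) (hf : ContinuousOn f (Ioi 0)) :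
    ∃ M, ∀ y, a < y → relSize m X f y ≤ M := by
  have hs : Icc a X ⊆ Ioi 0 := fun y hy => ha.trans_le hy.1
  obtain ⟨M, hM⟩ := isCompact_Icc.exists_bound_of_continuousOn
    ((hf.mono hs).norm.div ((continuousOn_rpow (1 / 2 - m.re)).mono hs)
      fun x hx => (Real.rpow_pos_of_pos (hs hx) _).ne')
  refine ⟨max M 0, fun y hy => ?_⟩
  rcases le_or_gt y X with hX | hX
  · rw [relSize_of_le hX]
    exact ((le_abs_self _).trans (hM y ⟨hy.le, hX⟩)).trans (le_max_left _ _)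
  · rw [relSize_of_gt hX]
    exact le_max_right _ _

end RelSize

/-- The perturbation `d` of an approximate solution `v₀` on `]a,X]`, with small data at `X`. -/
structure InnerProblem (m κ : ℂ) (Q d d' v₀ : ℝ → ℂ) (a X L C₁ C₀ ε : ℝ) : Prop where
  pos : 0 < a
  lt : a < X
  nonneg_L : 0 ≤ L
  nonneg_C₁ : 0 ≤ C₁
  nonneg_C₀ : 0 ≤ C₀
  nonneg_ε : 0 ≤ ε
  integrable : IntegrableOn (fun y => y * ‖Q y‖) (Ioi a)
  kernel : ∀ x y, a < x → x ≤ y →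
    ‖bisolution m x y‖ * y ^ (1 / 2 - m.re) ≤ x ^ (1 / 2 - m.re) * (L * y)
  data : ∀ x, 0 < x → x ≤ X → ‖powSol m x * (d X * powSol₂Deriv m X - d' X * powSol₂ m X) +
      powSol₂ m x * (d' X * powSol m X - d X * powSolDeriv m X)‖ ≤ C₁ * ε * x ^ (1 / 2 - m.re)
  energy : ‖κ‖ * X ^ 2 ≤ 1
  ode : SecondPrimitive d d' fun t : ℝ =>
    (m ^ 2 - 1 / 4) / (t : ℂ) ^ 2 * d t + (κ * d t + Q t * (d t + v₀ t))
  continuousOn : ContinuousOn v₀ (Ioi 0)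
  bound : ∀ x, a < x → x ≤ X → ‖v₀ x‖ ≤ C₀ * x ^ (1 / 2 - m.re)

namespace InnerProblem

variable {m κ : ℂ} {Q d d' v₀ : ℝ → ℂ} {a X L C₁ C₀ ε : ℝ}

theorem norm_kernel_mul_le (I : InnerProblem m κ Q d d' v₀ a X L C₁ C₀ ε) {x y c : ℝ} {z : ℂ}
    (hx : a < x) (hxy : x ≤ y) (hz : ‖z‖ ≤ c * y ^ (1 / 2 - m.re)) (hc : 0 ≤ c) :
    ‖bisolution m x y * z‖ ≤ x ^ (1 / 2 - m.re) * (L * y * c) := by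
  rw [norm_mul]
  calc ‖bisolution m x y‖ * ‖z‖ ≤ ‖bisolution m x y‖ * (c * y ^ (1 / 2 - m.re)) := by gcongr
    _ = (‖bisolution m x y‖ * y ^ (1 / 2 - m.re)) * c := by ring
    _ ≤ (x ^ (1 / 2 - m.re) * (L * y)) * c := mul_le_mul_of_nonneg_right (I.kernel x y hx hxy) hc
    _ = _ := by ring

/-- The derivation of the integral equation from the data at `X`. -/
theorem eq_data_add_integral (I : InnerProblem m κ Q d d' v₀ a X L C₁ C₀ ε) {x : ℝ}
    (hx : a < x) :
    d x = powSol m x * (d X * powSol₂Deriv m X - d' X * powSol₂ m X) +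
      powSol₂ m x * (d' X * powSol m X - d X * powSolDeriv m X) +
      ∫ y in x..X, bisolution m x y * (κ * d y + Q y * (d y + v₀ y)) := by
  simp only [bisolution_eq]
  exact (fundPair_zero m).variation_of_constants I.ode (I.pos.trans hx) (I.pos.trans I.lt)

/-- The energy adds the density ‖κ‖X on ]0,X], whose mass is at most ‖κ‖X² ≤ 1; this is the 1 in the
exponent. The endpoint b is left free: b = a gives a uniform bound, and a large b gives smallness
through the tail of y|Q(y)| from b. -/
theorem norm_le_of_data (I : InnerProblem m κ Q d d' v₀ a X L C₁ C₀ ε) {b x : ℝ} (hb : a ≤ b)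
    (hx : b < x) (hxX : x ≤ X) :
    ‖d x‖ ≤ 2 * (C₁ * ε + L * C₀ * tail (fun y => y * ‖Q y‖) b) *
      Real.exp (2 * (L * (1 + tail (fun y => y * ‖Q y‖) a))) * x ^ (1 / 2 - m.re) := by
  have hb0 := I.pos.trans_le hb
  have hX0 := I.pos.trans I.lt
  have hL := I.nonneg_L
  have hC₀ := I.nonneg_C₀
  have hκ0 := norm_nonneg κ
  have hsubb : Ioi b ⊆ Ioi a := Ioi_subset_Ioi hb
  have hQi := I.integrable.mono_set hsubb
  have hQ0 : ∀ y, a < y → 0 ≤ y * ‖Q y‖ := fun y hy =>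
    mul_nonneg (I.pos.trans hy).le (norm_nonneg _)
  set g := relSize m X d with hg
  obtain ⟨M, hM⟩ := exists_relSize_le I.pos X (m := m) I.ode.continuousOn
  have hg0 : ∀ y, b < y → 0 ≤ g y := fun y hy => relSize_nonneg (hb0.trans hy)
  have hgm : AEStronglyMeasurable g (volume.restrict (Ioi b)) :=
    aestronglyMeasurable_relSize hb0.le I.ode.continuousOn
  set ρ : ℝ → ℝ := fun y => L * ((Iic X).indicator (fun _ => ‖κ‖ * X) y + y * ‖Q y‖) with hρ
  have hind0 : ∀ y, 0 ≤ (Iic X).indicator (fun _ => ‖κ‖ * X) y := fun y =>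
    indicator_nonneg (fun _ _ => by positivity) y
  have hρ0 : ∀ y, b < y → 0 ≤ ρ y := fun y hy =>
    mul_nonneg hL (add_nonneg (hind0 y) (hQ0 y (hsubb hy)))
  have hρi : IntegrableOn ρ (Ioi b) :=
    ((integrableOn_indicator_const b X _).add hQi).const_mul L
  have hρg : IntegrableOn (fun y => ρ y * g y) (Ioi b) := by
    refine Integrable.mul_bdd (c := M) hρi hgm ?_
    filter_upwards [ae_restrict_mem measurableSet_Ioi] with y hy
    rw [Real.norm_of_nonneg (hg0 y hy)]
    exact hM y (hsubb hy)
  set A := C₁ * ε + L * C₀ * tail (fun y => y * ‖Q y‖) b with hA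
  have hA0 : 0 ≤ A := add_nonneg (mul_nonneg I.nonneg_C₁ I.nonneg_ε)
    (mul_nonneg (mul_nonneg hL hC₀) (tail_nonneg hQ0 hb))
  have hgr : ∀ t, b < t → g t ≤ A + ∫ y in Ioi t, ρ y * g y := by
    intro t ht
    have ht0 := hb0.trans ht
    have hsub : Ioi t ⊆ Ioi b := Ioi_subset_Ioi ht.le
    have hφ := Real.rpow_pos_of_pos ht0 (1 / 2 - m.re)
    have hI0 : 0 ≤ ∫ y in Ioi t, ρ y * g y := setIntegral_nonneg measurableSet_Ioi
      fun y hy => mul_nonneg (hρ0 y (hsub hy)) (hg0 y (hsub hy))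
    rcases le_or_gt t X with htX | htX
    swap
    · rw [hg, relSize_of_gt htX]
      positivity
    have hmaj : IntegrableOn (fun y => t ^ (1 / 2 - m.re) *
        (ρ y * g y + L * C₀ * (y * ‖Q y‖))) (Ioi t) :=
      ((hρg.mono_set hsub).add ((hQi.mono_set hsub).const_mul (L * C₀))).const_mul _
    have hint : ‖∫ y in t..X, bisolution m t y * (κ * d y + Q y * (d y + v₀ y))‖ ≤
        t ^ (1 / 2 - m.re) * ((∫ y in Ioi t, ρ y * g y) +
          L * C₀ * tail (fun y => y * ‖Q y‖) t) := by
      rw [tail, ← integral_const_mul, ← integral_add (hρg.mono_set hsub)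
        ((hQi.mono_set hsub).const_mul (L * C₀)), ← integral_const_mul,
        intervalIntegral_eq_indicator htX]
      refine norm_integral_le_of_norm_le hmaj ?_
      filter_upwards [ae_restrict_mem measurableSet_Ioi] with y hy
      have hty : t < y := hy
      have hy0 := ht0.trans hty
      have hgy := hg0 y (hsub hy)
      have hφy := Real.rpow_pos_of_pos hy0 (1 / 2 - m.re)
      by_cases hyX : y ≤ X
      · rw [indicator_of_mem (show y ∈ Iic X from hyX)]
        have hz : ‖κ * d y + Q y * (d y + v₀ y)‖ ≤
            (‖κ‖ * g y + ‖Q y‖ * (g y + C₀)) * y ^ (1 / 2 - m.re) := by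
          have e1 := norm_eq_relSize (m := m) (f := d) hy0 hyX
          have e2 := I.bound y (hsubb (hsub hy)) hyX
          calc _ ≤ ‖κ‖ * ‖d y‖ + ‖Q y‖ * (‖d y‖ + ‖v₀ y‖) := by
                refine (norm_add_le _ _).trans ?_
                rw [norm_mul, norm_mul]
                gcongr
                exact norm_add_le _ _
            _ ≤ ‖κ‖ * (g y * y ^ (1 / 2 - m.re)) + ‖Q y‖ * (g y * y ^ (1 / 2 - m.re) +
                  C₀ * y ^ (1 / 2 - m.re)) := by
                rw [e1]
                gcongr
            _ = _ := by ring
        refine (I.norm_kernel_mul_le (hb.trans_lt ht) hty.le hz (by positivity)).trans ?_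
        refine mul_le_mul_of_nonneg_left ?_ hφ.le
        have hρy : ρ y = L * (‖κ‖ * X + y * ‖Q y‖) := by
          rw [hρ]
          simp only
          rw [indicator_of_mem (show y ∈ Iic X from hyX)]
        rw [hρy]
        have h1 : ‖κ‖ * g y * y ≤ ‖κ‖ * g y * X := by gcongr
        nlinarith [mul_le_mul_of_nonneg_left h1 hL]
      · rw [indicator_of_notMem (show y ∉ Iic X from hyX), norm_zero]
        have := hρ0 y (hsub hy)
        positivity
    have hdt := I.eq_data_add_integral (hb.trans_lt ht)
    have hdata := I.data t ht0 htX
    have htail : tail (fun y => y * ‖Q y‖) t ≤ tail (fun y => y * ‖Q y‖) b :=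
      tail_anti I.integrable hQ0 hb ht.le
    have hfin : ‖d t‖ ≤ (A + ∫ y in Ioi t, ρ y * g y) * t ^ (1 / 2 - m.re) := by
      rw [hdt]
      refine (norm_add_le _ _).trans ((add_le_add hdata hint).trans ?_)
      have h3 : L * C₀ * tail (fun y => y * ‖Q y‖) t ≤ L * C₀ * tail (fun y => y * ‖Q y‖) b := by
        gcongr
      rw [hA]
      nlinarith [mul_le_mul_of_nonneg_left h3 hφ.le]
    rw [hg, relSize_of_le htX]
    exact (div_le_iff₀ hφ).2 hfin
  have hres := backward_gronwall hρi hρ0 hA0 hg0 (fun y hy => hM y (hsubb hy)) hgr hx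
  have htail : tail ρ x ≤ L * (1 + tail (fun y => y * ‖Q y‖) a) := by
    have hsub : Ioi x ⊆ Ioi b := Ioi_subset_Ioi hx.le
    rw [tail, hρ, integral_const_mul, integral_add
      (integrableOn_indicator_const x X _) (hQi.mono_set hsub)]
    refine mul_le_mul_of_nonneg_left (add_le_add ?_ ?_) hL
    · refine (integral_indicator_const_le (hb0.trans hx).le hX0.le (by positivity)).trans ?_
      have := I.energy
      nlinarith
    · exact tail_anti I.integrable hQ0 le_rfl (hb.trans hx.le)
  have hφ := Real.rpow_pos_of_pos (hb0.trans hx) (1 / 2 - m.re)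
  rw [norm_eq_relSize (m := m) (f := d) (hb0.trans hx) hxX]
  refine mul_le_mul_of_nonneg_right (hres.trans ?_) hφ.le
  gcongr

end InnerProblem

/-! ### The zero-energy limit of the renormalized Jost solutions -/

namespace InnerProblem

variable {m κ γ : ℂ} {δ : ℝ} {Q d d' v₀ : ℝ → ℂ} {a X L C₁ C₀ ε Y B₁ B₂ Mq : ℝ}

/-- The integral equation of the error `d + v₀ - γ q`. -/
theorem error_eq (I : InnerProblem m κ Q d d' v₀ a X L C₁ C₀ ε) (H : PotAssumption m δ Q)
    {x : ℝ} (hx : a < x) :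
    d x + v₀ x - γ * zeroSol m Q x =
      (powSol m x * (d X * powSol₂Deriv m X - d' X * powSol₂ m X) +
        powSol₂ m x * (d' X * powSol m X - d X * powSolDeriv m X)) +
      (v₀ x - γ * powSol m x) - (∫ y in Ioi X, bisolution m x y * (γ * (Q y * zeroSol m Q y))) +
      ∫ y in x..X, bisolution m x y * (κ * d y + Q y * (d y + v₀ y - γ * zeroSol m Q y)) := by
  have F := fundPair_zero m
  have hx0 := I.pos.trans hx
  have hX0 := I.pos.trans I.lt
  have hG : ContinuousOn (bisolution m x) (Ioi 0) := by
    rw [show bisolution m x = fun y => powSol m x * powSol₂ m y - powSol₂ m x * powSol m y from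
      funext fun y => bisolution_eq m x y]
    exact (continuousOn_const.mul F.continuousOn_v).sub (continuousOn_const.mul F.continuousOn_u)
  have hsub : uIcc x X ⊆ Ioi 0 := fun _ ht => pos_of_mem_uIcc hx0 hX0 ht
  have i1 : IntervalIntegrable (fun y => bisolution m x y * (κ * d y + Q y * (d y + v₀ y)))
      volume x X := by
    have hVd : IntervalIntegrable (fun t : ℝ => (m ^ 2 - 1 / 4) / (t : ℂ) ^ 2 * d t) volume x X :=
      ((F.continuousOn.mul I.ode.continuousOn).mono hsub).intervalIntegrable
    have hh : IntervalIntegrable (fun y => κ * d y + Q y * (d y + v₀ y)) volume x X := by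
      simpa using (I.ode.intervalIntegrable x X hx0 hX0).sub hVd
    exact hh.continuousOn_mul (hG.mono hsub)
  have hq : ∀ t, a < t → IntegrableOn (fun y => bisolution m x y * (Q y * zeroSol m Q y))
      (Ioi t) := by
    intro t ht
    obtain ⟨M, hM, hb⟩ := H.exists_zeroSol_bound I.pos
    obtain ⟨h1, h2⟩ := H.integrableOn_solutions I.pos hM (H.aestronglyMeasurable_zeroSol I.pos) hb
    have hs : Ioi t ⊆ Ioi a := Ioi_subset_Ioi ht.le
    refine (((h2.mono_set hs).const_mul (powSol m x)).sub
      ((h1.mono_set hs).const_mul (powSol₂ m x))).congr (ae_of_all _ fun y => ?_)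
    simp only [Pi.sub_apply, bisolution_eq]
    ring
  have hqc := H.secondPrimitive_zeroSol.continuousOn
  have i2 : IntervalIntegrable (fun y => bisolution m x y * (Q y * zeroSol m Q y)) volume x X :=
    ((intervalIntegrable_of_locallyIntegrableOn H.locallyIntegrable hx0 hX0).mul_continuousOn
      (hqc.mono hsub)).continuousOn_mul (hG.mono hsub)
  have e1 := I.eq_data_add_integral hx
  have e2 := H.zeroSol_eq hx0
  have e3 : volt (greenK m Q) (zeroSol m Q) x =
      ∫ y in Ioi x, bisolution m x y * (Q y * zeroSol m Q y) := by
    simp only [volt, greenK, mul_assoc]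
  have e4 := intervalIntegral.integral_interval_add_Ioi (hq x hx) (hq X I.lt)
  have e5 : ∫ y in Ioi X, bisolution m x y * (γ * (Q y * zeroSol m Q y)) =
      γ * ∫ y in Ioi X, bisolution m x y * (Q y * zeroSol m Q y) := by
    rw [← integral_const_mul]; congr 1; ext y; ring
  have e6 : ∫ y in x..X, bisolution m x y * (κ * d y + Q y * (d y + v₀ y - γ * zeroSol m Q y)) =
      (∫ y in x..X, bisolution m x y * (κ * d y + Q y * (d y + v₀ y))) -
        γ * ∫ y in x..X, bisolution m x y * (Q y * zeroSol m Q y) := by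
    rw [← intervalIntegral.integral_const_mul,
      ← intervalIntegral.integral_sub i1 (i2.const_mul γ)]
    congr 1; ext y; ring
  rw [e5, e6]
  linear_combination e1 - γ * e2 - γ * e3 + γ * e4

theorem continuousOn_error (I : InnerProblem m κ Q d d' v₀ a X L C₁ C₀ ε)
    (H : PotAssumption m δ Q) :
    ContinuousOn (fun y => d y + v₀ y - γ * zeroSol m Q y) (Ioi 0) :=
  (I.ode.continuousOn.add I.continuousOn).sub
    (continuousOn_const.mul H.secondPrimitive_zeroSol.continuousOn)

/-- The energy term, estimated at once on ]x,X], would be bounded but not small. It is split at Y: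
below Y the bound B₁ meets the small mass ‖κ‖Y², and above Y the bounded mass ‖κ‖X² meets the small
bound B₂. -/
theorem relSize_error_le (I : InnerProblem m κ Q d d' v₀ a X L C₁ C₀ ε) (H : PotAssumption m δ Q)
    (hMq0 : 0 ≤ Mq) (hMq : ∀ y, a < y → ‖zeroSol m Q y‖ ≤ Mq * y ^ (1 / 2 - m.re))
    (hY : a ≤ Y) (hB₁0 : 0 ≤ B₁) (hB₂0 : 0 ≤ B₂)
    (hB₁ : ∀ y, a < y → y ≤ X → ‖d y‖ ≤ B₁ * y ^ (1 / 2 - m.re))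
    (hB₂ : ∀ y, Y < y → y ≤ X → ‖d y‖ ≤ B₂ * y ^ (1 / 2 - m.re)) {x : ℝ} (hx : a < x) :
    relSize m X (fun y => d y + v₀ y - γ * zeroSol m Q y) x ≤
      (C₁ * ε + L * (‖κ‖ * Y ^ 2 * B₁ + B₂) + L * (‖γ‖ * Mq) * tail (fun y => y * ‖Q y‖) X +
        relSize m X (fun y => v₀ y - γ * powSol m y) x) +
      ∫ y in Ioi x, L * (y * ‖Q y‖) *
        relSize m X (fun y => d y + v₀ y - γ * zeroSol m Q y) y := by
  have hx0 := I.pos.trans hx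
  have hX0 := I.pos.trans I.lt
  have hY0 := I.pos.trans_le hY
  have hL := I.nonneg_L
  have hκ0 := norm_nonneg κ
  have hQ0 : ∀ y, a < y → 0 ≤ y * ‖Q y‖ := fun y hy =>
    mul_nonneg (I.pos.trans hy).le (norm_nonneg _)
  have hφ := Real.rpow_pos_of_pos hx0 (1 / 2 - m.re)
  have hC₁ε : 0 ≤ C₁ * ε := mul_nonneg I.nonneg_C₁ I.nonneg_ε
  have hT0 : 0 ≤ tail (fun y => y * ‖Q y‖) X := tail_nonneg hQ0 I.lt.le
  set e : ℝ → ℂ := fun y => d y + v₀ y - γ * zeroSol m Q y with he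
  have hec : ContinuousOn e (Ioi 0) := I.continuousOn_error H
  set h := relSize m X e with hh
  have hh0 : ∀ y, a < y → 0 ≤ h y := fun y hy => relSize_nonneg (I.pos.trans hy)
  have hsub : Ioi x ⊆ Ioi a := Ioi_subset_Ioi hx.le
  have hI0 : 0 ≤ ∫ y in Ioi x, L * (y * ‖Q y‖) * h y := setIntegral_nonneg measurableSet_Ioi
    fun y hy => mul_nonneg (mul_nonneg hL (hQ0 y (hsub hy))) (hh0 y (hsub hy))
  rcases le_or_gt x X with hxX | hxX
  swap
  · rw [hh, relSize_of_gt hxX, relSize_of_gt hxX]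
    positivity
  obtain ⟨M, hM⟩ := exists_relSize_le I.pos X (m := m) hec
  have hQhi : IntegrableOn (fun y => L * (y * ‖Q y‖) * h y) (Ioi x) := by
    refine Integrable.mul_bdd (c := M) ((I.integrable.mono_set hsub).const_mul L)
      (aestronglyMeasurable_relSize hx0.le hec) ?_
    filter_upwards [ae_restrict_mem measurableSet_Ioi] with y hy
    rw [Real.norm_of_nonneg (hh0 y (hsub hy))]
    exact hM y (hsub hy)
  have j1 := integrableOn_indicator_const x Y (‖κ‖ * Y * B₁)
  have j2 := integrableOn_indicator_const x X (‖κ‖ * X * B₂)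
  have k1 : ∀ y, 0 ≤ (Iic Y).indicator (fun _ => ‖κ‖ * Y * B₁) y := fun y =>
    indicator_nonneg (fun _ _ => by positivity) y
  have k2 : ∀ y, 0 ≤ (Iic X).indicator (fun _ => ‖κ‖ * X * B₂) y := fun y =>
    indicator_nonneg (fun _ _ => by positivity) y
  have hint : ‖∫ y in x..X, bisolution m x y * (κ * d y + Q y * e y)‖ ≤
      x ^ (1 / 2 - m.re) * (L * (‖κ‖ * Y ^ 2 * B₁ + B₂) +
        ∫ y in Ioi x, L * (y * ‖Q y‖) * h y) := by
    have step : ‖∫ y in x..X, bisolution m x y * (κ * d y + Q y * e y)‖ ≤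
        ∫ y in Ioi x, x ^ (1 / 2 - m.re) * (L * ((Iic Y).indicator (fun _ => ‖κ‖ * Y * B₁) y +
          (Iic X).indicator (fun _ => ‖κ‖ * X * B₂) y) + L * (y * ‖Q y‖) * h y) := by
      rw [intervalIntegral_eq_indicator hxX]
      refine norm_integral_le_of_norm_le ((((j1.add j2).const_mul L).add hQhi).const_mul _) ?_
      filter_upwards [ae_restrict_mem measurableSet_Ioi] with y hy
      have hxy : x < y := hy
      have hy0 := hx0.trans hxy
      have hhy := hh0 y (hsub hy)
      by_cases hyX : y ≤ X
      · rw [indicator_of_mem (show y ∈ Iic X from hyX)]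
        have hey : ‖e y‖ = h y * y ^ (1 / 2 - m.re) := norm_eq_relSize hy0 hyX
        have gen : ∀ B, 0 ≤ B → ‖d y‖ ≤ B * y ^ (1 / 2 - m.re) → ‖κ‖ * y * B ≤
            (Iic Y).indicator (fun _ => ‖κ‖ * Y * B₁) y +
              (Iic X).indicator (fun _ => ‖κ‖ * X * B₂) y →
            ‖bisolution m x y * (κ * d y + Q y * e y)‖ ≤ x ^ (1 / 2 - m.re) *
              (L * ((Iic Y).indicator (fun _ => ‖κ‖ * Y * B₁) y +
                (Iic X).indicator (fun _ => ‖κ‖ * X * B₂) y) + L * (y * ‖Q y‖) * h y) := by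
          intro B hB hdB hB'
          have hz : ‖κ * d y + Q y * e y‖ ≤ (‖κ‖ * B + ‖Q y‖ * h y) * y ^ (1 / 2 - m.re) := by
            refine (norm_add_le _ _).trans ?_
            rw [norm_mul, norm_mul, hey]
            nlinarith [mul_le_mul_of_nonneg_left hdB hκ0]
          refine (I.norm_kernel_mul_le hx hxy.le hz (by positivity)).trans ?_
          refine mul_le_mul_of_nonneg_left ?_ hφ.le
          nlinarith [mul_le_mul_of_nonneg_left hB' hL]
        by_cases hyY : y ≤ Y
        · refine gen B₁ hB₁0 (hB₁ y (hsub hy) hyX) ?_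
          rw [indicator_of_mem (show y ∈ Iic Y from hyY)]
          have := k2 y
          have : ‖κ‖ * y * B₁ ≤ ‖κ‖ * Y * B₁ := by gcongr
          linarith
        · refine gen B₂ hB₂0 (hB₂ y (not_le.1 hyY) hyX) ?_
          rw [indicator_of_mem (show y ∈ Iic X from hyX)]
          have := k1 y
          have : ‖κ‖ * y * B₂ ≤ ‖κ‖ * X * B₂ := by gcongr
          linarith
      · rw [indicator_of_notMem (show y ∉ Iic X from hyX), norm_zero]
        have h3 := hQ0 y (hsub hy)
        have := k1 y
        have := k2 y
        exact mul_nonneg hφ.le (add_nonneg (mul_nonneg hL (by linarith))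
          (mul_nonneg (mul_nonneg hL h3) hhy))
    refine step.trans ?_
    have j3 : IntegrableOn (fun y => L * ((Iic Y).indicator (fun _ => ‖κ‖ * Y * B₁) y +
        (Iic X).indicator (fun _ => ‖κ‖ * X * B₂) y)) (Ioi x) := (j1.add j2).const_mul L
    rw [integral_const_mul, integral_add j3 hQhi, integral_const_mul, integral_add j1 j2]
    have b1 := integral_indicator_const_le (c := ‖κ‖ * Y * B₁) hx0.le hY0.le (by positivity)
    have b2 := integral_indicator_const_le (c := ‖κ‖ * X * B₂) hx0.le hX0.le (by positivity)
    have b3 : ‖κ‖ * X * B₂ * X ≤ B₂ := by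
      have := mul_le_mul_of_nonneg_right I.energy hB₂0
      nlinarith
    gcongr
    · exact b1.trans_eq (by ring)
    · exact b2.trans b3
  have hq : ‖∫ y in Ioi X, bisolution m x y * (γ * (Q y * zeroSol m Q y))‖ ≤
      x ^ (1 / 2 - m.re) * (L * (‖γ‖ * Mq) * tail (fun y => y * ‖Q y‖) X) := by
    rw [tail, ← mul_assoc, ← integral_const_mul]
    have hsX : Ioi X ⊆ Ioi a := Ioi_subset_Ioi I.lt.le
    refine norm_integral_le_of_norm_le ((I.integrable.mono_set hsX).const_mul _) ?_
    filter_upwards [ae_restrict_mem measurableSet_Ioi] with y hy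
    have hXy : X < y := hy
    have hz : ‖γ * (Q y * zeroSol m Q y)‖ ≤ (‖γ‖ * Mq * ‖Q y‖) * y ^ (1 / 2 - m.re) := by
      rw [norm_mul, norm_mul]
      calc ‖γ‖ * (‖Q y‖ * ‖zeroSol m Q y‖)
          ≤ ‖γ‖ * (‖Q y‖ * (Mq * y ^ (1 / 2 - m.re))) := by gcongr; exact hMq y (hsX hy)
        _ = _ := by ring
    exact (I.norm_kernel_mul_le hx (hxX.trans hXy.le) hz (by positivity)).trans_eq (by ring)
  have hdata := I.data x hx0 hxX
  have hv := norm_eq_relSize (m := m) (f := fun y => v₀ y - γ * powSol m y) hx0 hxX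
  rw [hh, relSize_of_le hxX]
  refine (div_le_iff₀ hφ).2 ?_
  have hex : e x = _ := I.error_eq H (γ := γ) hx
  rw [hex]
  refine (norm_add_le _ _).trans ((add_le_add ((norm_sub_le _ _).trans (add_le_add
    ((norm_add_le _ _).trans (add_le_add hdata hv.le)) hq)) hint).trans_eq ?_)
  ring

end InnerProblem

namespace PotAssumption

variable {m : ℂ} {δ : ℝ} {Q : ℝ → ℂ}

/-- The renormalized Jost solution fits into `InnerProblem` with data of size
`∫_{1/(2|k|)}^∞ y |Q(y)| dy`. -/
theorem exists_innerProblem (H : PotAssumption m δ Q) (hm : 0 < m.re) {a : ℝ} (ha : 0 < a) :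
    ∃ L C₁ C₀ C₂ : ℝ, (0 ≤ L ∧ 0 ≤ C₁ ∧ 0 ≤ C₀ ∧ 0 ≤ C₂) ∧ ∀ k : ℂ, 0 ≤ k.re → k ≠ 0 → a ≤ 1 / ‖k‖ / 2 →
      ∃ d' : ℝ → ℂ, InnerProblem m (k ^ 2) Q
        (fun x => vFactor m k * jostSol k (fullPot m Q) x - vFactor m k * wZero m k x) d'
        (fun x => vFactor m k * wZero m k x) a (1 / ‖k‖) L C₁ C₀
        (C₂ * tail (fun y => y * ‖Q y‖) (1 / ‖k‖ / 2)) := by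
  obtain ⟨L, hL0, hL⟩ := exists_kernel_bound hm ha
  obtain ⟨C₁, hC₁0, hC₁⟩ := exists_data_bound hm
  obtain ⟨C₀, hC₀0, hC₀⟩ := exists_vFactor_mul_wZero_bound hm
  obtain ⟨Cv, hCv0, hCv⟩ := exists_vFactor_bound m
  set c : ℂ := m ^ 2 - 1 / 4 with hc
  set P₀ : ℝ → ℂ := fun t => c / (t : ℂ) ^ 2 with hP₀
  set r := tail (fun y => y * ‖Q y‖) with hr
  have hQ0 : ∀ y, a < y → 0 ≤ y * ‖Q y‖ := fun y hy =>
    mul_nonneg (ha.trans hy).le (norm_nonneg _)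
  have hQi := H.integrableOn_id_mul ha
  have hra : 0 ≤ r a := tail_nonneg hQ0 le_rfl
  -- A bound, uniform in k, for the tails from 1/(2|k|) divided by |k| of the centrifugal and the
  -- full potentials.
  set τ := 2 * ‖c‖ + 2 * r a with hτ
  have hτ0 : 0 ≤ τ := by positivity
  refine ⟨L, C₁, C₀, Cv * (4 * Real.exp (4 * τ) * (1 + τ) * 2),
    ⟨hL0, hC₁0, hC₀0, by positivity⟩, fun k hk hk0 hak => ?_⟩
  have hkn := norm_pos_iff.2 hk0
  set X := 1 / ‖k‖ with hX
  have hX0 : 0 < X := by positivity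
  have hkX : ‖k‖ * X = 1 := by rw [hX]; field_simp
  have hb0 : 0 < X / 2 := by positivity
  have haX : a < X := by linarith
  have hrX : 0 ≤ r (X / 2) := tail_nonneg hQ0 hak
  have hrXa : r (X / 2) ≤ r a := tail_anti hQi hQ0 le_rfl hak
  have hP₀i : ∀ b, 0 < b → IntegrableOn P₀ (Ioi b) := fun b hb => integrableOn_centrifugal _ hb
  have hP₁i : ∀ b, 0 < b → IntegrableOn (fullPot m Q) (Ioi b) := fun b hb =>
    H.integrableOn_fullPot hb
  have hdiv : ∀ z : ℝ, z / ‖k‖ = z * X := fun z => by rw [hX]; ring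
  have hxx : (X / 2)⁻¹ * X = 2 := by field_simp
  have t0 : tail (fun y => ‖P₀ y‖) (X / 2) / ‖k‖ = 2 * ‖c‖ := by
    rw [hP₀, tail_centrifugal c hb0, hdiv, div_eq_mul_inv]
    linear_combination ‖c‖ * hxx
  have tQ : tail (fun y => ‖Q y‖) (X / 2) / ‖k‖ ≤ 2 * r (X / 2) := by
    rw [hdiv]
    calc _ ≤ (X / 2)⁻¹ * r (X / 2) * X :=
          mul_le_mul_of_nonneg_right (H.tail_potential_le hb0) hX0.le
      _ = _ := by linear_combination r (X / 2) * hxx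
  have t1 : tail (fun y => ‖fullPot m Q y‖) (X / 2) / ‖k‖ ≤ τ := by
    have h1 : tail (fun y => ‖fullPot m Q y‖) (X / 2) ≤
        tail (fun y => ‖P₀ y‖) (X / 2) + tail (fun y => ‖Q y‖) (X / 2) := by
      rw [tail, tail, tail, ← integral_add (hP₀i _ hb0).norm (H.integrableOn_potential hb0).norm]
      exact integral_mono (hP₁i _ hb0).norm
        ((hP₀i _ hb0).norm.add (H.integrableOn_potential hb0).norm) fun y => norm_add_le _ _
    calc _ ≤ (tail (fun y => ‖P₀ y‖) (X / 2) + tail (fun y => ‖Q y‖) (X / 2)) / ‖k‖ := by gcongr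
      _ ≤ _ := by rw [add_div, t0]; linarith
  have tσ : tail (fun y => ‖fullPot m Q y - P₀ y‖) (X / 2) / ‖k‖ ≤ 2 * r (X / 2) := by
    simpa only [fullPot, hP₀, ← hc, add_sub_cancel_left] using tQ
  -- The comparison starts at X/2 and is read at X; the source mass 2 r(X/2) tends to 0 with k.
  obtain ⟨D1, D2⟩ := norm_jostSol_sub_le hk hk0 hP₀i hP₁i hb0 (show X / 2 < X by linarith)
    (t0.le.trans (by linarith)) t1 tσ
  have hw₀ : ∀ x, 0 < x → wZero m k x = jostSol k P₀ x := fun x hx =>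
    wZero_eq_jostSol hm hk hk0 hx
  have hvf := hCv k hk hk0
  rw [← hX] at hvf
  set W := 4 * Real.exp (4 * τ) * (1 + τ) * (2 * r (X / 2)) with hW
  have hW0 : 0 ≤ W := by positivity
  have hε0 : 0 ≤ Cv * (4 * Real.exp (4 * τ) * (1 + τ) * 2) * r (X / 2) := by positivity
  have hεW : Cv * (4 * Real.exp (4 * τ) * (1 + τ) * 2) * r (X / 2) = Cv * W := by rw [hW]; ring
  have hpX := Real.rpow_pos_of_pos hX0 (1 / 2 - m.re)
  have S₁ := (H.secondPrimitive_jostSol_fullPot hk hk0).const_mul (vFactor m k)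
  have S₀ := (secondPrimitive_jostSol hk hk0 hP₀i).const_mul (vFactor m k)
  refine ⟨fun x => vFactor m k * jostSolDeriv k (fullPot m Q) x -
    vFactor m k * jostSolDeriv k P₀ x, ha, haX, hL0, hC₁0, hC₀0, hε0, hQi, hL,
    fun x hx hxX => ?_, ?_, ?_, ?_, fun x hx hxX => ?_⟩
  · refine hC₁ _ x X _ _ hε0 hx hxX ?_ ?_
    · rw [hw₀ X hX0, ← mul_sub, norm_mul, hεW]
      have hle : ‖jostSol k (fullPot m Q) X - jostSol k P₀ X‖ ≤ W := D1.trans (by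
        rw [hW]
        refine mul_le_mul_of_nonneg_right ?_ (by positivity)
        exact le_mul_of_one_le_right (by positivity) (by linarith))
      calc _ ≤ (Cv * X ^ (1 / 2 - m.re)) * W := by gcongr
        _ = _ := by ring
    · rw [← mul_sub, norm_mul, hεW]
      have hXi : X⁻¹ = ‖k‖ := by rw [hX]; simp
      calc _ ≤ (Cv * X ^ (1 / 2 - m.re)) * (‖k‖ * W) := by gcongr
        _ = _ := by rw [hXi]; ring
  · rw [norm_pow]
    exact le_of_eq (by linear_combination (‖k‖ * X + 1) * hkX)
  · refine (S₁.sub S₀).congr (fun x hx => ?_) ?_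
    · simp only
      rw [hw₀ x hx]
    · refine (ae_restrict_iff' measurableSet_Ioi).2 (ae_of_all _ fun t ht => ?_)
      simp only [hP₀]
      rw [hw₀ t ht, ← hc]
      ring
  · exact continuousOn_const.mul (secondPrimitive_wZero hm hk hk0).continuousOn
  · refine hC₀ k x hk hk0 (ha.trans hx) ?_
    calc x * ‖k‖ ≤ X * ‖k‖ := by gcongr
      _ = 1 := by linarith

/-- The renormalized Jost solutions converge to the zero-energy solution. -/
theorem tendsto_jostV (H : PotAssumption m δ Q) (hm : 0 < m.re) {x : ℝ} (hx : 0 < x) :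
    Tendsto (fun k => jostV m k Q x) kFilter (𝓝 (1 / 2 * Complex.Gamma m * zeroSol m Q x)) := by
  set γ := 1 / 2 * Complex.Gamma m with hγ
  set a := x / 2 with ha_def
  have ha : 0 < a := by positivity
  have hax : a < x := by rw [ha_def]; linarith
  obtain ⟨L, C₁, C₀, C₂, ⟨hL0, hC₁0, hC₀0, hC₂0⟩, hI⟩ := H.exists_innerProblem hm ha
  obtain ⟨Mq, hMq0, hMq⟩ := H.exists_zeroSol_bound ha
  set r := tail (fun y => y * ‖Q y‖) with hr
  have hQ0 : ∀ y, a < y → 0 ≤ y * ‖Q y‖ := fun y hy =>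
    mul_nonneg (ha.trans hy).le (norm_nonneg _)
  have hQi := H.integrableOn_id_mul ha
  set E := Real.exp (2 * (L * (1 + r a))) with hE
  have hXlim : Tendsto (fun k : ℂ => 1 / ‖k‖) kFilter atTop := by
    have h1 : kFilter ≤ 𝓝[≠] 0 := nhdsWithin_mono _ fun k hk => hk.2
    have := (tendsto_norm_nhdsNE_zero (E := ℂ)).inv_tendsto_nhdsGT_zero.mono_left h1
    simp only [one_div]
    exact this
  have hX2lim : Tendsto (fun k : ℂ => 1 / ‖k‖ / 2) kFilter atTop :=
    hXlim.atTop_div_const two_pos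
  -- The splitting point is Y = |k|^{-1/2}: it tends to infinity, while |k|²Y² = |k| tends to 0.
  have hYlim : Tendsto (fun k : ℂ => √(1 / ‖k‖)) kFilter atTop :=
    Real.tendsto_sqrt_atTop.comp hXlim
  have hrlim : Tendsto r atTop (𝓝 0) := tendsto_tail hQi
  have hnorm : Tendsto (fun k : ℂ => ‖k‖) kFilter (𝓝 0) := by
    simpa using (continuous_norm.tendsto (0 : ℂ)).mono_left kFilter_le
  set ε : ℂ → ℝ := fun k => C₂ * r (1 / ‖k‖ / 2) with hε
  have hεlim : Tendsto ε kFilter (𝓝 0) := by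
    have := (hrlim.comp hX2lim).const_mul C₂
    rwa [mul_zero] at this
  set B₁ : ℂ → ℝ := fun k => 2 * (C₁ * ε k + L * C₀ * r a) * E with hB₁
  set B₂ : ℂ → ℝ := fun k => 2 * (C₁ * ε k + L * C₀ * r (√(1 / ‖k‖))) * E with hB₂
  have hB₁lim : Tendsto B₁ kFilter (𝓝 (2 * (C₁ * 0 + L * C₀ * r a) * E)) :=
    (((hεlim.const_mul C₁).add_const _).const_mul 2).mul_const E
  have hB₂lim : Tendsto B₂ kFilter (𝓝 0) := by
    have := (((hεlim.const_mul C₁).add ((hrlim.comp hYlim).const_mul (L * C₀))).const_mul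
      2).mul_const E
    rwa [mul_zero, mul_zero, add_zero, mul_zero, zero_mul] at this
  -- The part of the inhomogeneity that is uniform in y: data at X, energy term, and the part of the
  -- integral for q beyond X.
  set D : ℂ → ℝ := fun k => C₁ * ε k + L * (‖k‖ * B₁ k + B₂ k) + L * (‖γ‖ * Mq) * r (1 / ‖k‖)
    with hD
  have hDlim : Tendsto D kFilter (𝓝 0) := by
    have := ((hεlim.const_mul C₁).add (((hnorm.mul hB₁lim).add hB₂lim).const_mul L)).add
      ((hrlim.comp hXlim).const_mul (L * (‖γ‖ * Mq)))
    rwa [mul_zero, zero_mul, mul_zero, add_zero, add_zero, zero_add, mul_zero] at this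
  -- The distance of v_m^0 from its limit tends to 0 only pointwise in y, and is bounded uniformly.
  -- This is why Grönwall's inequality is used with a variable inhomogeneity.
  set s : ℂ → ℝ → ℝ := fun k =>
    relSize m (1 / ‖k‖) (fun y => vFactor m k * wZero m k y - γ * powSol m y) with hs
  have hslim : ∀ y, a < y → Tendsto (fun k => s k y) kFilter (𝓝 0) := by
    intro y hy
    have hy0 := ha.trans hy
    have h1 := ((tendsto_vFactor_mul_wZero hm hy0).sub_const (γ * powSol m y)).norm.div_const
      (y ^ (1 / 2 - m.re))
    rw [← hγ, sub_self, norm_zero, zero_div] at h1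
    refine squeeze_zero (fun k => relSize_nonneg hy0) (fun k => ?_) h1
    rcases le_or_gt y (1 / ‖k‖) with h | h
    · exact (relSize_of_le h).le
    · rw [hs]
      simp only
      rw [relSize_of_gt h]
      positivity
  have hev : ∀ᶠ k in kFilter, (0 ≤ k.re ∧ k ≠ 0) ∧ a ≤ 1 / ‖k‖ / 2 ∧ a ≤ √(1 / ‖k‖) ∧
      x ≤ 1 / ‖k‖ ∧ D k ≤ 1 :=
    eventually_kFilter.and ((hX2lim.eventually_ge_atTop a).and ((hYlim.eventually_ge_atTop a).and
      ((hXlim.eventually_ge_atTop x).and (hDlim.eventually_le_const one_pos))))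
  set ρ : ℝ → ℝ := fun y => L * (y * ‖Q y‖) with hρ
  have hρi : IntegrableOn ρ (Ioi a) := hQi.const_mul L
  have hρ0 : ∀ y, a < y → 0 ≤ ρ y := fun y hy => mul_nonneg hL0 (hQ0 y hy)
  have hra : 0 ≤ r a := tail_nonneg hQ0 le_rfl
  have hs0 : ∀ k y, a < y → 0 ≤ s k y := fun k y hy => relSize_nonneg (ha.trans hy)
  have hfacts : ∀ k : ℂ, (0 ≤ k.re ∧ k ≠ 0) ∧ a ≤ 1 / ‖k‖ / 2 ∧ a ≤ √(1 / ‖k‖) ∧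
      x ≤ 1 / ‖k‖ ∧ D k ≤ 1 → (0 ≤ ε k ∧ 0 ≤ B₁ k ∧ 0 ≤ B₂ k ∧ 0 ≤ D k) ∧
      (∀ y, a < y → s k y ≤ C₀ + ‖γ‖) ∧
      AEStronglyMeasurable (s k) (volume.restrict (Ioi a)) := by
    rintro k ⟨⟨hk, hk0⟩, h1, h2, h3, h4⟩
    obtain ⟨d', I⟩ := hI k hk hk0 h1
    have hε0 : 0 ≤ ε k := mul_nonneg hC₂0 (tail_nonneg hQ0 h1)
    have hrY : 0 ≤ r (√(1 / ‖k‖)) := tail_nonneg hQ0 h2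
    have hrX : 0 ≤ r (1 / ‖k‖) := tail_nonneg hQ0 (hax.le.trans h3)
    have hB₁0 : 0 ≤ B₁ k := by simp only [hB₁]; positivity
    have hB₂0 : 0 ≤ B₂ k := by simp only [hB₂]; positivity
    refine ⟨⟨hε0, hB₁0, hB₂0, by simp only [hD]; positivity⟩, fun y hy => ?_, ?_⟩
    · refine relSize_le (by positivity) (ha.trans hy) fun hyX => ?_
      refine (norm_sub_le _ _).trans ?_
      rw [norm_mul γ, norm_powSol m (ha.trans hy), add_mul]
      exact add_le_add (I.bound y hy hyX) le_rfl
    · exact aestronglyMeasurable_relSize ha.le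
        (I.continuousOn.sub (continuousOn_const.mul (fundPair_zero m).continuousOn_u))
  -- Dominated convergence against ρ: on the eventual set of k, D is at most 1 and s at most C₀ +
  -- ‖γ‖.
  have hAlim : Tendsto (fun k => ∫ y in Ioi a, ρ y * (D k + s k y)) kFilter (𝓝 0) := by
    have h0 : (0 : ℝ) = ∫ y in Ioi a, ρ y * (0 + 0) := by simp
    rw [h0]
    refine tendsto_integral_filter_of_dominated_convergence
      (fun y => ρ y * (1 + (C₀ + ‖γ‖))) ?_ ?_ (hρi.mul_const _) ?_
    · filter_upwards [hev] with k hk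
      exact hρi.aestronglyMeasurable.mul (aestronglyMeasurable_const.add (hfacts k hk).2.2)
    · filter_upwards [hev] with k hk
      obtain ⟨⟨-, -, -, hD0⟩, hb, -⟩ := hfacts k hk
      filter_upwards [ae_restrict_mem measurableSet_Ioi] with y hy
      have e1 := hρ0 y hy
      have e2 := hs0 k y hy
      rw [Real.norm_of_nonneg (by positivity)]
      gcongr
      · exact hk.2.2.2.2
      · exact hb y hy
    · filter_upwards [ae_restrict_mem measurableSet_Ioi] with y hy
      exact (hDlim.add (hslim y hy)).const_mul _
  have hmain : ∀ᶠ k in kFilter, ‖jostV m k Q x - γ * zeroSol m Q x‖ ≤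
      (D k + s k x + 2 * (∫ y in Ioi a, ρ y * (D k + s k y)) * Real.exp (2 * tail ρ a)) *
        x ^ (1 / 2 - m.re) := by
    filter_upwards [hev] with k hk
    obtain ⟨⟨hε0, hB₁0, hB₂0, hD0⟩, hsb, hsm⟩ := hfacts k hk
    obtain ⟨⟨hkre, hk0⟩, h1, h2, h3, h4⟩ := hk
    obtain ⟨d', I⟩ := hI k hkre hk0 h1
    set d : ℝ → ℂ := fun x => vFactor m k * jostSol k (fullPot m Q) x - vFactor m k * wZero m k x
    set v₀ : ℝ → ℂ := fun x => vFactor m k * wZero m k x with hv₀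
    set e : ℝ → ℂ := fun y => d y + v₀ y - γ * zeroSol m Q y with he
    have hec : ContinuousOn e (Ioi 0) := I.continuousOn_error H
    obtain ⟨M, hM⟩ := exists_relSize_le ha (1 / ‖k‖) (m := m) hec
    have hY2 : ‖k ^ 2‖ * √(1 / ‖k‖) ^ 2 = ‖k‖ := by
      have := norm_pos_iff.2 hk0
      rw [Real.sq_sqrt (by positivity), norm_pow]
      field_simp
    have hgr : ∀ y, a < y → relSize m (1 / ‖k‖) e y ≤ (D k + s k y) +
        ∫ t in Ioi y, ρ t * relSize m (1 / ‖k‖) e t := by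
      intro y hy
      -- The endpoint a itself supplies the uniform bound `B₁`, and the splitting point supplies the
      -- vanishing bound `B₂`.
      have := I.relSize_error_le H (γ := γ) hMq0 hMq h2 hB₁0 hB₂0
        (fun t ht htX => I.norm_le_of_data le_rfl ht htX)
        (fun t ht htX => I.norm_le_of_data h2 ht htX) hy
      rwa [hY2] at this
    have hηi : IntegrableOn (fun y => ρ y * (D k + s k y)) (Ioi a) := by
      refine Integrable.mul_bdd (c := D k + (C₀ + ‖γ‖)) hρi (aestronglyMeasurable_const.add hsm) ?_
      filter_upwards [ae_restrict_mem measurableSet_Ioi] with y hy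
      rw [Real.norm_of_nonneg (add_nonneg hD0 (hs0 k y hy))]
      linarith [hsb y hy]
    have hfin := backward_gronwall_inhomogeneous hρi hρ0
      (fun y hy => relSize_nonneg (ha.trans hy)) hM
      (aestronglyMeasurable_relSize ha.le hec)
      (fun y hy => add_nonneg hD0 (hs0 k y hy)) hηi hgr hax
    have hex : jostV m k Q x - γ * zeroSol m Q x = e x := by
      rw [H.jostV_eq hm hkre hk0 hx]
      simp only [he, d, hv₀]
      ring
    rw [hex, norm_eq_relSize (m := m) (f := e) hx h3]
    exact mul_le_mul_of_nonneg_right hfin (Real.rpow_pos_of_pos hx _).le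
  have hlim := (((hDlim.add (hslim x hax)).add ((hAlim.const_mul 2).mul_const
    (Real.exp (2 * tail ρ a)))).mul_const (x ^ (1 / 2 - m.re)))
  rw [mul_zero, zero_mul, add_zero, add_zero, zero_mul] at hlim
  exact tendsto_sub_nhds_zero_iff.1 (squeeze_zero_norm' hmain hlim)

end PotAssumption

end

end PerturbedBessel

theorem mainTheorem5 (m : ℂ) (δ : ℝ) (hδ : 1 + 2 * max (-m.re) 0 ≤ δ) (Q : ℝ → ℂ)
    (hQ : m ≠ 0 → Q ∈ PerturbedBessel.potInfty δ)
    (hQ0 : m = 0 → Q ∈ PerturbedBessel.potInftyLog δ) :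
    ∃ q : ℝ → ℂ,
      -- `q = (1 + G⁰_← Q)⁻¹ x^{1/2-m}`, and so `(1 + G⁰_← Q)⁻¹ u⁰_{-m}(·,0) = q / Γ(1-m)`
      PerturbedBessel.IsBackwardInverse m Q (fun x : ℝ => x ^ (1 / 2 - m.re))
        (PerturbedBessel.powSol m) q ∧
      PerturbedBessel.IsBackwardInverse m Q (fun x : ℝ => x ^ (1 / 2 - m.re))
        (PerturbedBessel.uZero (-m)) (fun x => q x / Complex.Gamma (1 - m)) ∧
      -- `q` is the unique solution with the prescribed behavior at infinity
      PerturbedBessel.IsZeroEnergySolution m δ Q q ∧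
      (∀ g : ℝ → ℂ, PerturbedBessel.IsZeroEnergySolution m δ Q g →
        Set.EqOn g q (Set.Ioi 0)) ∧
      -- the Jost solutions are well defined and, renormalized, converge to `Γ(m) q / 2`
      (0 < m.re →
        (∀ k : ℂ, 0 ≤ k.re → k ≠ 0 →
          PerturbedBessel.IsJostSolution m k Q (PerturbedBessel.jostW m k Q) ∧
          ∀ w : ℝ → ℂ, PerturbedBessel.IsJostSolution m k Q w →
            Set.EqOn w (PerturbedBessel.jostW m k Q) (Set.Ioi 0)) ∧
        ∀ x : ℝ, 0 < x →
          Filter.Tendsto (fun k : ℂ => PerturbedBessel.jostV m k Q x)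
            (nhdsWithin 0 {k : ℂ | 0 ≤ k.re ∧ k ≠ 0})
            (nhds (1 / 2 * Complex.Gamma m * q x))) := by
  have H := PerturbedBessel.potAssumption hδ hQ hQ0
  refine ⟨PerturbedBessel.zeroSol m Q, H.isBackwardInverse, H.isBackwardInverse_uZero,
    H.isZeroEnergySolution, fun g hg => H.eqOn_of_isZeroEnergySolution hg, fun hm =>
    ⟨fun k hk hk0 => ⟨H.isJostSolution_jostW hm hk hk0, fun w hw x hx => ?_⟩,
      fun x hx => H.tendsto_jostV hm hx⟩⟩
  rw [H.eqOn_jostSol hm hk hk0 hw hx,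
    H.eqOn_jostSol hm hk hk0 (H.isJostSolution_jostW hm hk hk0) hx]
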